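/- **Setting.** Let $\mathbb{T}^2=\mathbb{R}^2/\mathbb{Z}^2$ and let the time interval be $[0,1]$; $L^pL^q$ denotes $L^p([0,1];L^q(\mathbb{T}^2))$ and $C^0L^1$ denotes $C^0([0,1];L^1(\mathbb{T}^2))$; $\mathbb{N}=\{1,2,\dots\}$. For $u\in L^1([0,1];L^1(\mathbb{T}^2;\mathbb{R}^2))$ with $\nabla\cdot u=0$ in the distributional sense, a *weak solution along $u$ with initial data $f_0\in L^1(\mathbb{T}^2)$* is an $f\in L^1L^1$ with $uf\in L^1L^1$ and $\int_{\mathbb{T}^2\times[0,1)}f(\partial_t\phi+u\cdot\nabla\phi)\,dx\,dt=-\int_{\mathbb{T}^2}f_0\,\phi(\cdot,0)\,dx$ for all $\phi\in C_c^\infty(\mathbb{T}^2\times[0,1))$. It is *renormalised* if, for every bounded continuous $\beta:\mathbb{R}\to\mathbb{R}$, $\beta(f)$ is a weak solution along $u$ with initial data $\beta(f_0)$. A *Lagrangian flow along $u$* is a family of Lebesgue-measure preserving bijections $y_t:\mathbb{T}^2\to\mathbb{T}^2$, $t\in[0,1]$, such that for a.e. $x$ the curve $t\mapsto y_t(x)$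 is absolutely continuous with $\frac{d}{dt}y_t(x)=u(y_t(x),t)$ for a.e. $t$; $f\in L^1L^1$ is a *Lagrangian solution with initial data $f_0$* if $f(\cdot,t)=g\circ y_t^{-1}$ for all $t\in[0,1]$ and $f_0=g\circ y_0^{-1}$, for such a flow and some $g\in L^1(\mathbb{T}^2)$. For $i\in\{1,2\}$ let $\hat i$ be the other index. For $L\in\mathbb{N}$ let $u^{(i;L)}(x)=e_i$ if $x_{\hat i}\in[\frac{m}{2L},\frac{m+1}{2L})$ with $m$ even, and $u^{(i;L)}(x)=-e_i$ if $m$ is odd; put $y^{(i;L)}_t(x)=x+t\,u^{(i;L)}(x)$ for $t\in\mathbb{R}$. Let $\mathcal{D}=\{(k,m):k\in\mathbb{N},\,m\in\mathbb{Z},\,0\le m<2^k\}$ and $\mathcal{D}_K=\{(k,m)\in\mathcal{D}:k\le K\}$. Write $(k_1,m_1)<_{\mathrm{time}}(k_2,m_2)$ if $m_12^{-k_1}<m_22^{-k_2}$, or if $m_12^{-k_1}=m_22^{-k_2}$ and $k_1<k_2$. Put $t_{k,m}=\sum_{(k',m')<_{\mathrm{time}}(k,m)}2^{-2k'}$, the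 sum being over $(k',m')\in\mathcal{D}$. Let $i_k\in\{1,2\}$, $L_k\in\mathbb{N}$, $\tau_k>0$ $(k\in\mathbb{N})$ satisfy the *Finiteness Condition* $\tau_k<2^{-2k}$ for all $k\in\mathbb{N}$, so that the intervals $[t_{k,m},t_{k,m}+\tau_k]$, $(k,m)\in\mathcal{D}$, are disjoint subsets of $[0,1]$. Define $u_K(x,t)=u^{(i_k;L_k)}(x)$ if $t\in[t_{k,m},t_{k,m}+\tau_k]$ for some $(k,m)\in\mathcal{D}_K$, and $u_K(x,t)=0$ otherwise; define $u_\infty$ in the same way with $\mathcal{D}$ in place of $\mathcal{D}_K$. Let $f_0\in L^\infty(\mathbb{T}^2)$. **Proposition.** (1) For each $K\in\mathbb{N}$ there is a weak solution $f^K$ along $u_K$ with initial data $f_0$, unique in the class of all weak solutions. Moreover $f^K\in(C^0L^1)\cap(L^\infty L^\infty)$, and $f^K$ is a Lagrangian solution and a renormalised weak solution with initial data $f_0$. (2) Suppose in addition the *Cancellation Conditions*: for all $k\in\mathbb{N}$, $i_{k+1}\neq i_k$, $2\tau_{k+1}=\frac1{2L_k}$, and $2L_{k+1}\tau_k$ is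 an odd integer. Then there are $f^{\mathrm{even}},f^{\mathrm{odd}}\in L^\infty L^\infty$, weak-$*$ continuous as maps $[0,1]\to L^\infty(\mathbb{T}^2)$, such that $f^{2K}\to f^{\mathrm{even}}$ and $f^{2K+1}\to f^{\mathrm{odd}}$ as $K\to\infty$, both in weak-$*$ $L^\infty L^\infty$ and strongly in $L^pL^\infty$ for every $p\in[1,\infty)$. The sequences $f^{2K}$ and $f^{2K+1}$ are eventually constant (equal to $f^{\mathrm{even}}$, respectively $f^{\mathrm{odd}}$) on $\mathbb{T}^2\times[t_{k,m},t_{k,m}+2^{-2k}]$ for every $(k,m)\in\mathcal{D}$, and on $\mathbb{T}^2\times\{1\}$. Both $f^{\mathrm{even}}$ and $f^{\mathrm{odd}}$ are renormalised weak solutions along $u_\infty$ with initial data $f_0$, and $$f^{\mathrm{even}}(\cdot,1)=f_0,\qquad f^{\mathrm{odd}}(\cdot,1)=f_0\circ y^{(i_1;L_1)}_{-2\tau_1}.$$ If $f_0$ is not (a.e. equal to a) constant, then $f^{\mathrm{even}}\neq f^{\mathrm{odd}}$ as elements of $L^\infty L^\infty$. -/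

import Mathlib

open MeasureTheory Filter Topology Set
open scoped ContDiff ENNReal

noncomputable section

namespace FractalShear

/-! ### The torus, space-time, and test functions -/

/-- The two-dimensional unit torus `ℝ² / ℤ²`, with its normalised Lebesgue measure `volume`.
The coordinates `1, 2` of the text are the elements `0, 1` of `Fin 2`. -/
abbrev T2 : Type := Fin 2 → UnitAddCircle

/-- The quotient map `ℝ² → ℝ² / ℤ²`. -/
def toT2 (x : Fin 2 → ℝ) : T2 := fun j => (x j : UnitAddCircle)

/-- Lebesgue measure on `[0,1] × 𝕋²` (time comes first). -/
def spaceTime : Measure (ℝ × T2) :=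
  ((volume : Measure ℝ).restrict (Icc 0 1)).prod (volume : Measure T2)

/-- Test functions in `C_c^∞(𝕋² × [0,1))`: functions that are smooth (as periodic functions, up to
and including `t = 0`) and vanish for times close to `1`. -/
structure IsTestFunction (φ : ℝ → T2 → ℝ) : Prop where
  smooth : ContDiff ℝ ∞ (fun p : ℝ × (Fin 2 → ℝ) => φ p.1 (toT2 p.2))
  vanish : ∃ s < (1 : ℝ), ∀ t, s ≤ t → ∀ x, φ t x = 0

/-- The time derivative. -/
def timeDeriv (φ : ℝ → T2 → ℝ) (t : ℝ) (x : T2) : ℝ := deriv (fun s => φ s x) t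

/-- The spatial partial derivative in the direction of the `j`-th coordinate. -/
def partialDeriv (j : Fin 2) (φ : ℝ → T2 → ℝ) (t : ℝ) (x : T2) : ℝ :=
  deriv (fun h : ℝ => φ t (x + Pi.single j (h : UnitAddCircle))) 0

/-- `(u · ∇φ)(x, t)`. -/
def advect (u : ℝ → T2 → (Fin 2 → ℝ)) (φ : ℝ → T2 → ℝ) (t : ℝ) (x : T2) : ℝ :=
  ∑ j, u t x j * partialDeriv j φ t x

/-! ### Weak, renormalised and Lagrangian solutions on the time interval `[0,1]` -/

/-- `u ∈ L¹([0,1]; L¹(𝕋²; ℝ²))` with `∇ · u = 0` in the sense of distributions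
on `𝕋² × (0,1)`. -/
structure IsDivFree (u : ℝ → T2 → (Fin 2 → ℝ)) : Prop where
  integrable : Integrable (fun p : ℝ × T2 => u p.1 p.2) spaceTime
  div_free : ∀ φ : ℝ → T2 → ℝ, IsTestFunction φ → (∃ r > (0 : ℝ), ∀ t ≤ r, ∀ x, φ t x = 0) →
    ∫ p, advect u φ p.1 p.2 ∂spaceTime = 0

/-- `f` is a weak solution of `∂ₜ f + ∇ · (u f) = 0` on `𝕋² × [0,1]` with initial data `f₀`. -/
structure IsWeakSolution (u : ℝ → T2 → (Fin 2 → ℝ)) (f₀ : T2 → ℝ) (f : ℝ → T2 → ℝ) : Prop where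
  velocity : IsDivFree u
  data : Integrable f₀ volume
  integrable : Integrable (fun p : ℝ × T2 => f p.1 p.2) spaceTime
  flux : Integrable (fun p : ℝ × T2 => f p.1 p.2 • u p.1 p.2) spaceTime
  weak : ∀ φ : ℝ → T2 → ℝ, IsTestFunction φ →
    ∫ p, f p.1 p.2 * (timeDeriv φ p.1 p.2 + advect u φ p.1 p.2) ∂spaceTime
      = - ∫ x, f₀ x * φ 0 x

/-- Renormalised weak solutions. -/
structure IsRenormalised (u : ℝ → T2 → (Fin 2 → ℝ)) (f₀ : T2 → ℝ) (f : ℝ → T2 → ℝ) : Prop where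
  weak : IsWeakSolution u f₀ f
  renorm : ∀ β : ℝ → ℝ, Continuous β → (∃ C, ∀ s, |β s| ≤ C) →
    IsWeakSolution u (fun x => β (f₀ x)) (fun t x => β (f t x))

/-- A Lagrangian flow along `u`: measure preserving bijections `y t`, `t ∈ [0,1]`, such that
for a.e. `x` the curve `t ↦ y t x` is absolutely continuous with derivative `u (y t x, t)` for
a.e. `t`. Absolute continuity and derivative of a curve in `ℝ² / ℤ²` are those of a
lift `γ` of the curve to `ℝ²`. -/
structure IsLagrangianFlow (u : ℝ → T2 → (Fin 2 → ℝ)) (y : ℝ → T2 ≃ᵐ T2) : Prop where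
  velocity : IsDivFree u
  measurePreserving : ∀ t ∈ Icc (0 : ℝ) 1, MeasurePreserving (y t) volume volume
  curve : ∀ᵐ x : T2, ∃ γ : ℝ → (Fin 2 → ℝ),
    AbsolutelyContinuousOnInterval γ 0 1 ∧
    (∀ t ∈ Icc (0 : ℝ) 1, toT2 (γ t) = y t x) ∧
    (∀ᵐ t ∂(volume : Measure ℝ).restrict (Icc 0 1), HasDerivAt γ (u t (y t x)) t)

/-- `f` is a Lagrangian solution along `u` with initial data `f₀`:
`f(·,t) = g ∘ y_t⁻¹` for a Lagrangian flow `y` and some `g ∈ L¹` with `f₀ = g ∘ y_0⁻¹`. -/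
def IsLagrangianSolution (u : ℝ → T2 → (Fin 2 → ℝ)) (f₀ : T2 → ℝ) (f : ℝ → T2 → ℝ) : Prop :=
  Integrable (fun p : ℝ × T2 => f p.1 p.2) spaceTime ∧
  ∃ (g : T2 → ℝ) (y : ℝ → T2 ≃ᵐ T2), Integrable g volume ∧ IsLagrangianFlow u y ∧
    f₀ =ᵐ[volume] (fun x => g ((y 0).symm x)) ∧
    ∀ t ∈ Icc (0 : ℝ) 1, f t =ᵐ[volume] (fun x => g ((y t).symm x))

/-! ### Function spaces -/

/-- `f ∈ C⁰([0,1]; L¹(𝕋²))`. -/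
def IsC0L1 (f : ℝ → T2 → ℝ) : Prop :=
  (∀ t ∈ Icc (0 : ℝ) 1, MemLp (f t) 1 volume) ∧
  ∀ t ∈ Icc (0 : ℝ) 1,
    Tendsto (fun s => eLpNorm (fun x => f s x - f t x) 1 volume) (𝓝[Icc 0 1] t) (𝓝 0)

/-- `f ∈ L^∞([0,1]; L^∞(𝕋²))`. -/
def IsLinftyLinfty (f : ℝ → T2 → ℝ) : Prop :=
  MemLp (fun p : ℝ × T2 => f p.1 p.2) ⊤ spaceTime

/-- `f : [0,1] → L^∞(𝕋²)` is continuous for the weak-* topology of `L^∞ = (L¹)*`. -/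
def IsC0WeakStarLinfty (f : ℝ → T2 → ℝ) : Prop :=
  (∀ t ∈ Icc (0 : ℝ) 1, MemLp (f t) ⊤ volume) ∧
  ∀ g : T2 → ℝ, Integrable g volume →
    ContinuousOn (fun t => ∫ x, f t x * g x) (Icc 0 1)

/-- Weak-* convergence in `L^∞([0,1]; L^∞(𝕋²))`, the dual of `L¹([0,1]; L¹(𝕋²))`. -/
def TendstoWeakStar (F : ℕ → ℝ → T2 → ℝ) (f : ℝ → T2 → ℝ) : Prop :=
  ∀ g : ℝ × T2 → ℝ, Integrable g spaceTime →
    Tendsto (fun K => ∫ p, F K p.1 p.2 * g p ∂spaceTime) atTop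
      (𝓝 (∫ p, f p.1 p.2 * g p ∂spaceTime))

/-- The norm of `L^p([0,1]; L^∞(𝕋²))`. -/
def normLpLinfty (p : ℝ) (f : ℝ → T2 → ℝ) : ℝ≥0∞ :=
  (∫⁻ t in Icc (0 : ℝ) 1, (eLpNorm (f t) ⊤ volume) ^ p) ^ (1 / p)

/-! ### Lagrangian shears -/

/-- `1` if `z ∈ [m/(2L), (m+1)/(2L))` modulo `1` for an even `m`, and `-1` if this holds for
an odd `m`. -/
def shearSign (L : ℕ) (z : UnitAddCircle) : ℝ :=
  if Even ⌊2 * (L : ℝ) * (AddCircle.equivIco (1 : ℝ) 0 z : ℝ)⌋ then 1 else -1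

/-- The shear `u^{(i;L)}`; the other index is `1 - i`. -/
def shearField (i : Fin 2) (L : ℕ) (x : T2) : Fin 2 → ℝ :=
  Pi.single i (shearSign L (x (1 - i)))

/-- The flow `y_t^{(i;L)}` of the shear. -/
def shearFlow (i : Fin 2) (L : ℕ) (t : ℝ) (x : T2) : T2 :=
  x + Pi.single i ((t * shearSign L (x (1 - i)) : ℝ) : UnitAddCircle)

/-! ### The dyadic ordering and fractal shear flows -/

/-- The set `𝒟` of pairs `(k, m)` with `k ≥ 1` and `0 ≤ m < 2 ^ k`. -/
def dyadic : Set (ℕ × ℕ) := {p | 1 ≤ p.1 ∧ p.2 < 2 ^ p.1}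

/-- The set `𝒟_K` of pairs `(k, m) ∈ 𝒟` with `k ≤ K`. -/
def dyadicUpTo (K : ℕ) : Set (ℕ × ℕ) := {p | p ∈ dyadic ∧ p.1 ≤ K}

/-- The order `<_time`. -/
def timeLT (p q : ℕ × ℕ) : Prop :=
  (p.2 : ℝ) / 2 ^ p.1 < (q.2 : ℝ) / 2 ^ q.1 ∨
    ((p.2 : ℝ) / 2 ^ p.1 = (q.2 : ℝ) / 2 ^ q.1 ∧ p.1 < q.1)

/-- The times `t_{k,m}`. -/
def startTime (q : ℕ × ℕ) : ℝ :=
  ∑' p : {p : ℕ × ℕ // p ∈ dyadic ∧ timeLT p q}, ((2 : ℝ) ^ (2 * p.1.1))⁻¹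

/-- `τ_k < 2^{-2k}` for all `k ≥ 1`. -/
def FinitenessCondition (τ : ℕ → ℝ) : Prop :=
  ∀ k, 1 ≤ k → τ k < ((2 : ℝ) ^ (2 * k))⁻¹

/-- The cancellation conditions, for all `k ≥ 1`. -/
def CancellationConditions (i : ℕ → Fin 2) (L : ℕ → ℕ) (τ : ℕ → ℝ) : Prop :=
  ∀ k, 1 ≤ k → i (k + 1) ≠ i k ∧ 2 * τ (k + 1) = 1 / (2 * (L k : ℝ)) ∧
    ∃ n : ℤ, Odd n ∧ 2 * (L (k + 1) : ℝ) * τ k = n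

open Classical in
/-- The field equal to `u^{(i_k;L_k)}` at the times `t ∈ [t_{k,m}, t_{k,m} + τ_k]`, `(k,m) ∈ S`,
and `0` at all other times. Under the finiteness condition these intervals are disjoint for
distinct `(k,m) ∈ 𝒟`, so that `(k,m)` is determined by `t`. -/
def fractalField (i : ℕ → Fin 2) (L : ℕ → ℕ) (τ : ℕ → ℝ) (S : Set (ℕ × ℕ))
    (t : ℝ) (x : T2) : Fin 2 → ℝ :=
  if h : ∃ p ∈ S, t ∈ Icc (startTime p) (startTime p + τ p.1) then
    shearField (i h.choose.1) (L h.choose.1) x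
  else 0

/-- The truncated fractal shear flow `u_K`. -/
def truncatedField (i : ℕ → Fin 2) (L : ℕ → ℕ) (τ : ℕ → ℝ) (K : ℕ) : ℝ → T2 → (Fin 2 → ℝ) :=
  fractalField i L τ (dyadicUpTo K)

/-- The fractal shear flow `u_∞`. -/
def limitField (i : ℕ → Fin 2) (L : ℕ → ℕ) (τ : ℕ → ℝ) : ℝ → T2 → (Fin 2 → ℝ) :=
  fractalField i L τ dyadic

/-- The mode of convergence of a subsequence of solutions `F K` to its limit `f`: weak-* in
`L^∞ L^∞`, strongly in `L^p L^∞` for `1 ≤ p < ∞`, and the sequence is eventually constant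
(equal to `f`) on `𝕋² × [t_{k,m}, t_{k,m} + 2^{-2k}]` for each `(k,m) ∈ 𝒟` and on `𝕋² × {1}`. -/
structure FractalConvergence (F : ℕ → ℝ → T2 → ℝ) (f : ℝ → T2 → ℝ) : Prop where
  weakStar : TendstoWeakStar F f
  strong : ∀ p : ℝ, 1 ≤ p →
    Tendsto (fun K => normLpLinfty p (fun t x => F K t x - f t x)) atTop (𝓝 0)
  eventuallyConst : ∀ q ∈ dyadic, ∀ᶠ K in atTop,
    ∀ t ∈ Icc (startTime q) (startTime q + ((2 : ℝ) ^ (2 * q.1))⁻¹), F K t =ᵐ[volume] f t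
  eventuallyConst_one : ∀ᶠ K in atTop, F K 1 =ᵐ[volume] f 1

end FractalShear

end

noncomputable section

namespace FractalShear

/-! ### The torus as a probability space -/

/-! The time axis is self-similar. A block of level `k` has length `4^{-k}` and splits into four
equal quarters: a slot of level `k + 1`, a block of level `k + 1`, a second slot and a second block.
The block with index `(k, m)` begins exactly where the slot of `(k, m)` ends. The whole interval
`[0,1]` is the block of level `0`, and `u_K` vanishes inside blocks of level `K`. Hence the flow of
`u_K` is a finite recursive composition (`blockFlow`) of explicit shears, each piecewise a
translation and so measure preserving.

Existence for fixed `K`: changing variables by the flow and using the fundamental theorem of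
calculus along trajectories shows that `g ∘ y_t⁻¹` satisfies the weak formulation
(`integral_mul_materialDeriv`). Since `β ∘ (g ∘ y_t⁻¹) = (β ∘ g) ∘ y_t⁻¹`, renormalisation comes for
free.

Uniqueness: the difference of two solutions is followed from one time interval to the next, on each
of which the field is a fixed shear or zero. There it is tested against functions carried along by
the shear and cut off away from the stripe boundaries. Removing the cutoff leaves transported
Fourier modes, so almost every slice has vanishing Fourier coefficients
(`VanishesBefore.shear_step`).

Cancellation: over a block of level `k`, the next two levels act as `B A B A`, with `A` the level `k
+ 1` shear for time `τ_{k+1}` and `B` the level `k + 2` shear for time `2 τ_{k+2}`. Each moves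
points by an odd number of the other's stripes, thus flips the sign the other sees, and the product
is the identity (`shearFlow_cancel`). Therefore the flows of `u_n` and `u_{n+2}` agree except inside
the `2^n` blocks of level `n`, of total length `2^{-n}` (`blockFlow_add_two`). This gives all the
convergence claims. Almost every time is eventually resolved, so nonlinear functions of the
solutions also converge and the limits are renormalised. At the remaining times the flows still
converge uniformly, because trajectories are 1-Lipschitz in time; the limiting maps preserve
measure, and the density of the transported `g` yields a weak-* continuous curve.

Non-uniqueness: if both limits agreed, weak-* continuity would make them agree at every time. On the
last block of level `K`, `u_K` does nothing while `u_{K+1}` performs a net shear for time `2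
τ_{K+1}`, so `f₀` would be invariant under that shear, hence under translation by `2 τ_{K+1}` along
its axis. These steps tend to zero in both directions, so they generate a dense group of
translations, and ergodicity makes `f₀` constant (`IsLimitSol.ae_eq_const`). -/

instance isProbabilityMeasure_volume_T2 : IsProbabilityMeasure (volume : Measure T2) := by
  have : IsProbabilityMeasure (volume : Measure UnitAddCircle) := ⟨UnitAddCircle.measure_univ⟩
  rw [volume_pi]
  infer_instance

instance isProbabilityMeasure_spaceTime : IsProbabilityMeasure spaceTime := by
  have : IsProbabilityMeasure ((volume : Measure ℝ).restrict (Icc 0 1)) := ⟨by simp⟩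
  unfold spaceTime
  infer_instance

/-! ### The square wave -/

lemma one_sub_ne (i : Fin 2) : 1 - i ≠ i := by
  fin_cases i <;> decide

lemma eq_one_sub_of_ne {i j : Fin 2} (h : i ≠ j) : i = 1 - j := by
  revert i j; decide

lemma eq_or_eq_one_sub (i j : Fin 2) : j = i ∨ j = 1 - i := by
  revert i j; decide

/-- Reducing `r` modulo `1` changes `2 L r` by the even integer `2 L ⌊r⌋`, so any real
representative can be used to read the parity. -/
lemma shearSign_coe (L : ℕ) (r : ℝ) :
    shearSign L (r : UnitAddCircle) = if Even ⌊2 * (L : ℝ) * r⌋ then 1 else -1 := by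
  unfold shearSign
  have h : (AddCircle.equivIco (1 : ℝ) 0 (r : UnitAddCircle) : ℝ) = Int.fract r := by
    rw [AddCircle.coe_equivIco_mk_apply]
    simp
  rw [h]
  have h2 : 2 * (L : ℝ) * Int.fract r = 2 * (L : ℝ) * r - ((2 * L * ⌊r⌋ : ℤ) : ℝ) := by
    rw [Int.fract]; push_cast; ring
  rw [h2, Int.floor_sub_intCast]
  have h3 : Even (⌊2 * (L : ℝ) * r⌋ - 2 * L * ⌊r⌋) ↔ Even ⌊2 * (L : ℝ) * r⌋ := by
    rw [Int.even_sub]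
    have : Even (2 * (L : ℤ) * ⌊r⌋) := by rw [mul_assoc]; exact even_two_mul _
    simp [this]
  simp only [h3]

lemma shearSign_eq_or (L : ℕ) (z : UnitAddCircle) : shearSign L z = 1 ∨ shearSign L z = -1 := by
  unfold shearSign; split_ifs <;> simp

lemma measurable_shearSign (L : ℕ) : Measurable (shearSign L) := by
  unfold shearSign
  have h : Measurable fun z : UnitAddCircle =>
      ⌊2 * (L : ℝ) * (AddCircle.equivIco (1 : ℝ) 0 z : ℝ)⌋ := by
    have := (AddCircle.measurableEquivIco (1 : ℝ) 0).measurable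
    exact Int.measurable_floor.comp ((measurable_const.mul (measurable_subtype_coe.comp this)))
  exact Measurable.ite (h (MeasurableSpace.measurableSet_top (s := {n : ℤ | Even n})))
    measurable_const measurable_const

/-- Shifting by an odd multiple of the stripe width changes the sign of the square wave. -/
lemma shearSign_add_of_odd {L : ℕ} {c : ℝ} {n : ℤ} (hn : Odd n) (hc : 2 * (L : ℝ) * c = n)
    (z : UnitAddCircle) : shearSign L (z + (c : UnitAddCircle)) = - shearSign L z := by
  induction z using QuotientAddGroup.induction_on with
  | H r =>
    have : ((r : UnitAddCircle) + (c : UnitAddCircle)) = ((r + c : ℝ) : UnitAddCircle) := rfl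
    change shearSign L ((r : UnitAddCircle) + (c : UnitAddCircle)) = -shearSign L (r : UnitAddCircle)
    rw [this, shearSign_coe, shearSign_coe, mul_add, hc, Int.floor_add_intCast]
    have : Even (⌊2 * (L : ℝ) * r⌋ + n) ↔ ¬ Even ⌊2 * (L : ℝ) * r⌋ := by
      rw [Int.even_add, ← Int.not_odd_iff_even (n := n)]
      simp [hn]
    simp only [this]
    split_ifs <;> simp

/-! ### Shears as measure preserving bijections -/

lemma shearFlow_apply_same (i : Fin 2) (L : ℕ) (t : ℝ) (x : T2) :
    shearFlow i L t x i = x i + ((t * shearSign L (x (1 - i)) : ℝ) : UnitAddCircle) := by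
  simp [shearFlow]

lemma shearFlow_apply_other (i : Fin 2) (L : ℕ) (t : ℝ) (x : T2) :
    shearFlow i L t x (1 - i) = x (1 - i) := by
  simp [shearFlow, Pi.single_eq_of_ne (one_sub_ne i)]

lemma shearFlow_add (i : Fin 2) (L : ℕ) (s t : ℝ) (x : T2) :
    shearFlow i L s (shearFlow i L t x) = shearFlow i L (t + s) x := by
  conv_lhs => rw [shearFlow, shearFlow_apply_other]
  rw [shearFlow, shearFlow, add_assoc, ← Pi.single_add, add_mul]
  rfl

@[simp] lemma shearFlow_zero (i : Fin 2) (L : ℕ) (x : T2) : shearFlow i L 0 x = x := by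
  simp [shearFlow]

lemma measurable_shearFlow_uncurry (i : Fin 2) (L : ℕ) :
    Measurable fun p : ℝ × T2 => shearFlow i L p.1 p.2 := by
  unfold shearFlow
  refine measurable_snd.add ?_
  refine measurable_pi_lambda _ fun j => ?_
  have hs : Measurable fun p : ℝ × T2 =>
      ((p.1 * shearSign L (p.2 (1 - i)) : ℝ) : UnitAddCircle) := by
    refine (AddCircle.measurable_mk' (a := (1 : ℝ))).comp ?_
    exact measurable_fst.mul ((measurable_shearSign L).comp
      ((measurable_pi_apply (1 - i)).comp measurable_snd))
  rcases eq_or_ne j i with rfl | h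
  · simpa using hs
  · simp [Pi.single_eq_of_ne h]

lemma measurable_shearFlow (i : Fin 2) (L : ℕ) (t : ℝ) : Measurable (shearFlow i L t) :=
  (measurable_shearFlow_uncurry i L).comp measurable_prodMk_left

/-- The time-`t` shear as a measurable equivalence. -/
def shearEquiv (i : Fin 2) (L : ℕ) (t : ℝ) : T2 ≃ᵐ T2 where
  toFun := shearFlow i L t
  invFun := shearFlow i L (-t)
  left_inv x := by simp [shearFlow_add]
  right_inv x := by simp [shearFlow_add]
  measurable_toFun := measurable_shearFlow i L t
  measurable_invFun := measurable_shearFlow i L (-t)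

@[simp] lemma shearEquiv_apply (i : Fin 2) (L : ℕ) (t : ℝ) (x : T2) :
    shearEquiv i L t x = shearFlow i L t x := rfl

@[simp] lemma shearEquiv_zero (i : Fin 2) (L : ℕ) : shearEquiv i L 0 = MeasurableEquiv.refl T2 := by
  ext x : 2; simp

/-- The union of the stripes on which the shear `u^{(i;L)}` points in the positive direction. -/
def posStripes (i : Fin 2) (L : ℕ) : Set T2 := {x | shearSign L (x (1 - i)) = 1}

lemma measurableSet_posStripes (i : Fin 2) (L : ℕ) : MeasurableSet (posStripes i L) :=
  ((measurable_shearSign L).comp (measurable_pi_apply (1 - i))) (measurableSet_singleton 1)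

/-- Translation by `t` in the `i`-th coordinate direction. -/
def translate (i : Fin 2) (t : ℝ) (x : T2) : T2 := x + Pi.single i (t : UnitAddCircle)

lemma measurePreserving_translate (i : Fin 2) (t : ℝ) :
    MeasurePreserving (translate i t) volume volume :=
  measurePreserving_add_right volume _

lemma translate_mem_posStripes (i : Fin 2) (L : ℕ) (t : ℝ) (x : T2) :
    translate i t x ∈ posStripes i L ↔ x ∈ posStripes i L := by
  simp [translate, posStripes, Pi.single_eq_of_ne (one_sub_ne i)]

lemma shearFlow_of_mem {i : Fin 2} {L : ℕ} {x : T2} (hx : x ∈ posStripes i L) (t : ℝ) :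
    shearFlow i L t x = translate i t x := by
  have h : shearSign L (x (1 - i)) = 1 := hx
  simp [shearFlow, translate, h]

lemma shearFlow_of_notMem {i : Fin 2} {L : ℕ} {x : T2} (hx : x ∉ posStripes i L) (t : ℝ) :
    shearFlow i L t x = translate i (-t) x := by
  have h : shearSign L (x (1 - i)) = -1 := (shearSign_eq_or L _).resolve_left hx
  simp [shearFlow, translate, h]

/-- The positive stripes and their complement are both invariant under translation in direction `i`;
the shear is translation by `t` on the former and by `-t` on the latter. -/
lemma measurePreserving_shearFlow (i : Fin 2) (L : ℕ) (t : ℝ) :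
    MeasurePreserving (shearFlow i L t) volume volume := by
  refine ⟨measurable_shearFlow i L t, ?_⟩
  ext B hB
  rw [Measure.map_apply (measurable_shearFlow i L t) hB]
  have hA := measurableSet_posStripes i L
  rw [← measure_inter_add_sdiff (shearFlow i L t ⁻¹' B) hA, ← measure_inter_add_sdiff B hA]
  congr 1
  · have : shearFlow i L t ⁻¹' B ∩ posStripes i L = translate i t ⁻¹' (B ∩ posStripes i L) := by
      ext x
      simp only [mem_inter_iff, mem_preimage, translate_mem_posStripes]
      constructor <;> rintro ⟨h1, h2⟩ <;> simpa [shearFlow_of_mem h2, h2] using h1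
    rw [this, (measurePreserving_translate i t).measure_preimage (hB.inter hA).nullMeasurableSet]
  · have : shearFlow i L t ⁻¹' B \ posStripes i L = translate i (-t) ⁻¹' (B \ posStripes i L) := by
      ext x
      simp only [Set.mem_sdiff, mem_preimage, translate_mem_posStripes]
      constructor <;> rintro ⟨h1, h2⟩ <;> simpa [shearFlow_of_notMem h2, h2] using h1
    rw [this, (measurePreserving_translate i (-t)).measure_preimage (hB.diff hA).nullMeasurableSet]

/-- Clipping `t - a` to the interval `[0, T]`: the time for which a process started at time `a` and
of duration `T` has run at time `t`. -/
def clip (T a t : ℝ) : ℝ := max 0 (min (t - a) T)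

lemma clip_of_le {T a t : ℝ} (h : t ≤ a) : clip T a t = 0 :=
  max_eq_left ((min_le_left _ _).trans (by linarith))

lemma clip_of_ge {T a t : ℝ} (hT : 0 ≤ T) (h : a + T ≤ t) : clip T a t = T := by
  rw [clip, min_eq_right (by linarith), max_eq_right hT]

lemma clip_of_mem {T a t : ℝ} (h : t ∈ Icc a (a + T)) : clip T a t = t - a := by
  rw [clip, min_eq_left (by linarith [h.2]), max_eq_right (by linarith [h.1])]

lemma continuous_clip (T a : ℝ) : Continuous (clip T a) := by
  unfold clip; fun_prop

lemma abs_clip_sub_le (T a s t : ℝ) : |clip T a s - clip T a t| ≤ |s - t| := by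
  unfold clip
  refine (abs_max_sub_max_le_max _ _ _ _).trans ?_
  refine max_le (by simp) ((abs_min_sub_min_le_max _ _ _ _).trans ?_)
  refine max_le (by simp) (by simp)

/-! ### Strong continuity in `L¹` -/

/-- A family of bijections of the torus acts strongly continuously on `L¹`. -/
def StronglyContinuous (A : ℝ → T2 ≃ᵐ T2) : Prop :=
  ∀ g : T2 → ℝ, Integrable g volume → ∀ t, Tendsto
    (fun s => eLpNorm (fun x => g ((A s).symm x) - g ((A t).symm x)) 1 volume) (𝓝 t) (𝓝 0)

lemma stronglyContinuous_refl : StronglyContinuous fun _ => MeasurableEquiv.refl T2 := by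
  intro g _ t
  simp

/-- The increment splits into an increment of `A` composed with `(B s)⁻¹`, whose norm is unchanged
by measure preservation, and an increment of `B` acting on the fixed function `g ∘ (A t)⁻¹`. -/
lemma StronglyContinuous.trans {A B : ℝ → T2 ≃ᵐ T2} (hA : StronglyContinuous A)
    (hB : StronglyContinuous B) (hmA : ∀ t, MeasurePreserving (A t) volume volume)
    (hmB : ∀ t, MeasurePreserving (B t) volume volume) :
    StronglyContinuous fun t => (A t).trans (B t) := by
  intro g hg t
  have hmA' := fun t => (hmA t).symm (A t)
  have hmB' := fun t => (hmB t).symm (B t)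
  have h1 := hA g hg t
  have h2 := hB (fun x => g ((A t).symm x)) ((hmA' t).integrable_comp_of_integrable hg) t
  have h3 := h1.add h2
  rw [add_zero] at h3
  refine tendsto_of_tendsto_of_tendsto_of_le_of_le tendsto_const_nhds h3 (fun _ => zero_le) ?_
  intro s
  have e1 : (fun x => g (((A s).trans (B s)).symm x) - g (((A t).trans (B t)).symm x)) =
      (fun x => g ((A s).symm x) - g ((A t).symm x)) ∘ (B s).symm +
      fun x => g ((A t).symm ((B s).symm x)) - g ((A t).symm ((B t).symm x)) := by
    funext x
    change g ((A s).symm ((B s).symm x)) - g ((A t).symm ((B t).symm x)) = _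
    simp
  have hms := ((hmA' s).integrable_comp_of_integrable hg).aestronglyMeasurable
  have hmt := ((hmA' t).integrable_comp_of_integrable hg)
  have m1 : AEStronglyMeasurable (fun x => g ((A s).symm x) - g ((A t).symm x)) volume :=
    hms.sub hmt.aestronglyMeasurable
  have m2 : AEStronglyMeasurable
      (fun x => g ((A t).symm ((B s).symm x)) - g ((A t).symm ((B t).symm x))) volume :=
    ((hmB' s).integrable_comp_of_integrable hmt).aestronglyMeasurable.sub
      ((hmB' t).integrable_comp_of_integrable hmt).aestronglyMeasurable
  dsimp only
  rw [e1]
  refine (eLpNorm_add_le (m1.comp_measurePreserving (hmB' s)) m2 le_rfl).trans ?_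
  rw [eLpNorm_comp_measurePreserving m1 (hmB' s)]

lemma measurePreserving_shearEquiv_symm (i : Fin 2) (L : ℕ) (t : ℝ) :
    MeasurePreserving (shearEquiv i L t).symm volume volume :=
  measurePreserving_shearFlow i L (-t)

lemma continuous_shearFlow_time (i : Fin 2) (L : ℕ) (x : T2) :
    Continuous fun t => shearFlow i L t x := by
  unfold shearFlow
  refine continuous_const.add ((continuous_single i).comp ?_)
  exact (AddCircle.continuous_mk' (1 : ℝ)).comp (continuous_id.mul continuous_const)

/-- The shear is discontinuous in space, but each point moves continuously in time. This suffices
for bounded continuous `ψ` by dominated convergence, and approximation in `L¹` costs two further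
errors of `ε / 3`, by measure preservation. -/
lemma stronglyContinuous_shear (i : Fin 2) (L : ℕ) {c : ℝ → ℝ} (hc : Continuous c) :
    StronglyContinuous fun t => shearEquiv i L (c t) := by
  intro g hg t
  have hm := fun s => measurePreserving_shearEquiv_symm i L (c s)
  rw [ENNReal.tendsto_nhds_zero]
  intro ε hε
  have hε3 : ε / 3 ≠ 0 := (ENNReal.div_pos hε.ne' (by simp)).ne'
  obtain ⟨ψ, hψ, hψm⟩ := (memLp_one_iff_integrable.2 hg).exists_boundedContinuous_eLpNorm_sub_le
    ENNReal.one_ne_top hε3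
  have key : Tendsto (fun s => eLpNorm (fun x => ψ ((shearEquiv i L (c s)).symm x) -
      ψ ((shearEquiv i L (c t)).symm x)) 1 volume) (𝓝 t) (𝓝 0) := by
    simp_rw [eLpNorm_one_eq_lintegral_enorm]
    have : (0 : ℝ≥0∞) = ∫⁻ _ : T2, 0 := by simp
    rw [this]
    refine tendsto_lintegral_filter_of_dominated_convergence (fun _ => ‖2 * ‖ψ‖‖ₑ) ?_ ?_ ?_ ?_
    · refine Eventually.of_forall fun s => ?_
      exact ((ψ.continuous.measurable.comp (hm s).measurable).sub
        (ψ.continuous.measurable.comp (hm t).measurable)).enorm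
    · refine Eventually.of_forall fun s => Eventually.of_forall fun x => ?_
      rw [enorm_le_iff_norm_le, Real.norm_of_nonneg (r := 2 * ‖ψ‖) (by positivity), two_mul]
      exact (norm_sub_le _ _).trans (add_le_add (ψ.norm_coe_le_norm _) (ψ.norm_coe_le_norm _))
    · simp [ENNReal.mul_eq_top]
    · refine Eventually.of_forall fun x => ?_
      have h1 : Continuous fun s => ψ ((shearEquiv i L (c s)).symm x) -
          ψ ((shearEquiv i L (c t)).symm x) :=
        (ψ.continuous.comp ((continuous_shearFlow_time i L x).comp hc.neg)).sub continuous_const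
      have h2 := (h1.tendsto t).enorm
      simpa using h2
  rw [ENNReal.tendsto_nhds_zero] at key
  filter_upwards [key (ε / 3) (pos_iff_ne_zero.2 hε3)] with s hs
  have mg : AEStronglyMeasurable (g - ⇑ψ) volume := hg.aestronglyMeasurable.sub
    hψm.aestronglyMeasurable
  have e1 : (fun x => g ((shearEquiv i L (c s)).symm x) - g ((shearEquiv i L (c t)).symm x)) =
      ((g - ⇑ψ) ∘ (shearEquiv i L (c s)).symm - (g - ⇑ψ) ∘ (shearEquiv i L (c t)).symm) +
      fun x => ψ ((shearEquiv i L (c s)).symm x) - ψ ((shearEquiv i L (c t)).symm x) := by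
    funext x
    simp only [Pi.add_apply, Pi.sub_apply, Function.comp_apply]
    ring
  have m1 := fun s => mg.comp_measurePreserving (hm s)
  have m2 : AEStronglyMeasurable (fun x => ψ ((shearEquiv i L (c s)).symm x) -
      ψ ((shearEquiv i L (c t)).symm x)) volume :=
    ((ψ.continuous.measurable.comp (hm s).measurable).sub
        (ψ.continuous.measurable.comp (hm t).measurable)).aestronglyMeasurable
  rw [e1]
  refine (eLpNorm_add_le ((m1 s).sub (m1 t)) m2 le_rfl).trans ?_
  calc _ ≤ (ε / 3 + ε / 3) + ε / 3 := by
        refine add_le_add ((eLpNorm_sub_le (m1 s) (m1 t) le_rfl).trans ?_) hs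
        rw [eLpNorm_comp_measurePreserving mg (hm s), eLpNorm_comp_measurePreserving mg (hm t)]
        exact add_le_add hψ hψ
    _ = ε := ENNReal.add_thirds ε

/-! ### The starting times -/

/-- The length `2^{-2k}` of the time slots of level `k`. -/
def slotLen (k : ℕ) : ℝ := ((2 : ℝ) ^ (2 * k))⁻¹

lemma slotLen_pos (k : ℕ) : 0 < slotLen k := by unfold slotLen; positivity

lemma slotLen_succ (k : ℕ) : slotLen (k + 1) = slotLen k / 4 := by
  unfold slotLen
  rw [mul_add, pow_add]
  field_simp
  norm_num

lemma slotLen_zero : slotLen 0 = 1 := by simp [slotLen]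

lemma slotLen_eq (k : ℕ) : slotLen k = (1 / 4) ^ k := by
  unfold slotLen
  rw [pow_mul, ← inv_pow]
  norm_num

/-- The number of elements of `𝒟` of level `k'` that precede `q`. -/
def countBefore (q : ℕ × ℕ) (k' : ℕ) : ℕ :=
  if k' = 0 then 0 else if k' < q.1 then q.2 / 2 ^ (q.1 - k') + 1 else q.2 * 2 ^ (k' - q.1)

/-- At a coarser level a tie in position still counts as preceding, whence the `+ 1` in
`countBefore`; at the same or a finer level the inequality of positions must be strict. -/
lemma mem_dyadic_and_timeLT_iff {q : ℕ × ℕ} (hq : q ∈ dyadic) (k' m' : ℕ) :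
    ((k', m') ∈ dyadic ∧ timeLT (k', m') q) ↔ m' < countBefore q k' := by
  obtain ⟨k, m⟩ := q
  obtain ⟨hk, hm⟩ := hq
  simp only at hk hm
  unfold countBefore timeLT dyadic
  simp only [mem_ofPred_eq]
  rcases Nat.eq_zero_or_pos k' with rfl | hk'
  · simp
  rw [if_neg hk'.ne']
  rw [div_lt_div_iff₀ (by positivity) (by positivity), div_eq_div_iff (by positivity)
    (by positivity)]
  norm_cast
  split_ifs with h
  · obtain ⟨d, rfl⟩ := Nat.exists_eq_add_of_lt h
    have e : k' + d + 1 - k' = d + 1 := by omega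
    rw [e, Nat.lt_succ_iff (m := m'), Nat.le_div_iff_mul_le (by positivity)]
    have e2 : 2 ^ (k' + d + 1) = 2 ^ k' * 2 ^ (d + 1) := by rw [add_assoc, pow_add]
    rw [e2] at hm ⊢
    have p1 : 0 < 2 ^ k' := by positivity
    have p2 : 0 < 2 ^ (d + 1) := by positivity
    constructor
    · rintro ⟨-, h1 | ⟨h1, -⟩⟩
      · nlinarith
      · nlinarith
    · intro h1
      refine ⟨⟨hk', by nlinarith⟩, ?_⟩
      rcases h1.lt_or_eq with h2 | h2
      · left; nlinarith
      · right; exact ⟨by rw [← h2]; ring, h⟩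
  · obtain ⟨d, rfl⟩ := Nat.exists_eq_add_of_le (not_lt.1 h)
    have e : k + d - k = d := by omega
    rw [e, pow_add]
    have p1 : 0 < 2 ^ k := by positivity
    have p2 : 0 < 2 ^ d := by positivity
    constructor
    · rintro ⟨-, h1 | ⟨h1, h2⟩⟩
      · nlinarith
      · exact absurd h2 h
    · intro h1
      refine ⟨⟨hk', ?_⟩, Or.inl (by nlinarith)⟩
      nlinarith

lemma countBefore_le {q : ℕ × ℕ} (hq : q ∈ dyadic) (k' : ℕ) : countBefore q k' ≤ 2 ^ k' := by
  by_contra h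
  have := (mem_dyadic_and_timeLT_iff hq k' (2 ^ k')).2 (not_le.1 h)
  exact lt_irrefl _ this.1.2

lemma summable_countBefore {q : ℕ × ℕ} (hq : q ∈ dyadic) :
    Summable fun k' => slotLen k' * countBefore q k' := by
  refine Summable.of_nonneg_of_le (fun k' => mul_nonneg (slotLen_pos k').le (Nat.cast_nonneg _))
    (fun k' => ?_) summable_geometric_two
  calc slotLen k' * countBefore q k' ≤ slotLen k' * 2 ^ k' := by
        gcongr
        · exact (slotLen_pos k').le
        · exact_mod_cast countBefore_le hq k'
    _ = (1 / 2) ^ k' := by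
        rw [slotLen_eq, ← mul_pow]; norm_num

/-- Summing level by level turns `startTime` into a single series, so that differences of starting
times can be computed by comparing counts term by term. -/
lemma hasSum_startTime {q : ℕ × ℕ} (hq : q ∈ dyadic) :
    HasSum (fun k' => slotLen k' * countBefore q k') (startTime q) := by
  have h0 : ∀ k', HasSum (fun m' => indicator {p | p ∈ dyadic ∧ timeLT p q}
      (fun p : ℕ × ℕ => slotLen p.1) (k', m')) (slotLen k' * countBefore q k') := by
    intro k'
    have e : ∀ m', indicator {p | p ∈ dyadic ∧ timeLT p q}
      (fun p : ℕ × ℕ => slotLen p.1) (k', m') =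
        if m' ∈ Finset.range (countBefore q k') then slotLen k' else 0 := by
      intro m'
      classical
      rw [indicator_apply]
      simp only [mem_ofPred_eq, mem_dyadic_and_timeLT_iff hq, Finset.mem_range]
    simp_rw [e]
    have h := hasSum_sum_of_ne_finset_zero (L := .unconditional ℕ)
      (s := Finset.range (countBefore q k'))
      (f := fun m' => if m' ∈ Finset.range (countBefore q k') then slotLen k' else 0)
      fun b hb => by simp only [hb, if_false]
    rwa [Finset.sum_ite_mem, Finset.inter_self, Finset.sum_const, Finset.card_range, nsmul_eq_mul,
      mul_comm] at h
  have hs : Summable (indicator {p | p ∈ dyadic ∧ timeLT p q}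
      (fun p : ℕ × ℕ => slotLen p.1)) := by
    rw [summable_prod_of_nonneg]
    · refine ⟨fun k' => (h0 k').summable, ?_⟩
      simp_rw [fun k' => (h0 k').tsum_eq]
      exact summable_countBefore hq
    · exact fun p => indicator_nonneg (fun p _ => (slotLen_pos p.1).le) p
  have h1 := hs.hasSum.prod_fiberwise h0
  rw [← tsum_subtype] at h1
  exact h1

/-! ### Recursion for the starting times -/

lemma startTime_one_zero : startTime (1, 0) = 0 := by
  have hq : ((1, 0) : ℕ × ℕ) ∈ dyadic := by simp [dyadic]
  refine (hasSum_startTime hq).unique ?_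
  have : (fun k' => slotLen k' * countBefore (1, 0) k') = fun _ => 0 := by
    funext k'
    unfold countBefore
    rcases k' with _ | k'
    · simp
    · simp
  rw [this]
  exact hasSum_zero

/-- Both pairs have the same dyadic position and consecutive levels, so the second immediately
succeeds the first: the counts differ only at level `k`, by one. -/
lemma startTime_left {k m : ℕ} (hq : (k, m) ∈ dyadic) :
    startTime (k + 1, 2 * m) = startTime (k, m) + slotLen k := by
  have hq' : (k + 1, 2 * m) ∈ dyadic := by
    obtain ⟨h1, h2⟩ := hq
    refine ⟨Nat.le_add_left _ _, ?_⟩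
    simp only at h2 ⊢
    rw [pow_succ]; omega
  refine (hasSum_startTime hq').unique ?_
  convert (hasSum_startTime hq).add (hasSum_ite_eq k (slotLen k)) using 1
  funext k'
  have hk : 1 ≤ k := hq.1
  unfold countBefore
  rcases Nat.eq_zero_or_pos k' with rfl | hk'
  · have : ¬ (0 = k) := by omega
    simp [this]
  simp only [hk'.ne', if_false]
  rcases lt_trichotomy k' k with h | rfl | h
  · obtain ⟨d, rfl⟩ := Nat.exists_eq_add_of_lt h
    have e1 : k' + d + 1 + 1 - k' = (d + 1) + 1 := by omega
    have e2 : k' + d + 1 - k' = d + 1 := by omega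
    rw [if_pos h, if_pos (by omega), if_neg (by omega), e1, e2, pow_succ 2 (d + 1),
      mul_comm (2 ^ (d + 1)) 2, Nat.mul_div_mul_left _ _ two_pos, add_zero]
  · rw [if_pos (by omega), if_neg (by omega), if_pos rfl]
    simp
    ring
  · obtain ⟨d, rfl⟩ := Nat.exists_eq_add_of_lt h
    have e1 : k + d + 1 - (k + 1) = d := by omega
    have e2 : k + d + 1 - k = d + 1 := by omega
    rw [if_neg (by omega), if_neg (by omega), if_neg (by omega), e1, e2, pow_succ]
    push_cast
    ring

/-- Levels below `k` do not distinguish the two positions, while level `k' ≥ k` gains `2^{k'-k}`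
slots. The gain is the geometric series `∑ 4^{-k'} 2^{k'-k} = 2 · 4^{-k}`. -/
lemma startTime_right {k m : ℕ} (hq : (k, 2 * m + 1) ∈ dyadic) :
    startTime (k, 2 * m + 1) = startTime (k, 2 * m) + 2 * slotLen k := by
  have hk : 1 ≤ k := hq.1
  have hq' : (k, 2 * m) ∈ dyadic := ⟨hq.1, lt_trans (Nat.lt_succ_self _) hq.2⟩
  refine (hasSum_startTime hq).unique ?_
  have hgeo : HasSum (fun k' => if k ≤ k' then slotLen k' * 2 ^ (k' - k) else 0)
      (2 * slotLen k) := by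
    have h1 : HasSum (fun d => slotLen (d + k) * 2 ^ (d + k - k)) (2 * slotLen k) := by
      refine (hasSum_geometric_two.mul_right (slotLen k)).congr_fun fun d => ?_
      rw [Nat.add_sub_cancel, slotLen_eq, slotLen_eq, pow_add, mul_right_comm, ← mul_pow]
      norm_num
    have h2 := (hasSum_nat_add_iff' (f := fun k' => if k ≤ k' then slotLen k' * 2 ^ (k' - k) else 0)
      k (g := 2 * slotLen k)).1
    refine h2 ?_
    rw [Finset.sum_eq_zero, sub_zero]
    · simpa using h1
    · intro j hj
      rw [if_neg (by simpa using hj)]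
  convert (hasSum_startTime hq').add hgeo using 1
  funext k'
  unfold countBefore
  rcases Nat.eq_zero_or_pos k' with rfl | hk'
  · have : ¬ (k ≤ 0) := by omega
    simp [this]
  simp only [hk'.ne', if_false]
  rcases lt_or_ge k' k with h | h
  · obtain ⟨d, rfl⟩ := Nat.exists_eq_add_of_lt h
    have e2 : k' + d + 1 - k' = d + 1 := by omega
    have e3 : (2 * m + 1) / 2 ^ (d + 1) = (2 * m) / 2 ^ (d + 1) := by
      rw [pow_succ', ← Nat.div_div_eq_div_mul, ← Nat.div_div_eq_div_mul]
      congr 1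
      omega
    rw [if_pos h, if_pos h, if_neg (by omega), e2, e3, add_zero]
  · rw [if_neg (by omega), if_neg (by omega), if_pos h]
    push_cast
    ring

/-! ### Blocks and the disjointness of slots -/

/-- The start of the `m`-th block of level `k`, which consists of the slots of `(k + 1, 2m)`,
`(k + 1, 2m + 1)` and all their descendants, and has length `2^{-2k}`. -/
def blockStart (k m : ℕ) : ℝ := startTime (k + 1, 2 * m)

lemma mem_dyadic_left {k m : ℕ} (hm : m < 2 ^ k) : (k + 1, 2 * m) ∈ dyadic :=
  ⟨Nat.le_add_left _ _, by simp only [pow_succ]; omega⟩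

lemma mem_dyadic_right {k m : ℕ} (hm : m < 2 ^ k) : (k + 1, 2 * m + 1) ∈ dyadic :=
  ⟨Nat.le_add_left _ _, by simp only [pow_succ]; omega⟩

lemma blockStart_zero : blockStart 0 0 = 0 := startTime_one_zero

lemma startTime_right_eq {k m : ℕ} (hm : m < 2 ^ k) :
    startTime (k + 1, 2 * m + 1) = blockStart k m + 2 * slotLen (k + 1) :=
  startTime_right (mem_dyadic_right hm)

lemma blockStart_left {k m : ℕ} (hm : m < 2 ^ k) :
    blockStart (k + 1) (2 * m) = blockStart k m + slotLen (k + 1) :=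
  startTime_left (mem_dyadic_left hm)

lemma blockStart_right {k m : ℕ} (hm : m < 2 ^ k) :
    blockStart (k + 1) (2 * m + 1) = blockStart k m + 3 * slotLen (k + 1) := by
  rw [blockStart, startTime_left (mem_dyadic_right hm), startTime_right_eq hm]
  ring

/-- The two slots of one block are exactly two slot lengths apart. When `m` and `m + 1` belong to
different parent blocks, the slot `m` is followed by the last quarter of its block, and the parent
level supplies the inequality. -/
lemma startTime_add_le_succ (k m : ℕ) (hm : m + 1 < 2 ^ k) :
    startTime (k, m) + 2 * slotLen k ≤ startTime (k, m + 1) := by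
  induction k generalizing m with
  | zero => simp at hm
  | succ k ih =>
    rcases Nat.even_or_odd' m with ⟨n, rfl | rfl⟩
    · rw [startTime_right_eq (by rw [pow_succ] at hm; omega), blockStart]
    · have hn : n + 1 < 2 ^ k := by rw [pow_succ] at hm; omega
      have hk : 1 ≤ k := by
        rcases k with _ | k
        · simp at hn
        · omega
      have e : 2 * n + 1 + 1 = 2 * (n + 1) := by ring
      have h1 : (k, n) ∈ dyadic := ⟨hk, by simp only; omega⟩
      have h2 : (k, n + 1) ∈ dyadic := ⟨hk, hn⟩
      rw [startTime_right_eq (by omega), e, startTime_left h2, blockStart, startTime_left h1,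
        slotLen_succ]
      have := ih n hn
      linarith [slotLen_pos k]

lemma startTime_add_le {k m m' : ℕ} (h : m < m') (hm : m' < 2 ^ k) :
    startTime (k, m) + 2 * slotLen k ≤ startTime (k, m') := by
  induction m', h using Nat.le_induction with
  | base => exact startTime_add_le_succ k m hm
  | succ n hn ih =>
    have := startTime_add_le_succ k n hm
    have := ih (by omega)
    linarith [slotLen_pos k]

/-- A slot of level at most `k` does not meet the interior of a block of level `k`. -/
lemma slot_block_disjoint {k m : ℕ} (hm : m < 2 ^ k) {p : ℕ × ℕ} (hp : p ∈ dyadic)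
    (hpk : p.1 ≤ k) :
    startTime p + slotLen p.1 ≤ blockStart k m ∨ blockStart k m + slotLen k ≤ startTime p := by
  induction k generalizing m with
  | zero => exact absurd hp.1 (by omega)
  | succ k ih =>
    have hm2 : m / 2 < 2 ^ k := by rw [pow_succ] at hm; omega
    -- A strictly coarser slot avoids the parent block of index `m / 2`, which contains this one. A
    -- slot of equal level is compared with slot `(k + 1, m)`, at whose end the block begins.
    rcases hpk.lt_or_eq with h | h
    · have hsub : blockStart k (m / 2) ≤ blockStart (k + 1) m ∧
          blockStart (k + 1) m + slotLen (k + 1) ≤ blockStart k (m / 2) + slotLen k := by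
        have hd := slotLen_succ k
        have hp := slotLen_pos k
        rcases Nat.even_or_odd' m with ⟨n, rfl | rfl⟩
        · have e : 2 * n / 2 = n := by omega
          rw [e] at hm2 ⊢
          rw [blockStart_left hm2]
          constructor <;> linarith
        · have e : (2 * n + 1) / 2 = n := by omega
          rw [e] at hm2 ⊢
          rw [blockStart_right hm2]
          constructor <;> linarith
      rcases ih hm2 (by omega) with h1 | h1
      · left; linarith
      · right; linarith
    · obtain ⟨k', m'⟩ := p
      simp only at h
      subst h
      have hq : (k + 1, m) ∈ dyadic := ⟨by simp, hm⟩
      rw [blockStart, startTime_left hq]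
      rcases lt_trichotomy m' m with h1 | rfl | h1
      · left
        have := startTime_add_le h1 hm
        simp only
        linarith [slotLen_pos (k + 1)]
      · left; exact le_rfl
      · right
        have := startTime_add_le h1 hp.2
        linarith

/-- A slot is contained in its block. -/
lemma slot_subset_block {k m : ℕ} (hm : m < 2 ^ (k + 1)) :
    m / 2 < 2 ^ k ∧ blockStart k (m / 2) ≤ startTime (k + 1, m) ∧
      startTime (k + 1, m) + slotLen (k + 1) ≤ blockStart k (m / 2) + slotLen k := by
  have hm2 : m / 2 < 2 ^ k := by rw [pow_succ] at hm; omega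
  have hd := slotLen_succ k
  have hp := slotLen_pos k
  refine ⟨hm2, ?_⟩
  rcases Nat.even_or_odd' m with ⟨n, rfl | rfl⟩
  · have e : 2 * n / 2 = n := by omega
    rw [e, blockStart]
    constructor <;> linarith
  · have e : (2 * n + 1) / 2 = n := by omega
    rw [e] at hm2 ⊢
    rw [startTime_right_eq hm2]
    constructor <;> linarith

/-- The finer slot lies in a block one level above it, and the coarser slot stays outside the
interior of that block. -/
lemma slots_disjoint {p q : ℕ × ℕ} (hp : p ∈ dyadic) (hq : q ∈ dyadic) (hpq : p ≠ q) :
    startTime p + slotLen p.1 ≤ startTime q ∨ startTime q + slotLen q.1 ≤ startTime p := by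
  wlog h : p.1 ≤ q.1 generalizing p q
  · exact (this hq hp hpq.symm (by omega)).symm
  obtain ⟨k, m⟩ := p
  obtain ⟨k', m'⟩ := q
  simp only at h
  rcases h.lt_or_eq with h | rfl
  · obtain ⟨j, rfl⟩ : ∃ j, k' = j + 1 := ⟨k' - 1, by omega⟩
    obtain ⟨h1, h2, h3⟩ := slot_subset_block hq.2
    rcases slot_block_disjoint h1 hp (by simp only; omega) with h4 | h4
    · left; linarith
    · right; simp only; linarith
  · have hne : m ≠ m' := fun h => hpq (by rw [h])
    rcases hne.lt_or_gt with h1 | h1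
    · left
      have := startTime_add_le h1 hq.2
      simp only
      linarith [slotLen_pos k]
    · right
      have := startTime_add_le h1 hp.2
      simp only
      linarith [slotLen_pos k]

/-! ### The fields at a given time -/

section Field

variable {i : ℕ → Fin 2} {L : ℕ → ℕ} {τ : ℕ → ℝ}

/-- Adjacent slots share an endpoint; the strict inequality in the finiteness condition keeps each
closed activity interval away from the end of its slot. This makes the choice in `fractalField`
unambiguous. -/
lemma eq_of_mem_slots (hfin : FinitenessCondition τ) {p q : ℕ × ℕ} (hp : p ∈ dyadic)
    (hq : q ∈ dyadic) {t : ℝ} (htp : t ∈ Ico (startTime p) (startTime p + slotLen p.1))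
    (htq : t ∈ Icc (startTime q) (startTime q + τ q.1)) : q = p := by
  by_contra hne
  have h1 : τ q.1 < slotLen q.1 := hfin q.1 hq.1
  rcases slots_disjoint hq hp hne with h | h
  · linarith [htp.1, htq.2]
  · linarith [htp.2, htq.1]

lemma mem_Ico_slot (hfin : FinitenessCondition τ) {p : ℕ × ℕ} (hp : p ∈ dyadic) {t : ℝ}
    (ht : t ∈ Icc (startTime p) (startTime p + τ p.1)) :
    t ∈ Ico (startTime p) (startTime p + slotLen p.1) := by
  have h1 : τ p.1 < slotLen p.1 := hfin p.1 hp.1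
  exact ⟨ht.1, by linarith [ht.2]⟩

lemma fractalField_of_mem (hfin : FinitenessCondition τ) {S : Set (ℕ × ℕ)} (hS : S ⊆ dyadic)
    {p : ℕ × ℕ} (hp : p ∈ S) {t : ℝ} (ht : t ∈ Icc (startTime p) (startTime p + τ p.1)) :
    fractalField i L τ S t = shearField (i p.1) (L p.1) := by
  have hex : ∃ p ∈ S, t ∈ Icc (startTime p) (startTime p + τ p.1) := ⟨p, hp, ht⟩
  have e : hex.choose = p := eq_of_mem_slots hfin (hS hp) (hS hex.choose_spec.1)
    (mem_Ico_slot hfin (hS hp) ht) hex.choose_spec.2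
  funext x
  rw [fractalField, dif_pos hex, e]

lemma fractalField_of_forall_notMem {S : Set (ℕ × ℕ)} {t : ℝ}
    (h : ∀ p ∈ S, t ∉ Icc (startTime p) (startTime p + τ p.1)) :
    fractalField i L τ S t = 0 := by
  funext x
  rw [fractalField, dif_neg]
  · rfl
  · rintro ⟨p, hp, ht⟩
    exact h p hp ht

lemma fractalField_of_mem_gap (hfin : FinitenessCondition τ) {S : Set (ℕ × ℕ)} (hS : S ⊆ dyadic)
    {p : ℕ × ℕ} (hp : p ∈ dyadic) {t : ℝ} (ht0 : startTime p + τ p.1 < t)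
    (ht : t ∈ Ico (startTime p) (startTime p + slotLen p.1)) :
    fractalField i L τ S t = 0 := by
  refine fractalField_of_forall_notMem fun q hq htq => ?_
  have := eq_of_mem_slots hfin hp (hS hq) ht htq
  subst this
  linarith [htq.2]

lemma dyadicUpTo_subset (K : ℕ) : dyadicUpTo K ⊆ dyadic := fun _ h => h.1

lemma truncatedField_of_mem_block (hfin : FinitenessCondition τ) {K m : ℕ} (hm : m < 2 ^ K) {t : ℝ}
    (ht : t ∈ Ioo (blockStart K m) (blockStart K m + slotLen K)) :
    truncatedField i L τ K t = 0 := by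
  refine fractalField_of_forall_notMem fun p hp htp => ?_
  have h1 : τ p.1 < slotLen p.1 := hfin p.1 hp.1.1
  rcases slot_block_disjoint hm hp.1 hp.2 with h | h
  · linarith [ht.1, htp.2]
  · linarith [ht.2, htp.1]

/-- At each time, the truncated fields are eventually equal to the limit field. -/
lemma eventually_truncatedField_eq (hfin : FinitenessCondition τ) (t : ℝ) :
    ∀ᶠ K in atTop, truncatedField i L τ K t = limitField i L τ t := by
  by_cases h : ∃ p ∈ dyadic, t ∈ Icc (startTime p) (startTime p + τ p.1)
  · obtain ⟨p, hp, ht⟩ := h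
    filter_upwards [eventually_ge_atTop p.1] with K hK
    rw [truncatedField, limitField, fractalField_of_mem hfin (dyadicUpTo_subset K) ⟨hp, hK⟩ ht,
      fractalField_of_mem hfin subset_rfl hp ht]
  · push Not at h
    refine Eventually.of_forall fun K => ?_
    rw [truncatedField, limitField, fractalField_of_forall_notMem h,
      fractalField_of_forall_notMem fun p hp => h p hp.1]

/-! ### Measurability and boundedness of the fields -/

lemma measurable_shearField (i : Fin 2) (L : ℕ) : Measurable (shearField i L) := by
  refine measurable_pi_lambda _ fun j => ?_
  have hs : Measurable fun x : T2 => shearSign L (x (1 - i)) :=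
    (measurable_shearSign L).comp (measurable_pi_apply (1 - i))
  unfold shearField
  rcases eq_or_ne j i with rfl | h
  · simpa using hs
  · simp [Pi.single_eq_of_ne h]

lemma norm_shearField_le (i : Fin 2) (L : ℕ) (x : T2) : ‖shearField i L x‖ ≤ 1 := by
  unfold shearField
  rw [Pi.norm_single]
  rcases shearSign_eq_or L (x (1 - i)) with h | h <;> simp [h]

lemma norm_fractalField_le (S : Set (ℕ × ℕ)) (t : ℝ) (x : T2) :
    ‖fractalField i L τ S t x‖ ≤ 1 := by
  unfold fractalField
  split_ifs
  · exact norm_shearField_le _ _ _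
  · simp

lemma measurable_fractalField (hfin : FinitenessCondition τ) {S : Set (ℕ × ℕ)} (hS : S ⊆ dyadic) :
    Measurable fun p : ℝ × T2 => fractalField i L τ S p.1 p.2 := by
  intro B hB
  -- The preimage is a countable union of rectangles, one per slot, together with the idle times,
  -- which contribute either everything or nothing.
  have e : (fun p : ℝ × T2 => fractalField i L τ S p.1 p.2) ⁻¹' B =
      (⋃ q ∈ S, Icc (startTime q) (startTime q + τ q.1) ×ˢ (shearField (i q.1) (L q.1) ⁻¹' B)) ∪
      ((⋃ q ∈ S, Icc (startTime q) (startTime q + τ q.1))ᶜ ×ˢ {_x : T2 | (0 : Fin 2 → ℝ) ∈ B}) := by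
    ext ⟨t, x⟩
    by_cases h : ∃ q ∈ S, t ∈ Icc (startTime q) (startTime q + τ q.1)
    · obtain ⟨q, hq, ht⟩ := h
      have hne : t ∉ (⋃ q ∈ S, Icc (startTime q) (startTime q + τ q.1))ᶜ := by
        simp only [Set.mem_compl_iff, not_not]
        exact mem_biUnion hq ht
      simp only [mem_preimage, mem_union, mem_prod, hne, false_and, or_false, mem_iUnion,
        exists_prop]
      rw [fractalField_of_mem hfin hS hq ht]
      constructor
      · exact fun h => ⟨q, hq, ht, h⟩
      · rintro ⟨q', hq', ht', h'⟩
        rwa [← eq_of_mem_slots hfin (hS hq) (hS hq') (mem_Ico_slot hfin (hS hq) ht) ht']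
    · have hmem : t ∈ (⋃ q ∈ S, Icc (startTime q) (startTime q + τ q.1))ᶜ := by
        simp only [Set.mem_compl_iff, mem_iUnion, exists_prop]
        exact h
      have h0 : fractalField i L τ S t = 0 :=
        fractalField_of_forall_notMem fun q hq ht => h ⟨q, hq, ht⟩
      have hno : (t, x) ∉ ⋃ q ∈ S, Icc (startTime q) (startTime q + τ q.1) ×ˢ
          (shearField (i q.1) (L q.1) ⁻¹' B) := by
        simp only [mem_iUnion, mem_prod, exists_prop]
        rintro ⟨q, hq, ht, -⟩
        exact h ⟨q, hq, ht⟩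
      simp only [mem_preimage, mem_union, hno, false_or, mem_prod, hmem, true_and, h0]
      rfl
  rw [e]
  refine (MeasurableSet.biUnion (to_countable S) fun q _ =>
    measurableSet_Icc.prod (measurable_shearField _ _ hB)).union (MeasurableSet.prod ?_ ?_)
  · exact (MeasurableSet.biUnion (to_countable S) fun q _ => measurableSet_Icc).compl
  · exact MeasurableSet.const _

end Field

/-! ### Flows on a time interval -/

lemma toT2_surjective : Function.Surjective toT2 := by
  intro x
  choose r hr using fun j => QuotientAddGroup.mk_surjective (x j)
  exact ⟨r, funext hr⟩

lemma toT2_add (x y : Fin 2 → ℝ) : toT2 (x + y) = toT2 x + toT2 y := rfl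

lemma toT2_single (j : Fin 2) (c : ℝ) : toT2 (Pi.single j c) = Pi.single j (c : UnitAddCircle) := by
  funext l
  rcases eq_or_ne l j with rfl | h
  · simp [toT2]
  · simp [toT2, Pi.single_eq_of_ne h]

/-- `A` is a family of bijections of the torus that is at rest before time `a` and after time `b`,
and moves along the field `u` (off a countable set of times) in between. -/
def FlowOn (u : ℝ → T2 → (Fin 2 → ℝ)) (a b : ℝ) (A : ℝ → T2 ≃ᵐ T2) : Prop :=
  ∀ x : Fin 2 → ℝ, ∃ γ : ℝ → (Fin 2 → ℝ), (∀ t ≤ a, γ t = x) ∧ (∀ t, b ≤ t → γ t = γ b) ∧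
    (∀ s t, ‖γ s - γ t‖ ≤ |s - t|) ∧ (∀ t, toT2 (γ t) = A t (toT2 x)) ∧
    ∃ C : Set ℝ, C.Countable ∧ ∀ t ∈ Ioo a b \ C, HasDerivAt γ (u t (A t (toT2 x))) t

lemma FlowOn.apply_of_le {u : ℝ → T2 → (Fin 2 → ℝ)} {a b : ℝ} {A : ℝ → T2 ≃ᵐ T2}
    (hA : FlowOn u a b A) {t : ℝ} (ht : t ≤ a) (x : T2) : A t x = x := by
  obtain ⟨z, rfl⟩ := toT2_surjective x
  obtain ⟨γ, h1, -, -, h2, -⟩ := hA z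
  rw [← h2, h1 t ht]

/-- At every time one of the two factors is at rest, so a lift `γ` for `A` and a lift `η` for `B`
started at `γ b` glue to `γ + (η - γ b)`. The junction `b` joins the exceptional set. -/
lemma FlowOn.trans {u : ℝ → T2 → (Fin 2 → ℝ)} {a b c : ℝ} {A B : ℝ → T2 ≃ᵐ T2}
    (hA : FlowOn u a b A) (hB : FlowOn u b c B) (hab : a ≤ b) (hbc : b ≤ c) :
    FlowOn u a c (fun t => (A t).trans (B t)) := by
  intro x
  obtain ⟨γ, g1, g2, g3, g4, C, hC, g5⟩ := hA x
  obtain ⟨η, e1, e2, e3, e4, D, hD, e5⟩ := hB (γ b)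
  have hl : ∀ t ≤ b, γ t + (η t - γ b) = γ t := fun t ht => by rw [e1 t ht]; simp
  have hr : ∀ t, b ≤ t → γ t + (η t - γ b) = η t := fun t ht => by rw [g2 t ht]; simp
  have hAl : ∀ t ≤ b, B t (A t (toT2 x)) = A t (toT2 x) := fun t ht => hB.apply_of_le ht _
  have hAr : ∀ t, b ≤ t → B t (A t (toT2 x)) = B t (toT2 (γ b)) := fun t ht => by
    rw [← g4, g2 t ht]
  refine ⟨fun t => γ t + (η t - γ b), fun t ht => ?_, fun t ht => ?_, ?_, fun t => ?_,
    C ∪ D ∪ {b}, (hC.union hD).union (countable_singleton b), ?_⟩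
  · exact (hl t (ht.trans hab)).trans (g1 t ht)
  · exact (hr t (hbc.trans ht)).trans ((e2 t ht).trans (hr c hbc).symm)
  · intro s t
    wlog h : s ≤ t generalizing s t
    · rw [norm_sub_rev, abs_sub_comm]; exact this t s (by linarith)
    rcases le_total t b with ht | ht
    · simp only [hl t ht, hl s (h.trans ht)]; exact g3 s t
    rcases le_total s b with hs | hs
    · simp only [hl s hs, hr t ht]
      have h1 := g3 s b
      have h2 := e3 b t
      rw [e1 b le_rfl] at h2
      calc ‖γ s - η t‖ = ‖(γ s - γ b) + (γ b - η t)‖ := by congr 1; abel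
        _ ≤ |s - b| + |b - t| := (norm_add_le _ _).trans (add_le_add h1 h2)
        _ = |s - t| := by
          rw [abs_of_nonpos (by linarith), abs_of_nonpos (by linarith), abs_of_nonpos (by linarith)]
          ring
    · simp only [hr t ht, hr s hs]; exact e3 s t
  · change _ = B t (A t (toT2 x))
    rcases le_total t b with ht | ht
    · simp only [hl t ht, hAl t ht]; exact g4 t
    · simp only [hr t ht, hAr t ht]; exact e4 t
  · rintro t ⟨ht, hn⟩
    simp only [mem_union, mem_singleton_iff, not_or] at hn
    change HasDerivAt _ (u t (B t (A t (toT2 x)))) t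
    rcases lt_or_gt_of_ne hn.2 with h | h
    · rw [hAl t h.le]
      refine (g5 t ⟨⟨ht.1, h⟩, hn.1.1⟩).congr_of_eventuallyEq ?_
      filter_upwards [Iio_mem_nhds h] with s hs using hl s (le_of_lt hs)
    · rw [hAr t h.le]
      refine (e5 t ⟨⟨h, ht.2⟩, hn.1.2⟩).congr_of_eventuallyEq ?_
      filter_upwards [Ioi_mem_nhds h] with s hs using hr s (le_of_lt hs)

lemma flowOn_refl {u : ℝ → T2 → (Fin 2 → ℝ)} {a b : ℝ} (hu : ∀ t ∈ Ioo a b, u t = 0) :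
    FlowOn u a b fun _ => MeasurableEquiv.refl T2 := by
  intro x
  refine ⟨fun _ => x, fun _ _ => rfl, fun _ _ => rfl, by simp, fun _ => rfl, ∅, countable_empty, ?_⟩
  rintro t ⟨ht, -⟩
  rw [hu t ht]
  exact hasDerivAt_const t x

/-- A shear that is switched on for a time `T` at time `a`. -/
lemma flowOn_shear {u : ℝ → T2 → (Fin 2 → ℝ)} {a b T : ℝ} {i : Fin 2} {L : ℕ} (hT : 0 ≤ T)
    (hb : a + T ≤ b) (hu : ∀ t ∈ Ioo a (a + T), u t = shearField i L)
    (hu0 : ∀ t ∈ Ioo (a + T) b, u t = 0) :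
    FlowOn u a b fun t => shearEquiv i L (clip T a t) := by
  intro x
  -- The shear never changes the coordinate `1 - i`, so the sign at the starting point governs the
  -- whole trajectory.
  set σ := shearSign L (toT2 x (1 - i)) with hσ
  have hσ1 : |σ| = 1 := by rcases shearSign_eq_or L (toT2 x (1 - i)) with h | h <;> simp [hσ, h]
  have hflow : ∀ r : ℝ, toT2 (x + Pi.single i (r * σ)) = shearFlow i L r (toT2 x) := fun r => by
    rw [toT2_add, toT2_single, shearFlow]
  refine ⟨fun t => x + Pi.single i (clip T a t * σ), fun t ht => ?_, fun t ht => ?_, fun s t => ?_,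
    fun t => hflow _, {a + T}, countable_singleton _, ?_⟩
  · simp [clip_of_le ht]
  · simp only [clip_of_ge hT (hb.trans ht), clip_of_ge hT hb]
  · simp only [add_sub_add_left_eq_sub]
    rw [← Pi.single_sub, Pi.norm_single, ← sub_mul, Real.norm_eq_abs, abs_mul, hσ1, mul_one]
    exact abs_clip_sub_le T a s t
  · rintro t ⟨ht, hne⟩
    have hsingle : ∀ {c : ℝ → ℝ} {c' : ℝ}, HasDerivAt c c' t →
        HasDerivAt (fun t => x + Pi.single i (c t * σ)) (Pi.single i (c' * σ)) t := by
      intro c c' hc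
      refine HasDerivAt.const_add x ?_
      rw [hasDerivAt_pi]
      intro j
      rcases eq_or_ne j i with rfl | h
      · simpa using hc.mul_const σ
      · simpa [Pi.single_eq_of_ne h] using hasDerivAt_const t (0 : ℝ)
    rcases lt_or_gt_of_ne (show t ≠ a + T from hne) with h | h
    · rw [hu t ⟨ht.1, h⟩]
      have e : shearField i L (shearEquiv i L (clip T a t) (toT2 x)) = Pi.single i (1 * σ) := by
        rw [shearEquiv_apply, shearField, shearFlow_apply_other, one_mul]
      rw [e]
      refine hsingle (((hasDerivAt_id t).sub_const a).congr_of_eventuallyEq ?_)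
      filter_upwards [Ioo_mem_nhds ht.1 h] with s hs using clip_of_mem ⟨hs.1.le, hs.2.le⟩
    · rw [hu0 t ⟨h, ht.2⟩]
      have e : (0 : T2 → (Fin 2 → ℝ)) (shearEquiv i L (clip T a t) (toT2 x)) =
        Pi.single i (0 * σ) := by simp
      rw [e]
      refine hsingle ((hasDerivAt_const t T).congr_of_eventuallyEq ?_)
      filter_upwards [Ioi_mem_nhds h] with s hs using clip_of_ge hT (le_of_lt hs)

/-! ### The flow of the truncated field -/

/-- The flow, at time `t`, of the first `n` levels of slots in a block of level `k` that starts at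
time `a`: the block consists of a slot of level `k + 1`, a block of level `k + 1`, a second slot of
level `k + 1` and a second block of level `k + 1`. -/
def blockFlow (i : ℕ → Fin 2) (L : ℕ → ℕ) (τ : ℕ → ℝ) : ℕ → ℕ → ℝ → ℝ → T2 ≃ᵐ T2
  | 0, _, _, _ => MeasurableEquiv.refl T2
  | n + 1, k, a, t =>
    (((shearEquiv (i (k + 1)) (L (k + 1)) (clip (τ (k + 1)) a t)).trans
      (blockFlow i L τ n (k + 1) (a + slotLen (k + 1)) t)).trans
      (shearEquiv (i (k + 1)) (L (k + 1)) (clip (τ (k + 1)) (a + 2 * slotLen (k + 1)) t))).trans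
      (blockFlow i L τ n (k + 1) (a + 3 * slotLen (k + 1)) t)

section

variable {i : ℕ → Fin 2} {L : ℕ → ℕ} {τ : ℕ → ℝ}

lemma measurePreserving_shearEquiv (i : Fin 2) (L : ℕ) (t : ℝ) :
    MeasurePreserving (shearEquiv i L t) volume volume :=
  measurePreserving_shearFlow i L t

lemma measurePreserving_trans {A B : T2 ≃ᵐ T2} (hA : MeasurePreserving A volume volume)
    (hB : MeasurePreserving B volume volume) : MeasurePreserving (A.trans B) volume volume :=
  hB.comp hA

lemma measurePreserving_blockFlow (n k : ℕ) (a t : ℝ) :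
    MeasurePreserving (blockFlow i L τ n k a t) volume volume := by
  induction n generalizing k a with
  | zero => exact MeasurePreserving.id _
  | succ n ih =>
    exact measurePreserving_trans (measurePreserving_trans (measurePreserving_trans
      (measurePreserving_shearEquiv _ _ _) (ih _ _)) (measurePreserving_shearEquiv _ _ _)) (ih _ _)

lemma stronglyContinuous_blockFlow (n k : ℕ) (a : ℝ) :
    StronglyContinuous (blockFlow i L τ n k a) := by
  induction n generalizing k a with
  | zero => exact stronglyContinuous_refl
  | succ n ih =>
    have m1 := fun j a t => measurePreserving_shearEquiv (i j) (L j) (clip (τ j) a t)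
    have m2 := fun k a t => measurePreserving_blockFlow (i := i) (L := L) (τ := τ) n k a t
    have c1 := fun j a => stronglyContinuous_shear (i j) (L j) (continuous_clip (τ j) a)
    exact (((c1 _ _).trans (ih _ _) (m1 _ _) (m2 _ _)).trans (c1 _ _)
      (fun t => measurePreserving_trans (m1 _ _ _) (m2 _ _ _)) (m1 _ _)).trans (ih _ _)
      (fun t => measurePreserving_trans (measurePreserving_trans (m1 _ _ _) (m2 _ _ _)) (m1 _ _ _))
      (m2 _ _)

lemma measurable_uncurry_shear_clip (i : Fin 2) (L : ℕ) (T a : ℝ) :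
    Measurable fun p : ℝ × T2 => (p.1, shearEquiv i L (clip T a p.1) p.2) :=
  measurable_fst.prodMk ((measurable_shearFlow_uncurry i L).comp
    (((continuous_clip T a).measurable.comp measurable_fst).prodMk measurable_snd))

lemma measurable_uncurry_shear_clip_symm (i : Fin 2) (L : ℕ) (T a : ℝ) :
    Measurable fun p : ℝ × T2 => (p.1, (shearEquiv i L (clip T a p.1)).symm p.2) :=
  measurable_fst.prodMk ((measurable_shearFlow_uncurry i L).comp
    ((((continuous_clip T a).measurable.comp measurable_fst).neg).prodMk measurable_snd))

lemma measurable_uncurry_blockFlow (n k : ℕ) (a : ℝ) :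
    Measurable fun p : ℝ × T2 => (p.1, blockFlow i L τ n k a p.1 p.2) := by
  induction n generalizing k a with
  | zero => exact measurable_id
  | succ n ih =>
    exact (ih _ _).comp ((measurable_uncurry_shear_clip _ _ _ _).comp
      ((ih _ _).comp (measurable_uncurry_shear_clip _ _ _ _)))

lemma measurable_uncurry_blockFlow_symm (n k : ℕ) (a : ℝ) :
    Measurable fun p : ℝ × T2 => (p.1, (blockFlow i L τ n k a p.1).symm p.2) := by
  induction n generalizing k a with
  | zero => exact measurable_id
  | succ n ih =>
    have e : (fun p : ℝ × T2 => (p.1, (blockFlow i L τ (n + 1) k a p.1).symm p.2)) = fun p =>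
        (p.1, (shearEquiv (i (k + 1)) (L (k + 1)) (clip (τ (k + 1)) a p.1)).symm
          ((blockFlow i L τ n (k + 1) (a + slotLen (k + 1)) p.1).symm
            ((shearEquiv (i (k + 1)) (L (k + 1))
              (clip (τ (k + 1)) (a + 2 * slotLen (k + 1)) p.1)).symm
                ((blockFlow i L τ n (k + 1) (a + 3 * slotLen (k + 1)) p.1).symm p.2)))) := rfl
    rw [e]
    exact (measurable_uncurry_shear_clip_symm (i (k + 1)) (L (k + 1)) (τ (k + 1)) a).comp
      ((ih (k + 1) (a + slotLen (k + 1))).comp ((measurable_uncurry_shear_clip_symm (i (k + 1))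
        (L (k + 1)) (τ (k + 1)) (a + 2 * slotLen (k + 1))).comp
          (ih (k + 1) (a + 3 * slotLen (k + 1)))))

lemma truncatedField_left_slot (hfin : FinitenessCondition τ) {n k m : ℕ} (hm : m < 2 ^ k)
    (hτ : 0 < τ (k + 1)) :
    FlowOn (truncatedField i L τ (n + 1 + k)) (blockStart k m) (blockStart k m + slotLen (k + 1))
      (fun t => shearEquiv (i (k + 1)) (L (k + 1)) (clip (τ (k + 1)) (blockStart k m) t)) := by
  have hlt : τ (k + 1) < slotLen (k + 1) := hfin (k + 1) (by omega)
  have hp : (k + 1, 2 * m) ∈ dyadic := mem_dyadic_left hm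
  refine flowOn_shear hτ.le (by linarith) (fun t ht => ?_) (fun t ht => ?_)
  · exact fractalField_of_mem hfin (dyadicUpTo_subset _) (p := (k + 1, 2 * m)) ⟨hp, by simp⟩
      ⟨ht.1.le, ht.2.le⟩
  · exact fractalField_of_mem_gap hfin (dyadicUpTo_subset _) hp ht.1
      ⟨by have := ht.1; unfold blockStart at this; linarith, ht.2⟩

lemma truncatedField_right_slot (hfin : FinitenessCondition τ) {n k m : ℕ} (hm : m < 2 ^ k)
    (hτ : 0 < τ (k + 1)) :
    FlowOn (truncatedField i L τ (n + 1 + k)) (blockStart k m + 2 * slotLen (k + 1))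
      (blockStart k m + 3 * slotLen (k + 1)) (fun t => shearEquiv (i (k + 1)) (L (k + 1))
        (clip (τ (k + 1)) (blockStart k m + 2 * slotLen (k + 1)) t)) := by
  have hlt : τ (k + 1) < slotLen (k + 1) := hfin (k + 1) (by omega)
  have hp : (k + 1, 2 * m + 1) ∈ dyadic := mem_dyadic_right hm
  have e : blockStart k m + 3 * slotLen (k + 1) =
      startTime (k + 1, 2 * m + 1) + slotLen (k + 1) := by
    rw [startTime_right_eq hm]; ring
  rw [e, ← startTime_right_eq hm]
  refine flowOn_shear hτ.le (by linarith) (fun t ht => ?_) (fun t ht => ?_)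
  · exact fractalField_of_mem hfin (dyadicUpTo_subset _) (p := (k + 1, 2 * m + 1))
      ⟨hp, by simp⟩ ⟨ht.1.le, ht.2.le⟩
  · exact fractalField_of_mem_gap hfin (dyadicUpTo_subset _) hp ht.1
      ⟨by linarith [ht.1], ht.2⟩

/-- The four quarters of the block are concatenated with `FlowOn.trans`. At `n = 0` only slots of
level at most `k` are active, and none of them meets the interior of a block of level `k`. -/
lemma flowOn_blockFlow (hfin : FinitenessCondition τ) (hτ : ∀ k, 1 ≤ k → 0 < τ k) (n k m : ℕ)
    (hm : m < 2 ^ k) :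
    FlowOn (truncatedField i L τ (n + k)) (blockStart k m) (blockStart k m + slotLen k)
      (blockFlow i L τ n k (blockStart k m)) := by
  induction n generalizing k m with
  | zero =>
    rw [Nat.zero_add]
    exact flowOn_refl fun t ht => truncatedField_of_mem_block hfin hm ht
  | succ n ih =>
    have hτ' := hτ (k + 1) (by omega)
    have hd := slotLen_pos (k + 1)
    have h4 : slotLen k = 4 * slotLen (k + 1) := by rw [slotLen_succ]; ring
    have hl := ih (k + 1) (2 * m) (by rw [pow_succ]; omega)
    have hr := ih (k + 1) (2 * m + 1) (by rw [pow_succ]; omega)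
    have eN : n + (k + 1) = n + 1 + k := by ring
    rw [eN, blockStart_left hm] at hl
    rw [eN, blockStart_right hm] at hr
    have e1 : blockStart k m + slotLen (k + 1) + slotLen (k + 1) =
      blockStart k m + 2 * slotLen (k + 1) := by ring
    have e2 : blockStart k m + 3 * slotLen (k + 1) + slotLen (k + 1) =
      blockStart k m + slotLen k := by rw [h4]; ring
    rw [e1] at hl
    rw [e2] at hr
    exact (((truncatedField_left_slot hfin hm hτ').trans hl (by linarith) (by linarith)).trans
      (truncatedField_right_slot hfin hm hτ') (by linarith) (by linarith)).trans hr
      (by linarith) (by linarith)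

/-- The flow of the truncated field `u_K`. -/
def truncatedFlow (i : ℕ → Fin 2) (L : ℕ → ℕ) (τ : ℕ → ℝ) (K : ℕ) (t : ℝ) : T2 ≃ᵐ T2 :=
  blockFlow i L τ K 0 0 t

lemma flowOn_truncatedFlow (hfin : FinitenessCondition τ) (hτ : ∀ k, 1 ≤ k → 0 < τ k) (K : ℕ) :
    FlowOn (truncatedField i L τ K) 0 1 (truncatedFlow i L τ K) := by
  have := flowOn_blockFlow (i := i) (L := L) hfin hτ K 0 0 (by simp)
  rw [blockStart_zero, slotLen_zero, zero_add] at this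
  exact this

end

/-! ### Derivatives of test functions -/

/-- The representative in `[0,1)²` of a point of the torus. -/
def rep (x : T2) : Fin 2 → ℝ := fun j => AddCircle.equivIco (1 : ℝ) 0 (x j)

lemma toT2_rep (x : T2) : toT2 (rep x) = x := by
  funext j
  exact (AddCircle.equivIco (1 : ℝ) 0).symm_apply_apply (x j)

lemma measurable_rep : Measurable rep := by
  refine measurable_pi_lambda _ fun j => ?_
  exact (measurable_subtype_coe.comp (AddCircle.measurableEquivIco (1 : ℝ) 0).measurable).comp
    (measurable_pi_apply j)

lemma rep_mem_Icc (x : T2) : rep x ∈ Icc (0 : Fin 2 → ℝ) 1 := by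
  refine ⟨fun j => ?_, fun j => ?_⟩
  · exact (AddCircle.equivIco (1 : ℝ) 0 (x j)).2.1
  · have := (AddCircle.equivIco (1 : ℝ) 0 (x j)).2.2.le
    simpa [rep] using this

/-- The lift of a function on space-time to the universal cover. -/
def lift (φ : ℝ → T2 → ℝ) (p : ℝ × (Fin 2 → ℝ)) : ℝ := φ p.1 (toT2 p.2)

/-- The derivative of `φ` along the field `u`. -/
def materialDeriv (u : ℝ → T2 → (Fin 2 → ℝ)) (φ : ℝ → T2 → ℝ) (t : ℝ) (x : T2) : ℝ :=
  timeDeriv φ t x + advect u φ t x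

namespace IsTestFunction

variable {φ : ℝ → T2 → ℝ}

lemma differentiable (hφ : IsTestFunction φ) : Differentiable ℝ (lift φ) :=
  hφ.smooth.differentiable (by simp)

lemma timeDeriv_eq (hφ : IsTestFunction φ) (t : ℝ) (x : Fin 2 → ℝ) :
    timeDeriv φ t (toT2 x) = fderiv ℝ (lift φ) (t, x) (1, 0) := by
  have h1 := (hφ.differentiable (t, x)).hasFDerivAt
  have h2 : HasDerivAt (fun s : ℝ => (s, x)) (1, 0) t := (hasDerivAt_id t).prodMk
    (hasDerivAt_const t x)
  exact (h1.comp_hasDerivAt t h2).deriv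

lemma partialDeriv_eq (hφ : IsTestFunction φ) (j : Fin 2) (t : ℝ) (x : Fin 2 → ℝ) :
    partialDeriv j φ t (toT2 x) = fderiv ℝ (lift φ) (t, x) (0, Pi.single j 1) := by
  have h1 := (hφ.differentiable (t, x)).hasFDerivAt
  have h2 : HasDerivAt (fun h : ℝ => (t, x + Pi.single j h)) (0, Pi.single j 1) 0 := by
    refine (hasDerivAt_const 0 t).prodMk (HasDerivAt.const_add x ?_)
    rw [hasDerivAt_pi]
    intro l
    rcases eq_or_ne l j with rfl | h
    · simpa using hasDerivAt_id' (0 : ℝ)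
    · simpa [Pi.single_eq_of_ne h] using hasDerivAt_const (0 : ℝ) (0 : ℝ)
  have h3 : (fun h : ℝ => φ t (toT2 x + Pi.single j (h : UnitAddCircle))) =
      lift φ ∘ fun h : ℝ => (t, x + Pi.single j h) := by
    funext h
    simp [lift, toT2_add, toT2_single]
  rw [partialDeriv, h3]
  refine (HasFDerivAt.comp_hasDerivAt (0 : ℝ) ?_ h2).deriv
  simpa using h1

/-- On the universal cover the coordinate derivatives assemble into one Fréchet derivative in the
direction `(1, u)`. This is the form to which the chain rule along trajectories applies. -/
lemma materialDeriv_eq (hφ : IsTestFunction φ) (u : ℝ → T2 → (Fin 2 → ℝ)) (t : ℝ)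
    (x : Fin 2 → ℝ) :
    materialDeriv u φ t (toT2 x) = fderiv ℝ (lift φ) (t, x) (1, u t (toT2 x)) := by
  rw [materialDeriv, advect, hφ.timeDeriv_eq]
  simp_rw [hφ.partialDeriv_eq, ← smul_eq_mul, ← map_smul]
  rw [← map_sum, ← map_add]
  congr 1
  ext1
  · simp
  · ext j
    simp only [Prod.snd_add, Prod.snd_sum, Prod.smul_snd, zero_add, Finset.sum_apply, Pi.smul_apply,
      smul_eq_mul]
    rw [Finset.sum_eq_single j]
    · simp
    · intro l _ hl; simp [Pi.single_eq_of_ne hl.symm]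
    · simp

lemma continuous_fderiv (hφ : IsTestFunction φ) : Continuous (fderiv ℝ (lift φ)) :=
  hφ.smooth.continuous_fderiv (by simp)

lemma measurable_timeDeriv (hφ : IsTestFunction φ) :
    Measurable fun p : ℝ × T2 => timeDeriv φ p.1 p.2 := by
  have e : (fun p : ℝ × T2 => timeDeriv φ p.1 p.2) =
      fun p => fderiv ℝ (lift φ) (p.1, rep p.2) (1, 0) := by
    funext p
    conv_lhs => rw [← toT2_rep p.2, hφ.timeDeriv_eq]
  rw [e]
  exact (hφ.continuous_fderiv.clm_apply continuous_const).measurable.comp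
    (measurable_fst.prodMk (measurable_rep.comp measurable_snd))

lemma measurable_partialDeriv (hφ : IsTestFunction φ) (j : Fin 2) :
    Measurable fun p : ℝ × T2 => partialDeriv j φ p.1 p.2 := by
  have e : (fun p : ℝ × T2 => partialDeriv j φ p.1 p.2) =
      fun p => fderiv ℝ (lift φ) (p.1, rep p.2) (0, Pi.single j 1) := by
    funext p
    conv_lhs => rw [← toT2_rep p.2, hφ.partialDeriv_eq]
  rw [e]
  exact (hφ.continuous_fderiv.clm_apply continuous_const).measurable.comp
    (measurable_fst.prodMk (measurable_rep.comp measurable_snd))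

lemma measurable_materialDeriv (hφ : IsTestFunction φ) {u : ℝ → T2 → (Fin 2 → ℝ)}
    (hu : Measurable fun p : ℝ × T2 => u p.1 p.2) :
    Measurable fun p : ℝ × T2 => materialDeriv u φ p.1 p.2 := by
  unfold materialDeriv advect
  refine hφ.measurable_timeDeriv.add (Finset.measurable_sum _ fun j _ => ?_)
  exact ((measurable_pi_apply j).comp hu).mul (hφ.measurable_partialDeriv j)

/-- The derivative of a test function along fields bounded by `1` is bounded. -/
lemma exists_bound (hφ : IsTestFunction φ) : ∃ C : ℝ, ∀ (u : ℝ → T2 → (Fin 2 → ℝ)) (t : ℝ) (x : T2),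
    t ∈ Icc (0 : ℝ) 1 → ‖u t x‖ ≤ 1 → ‖materialDeriv u φ t x‖ ≤ C := by
  -- By periodicity it is enough to bound the derivative on `[0,1] × [0,1]²`. The resulting `C` does
  -- not depend on `u`, which later permits dominated convergence along varying fields.
  obtain ⟨C, hC⟩ := (isCompact_Icc (a := (0 : ℝ)) (b := 1)).prod
    (isCompact_Icc (a := (0 : Fin 2 → ℝ)) (b := 1)) |>.exists_bound_of_continuousOn
    hφ.continuous_fderiv.continuousOn
  refine ⟨C, fun u t x ht hu => ?_⟩
  have hx := hφ.materialDeriv_eq u t (rep x)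
  rw [toT2_rep] at hx
  rw [hx]
  refine (ContinuousLinearMap.le_opNorm _ _).trans ?_
  have h1 : ‖((1 : ℝ), u t x)‖ ≤ 1 := by
    rw [Prod.norm_def]; simpa using hu
  have h2 := hC (t, rep x) ⟨ht, rep_mem_Icc x⟩
  calc _ ≤ C * 1 := mul_le_mul h2 h1 (norm_nonneg _) ((norm_nonneg _).trans h2)
    _ = C := mul_one C

end IsTestFunction

lemma ae_spaceTime_mem : ∀ᵐ p ∂spaceTime, p.1 ∈ Icc (0 : ℝ) 1 :=
  (Measure.quasiMeasurePreserving_fst (μ := (volume : Measure ℝ).restrict (Icc 0 1))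
    (ν := (volume : Measure T2))).ae (ae_restrict_mem measurableSet_Icc)

lemma integrable_spaceTime_of_bounded {F : ℝ × T2 → ℝ} (hF : AEStronglyMeasurable F spaceTime)
    (C : ℝ) (hC : ∀ p : ℝ × T2, p.1 ∈ Icc (0 : ℝ) 1 → ‖F p‖ ≤ C) : Integrable F spaceTime :=
  Integrable.of_bound hF C (ae_spaceTime_mem.mono hC)

/-! ### Functions transported by a flow -/

/-- A function transported by the flow of a field bounded by `1` satisfies the weak formulation of
the transport equation. -/
lemma integral_mul_materialDeriv {u : ℝ → T2 → (Fin 2 → ℝ)} {A : ℝ → T2 ≃ᵐ T2}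
    (hu : Measurable fun p : ℝ × T2 => u p.1 p.2) (hu1 : ∀ t x, ‖u t x‖ ≤ 1)
    (hA : FlowOn u 0 1 A) (hAm : Measurable fun p : ℝ × T2 => (p.1, A p.1 p.2))
    (hAs : Measurable fun p : ℝ × T2 => (p.1, (A p.1).symm p.2))
    (hmp : ∀ t, MeasurePreserving (A t) volume volume) {g : T2 → ℝ} (hg : Measurable g) {M : ℝ}
    (hM : ∀ x, |g x| ≤ M) {φ : ℝ → T2 → ℝ} (hφ : IsTestFunction φ) :
    ∫ p, g ((A p.1).symm p.2) * materialDeriv u φ p.1 p.2 ∂spaceTime = - ∫ x, g x * φ 0 x := by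
  obtain ⟨C, hC⟩ := hφ.exists_bound
  have hHm := hφ.measurable_materialDeriv hu
  -- Passing to Lagrangian coordinates freezes `g` and puts the material derivative on trajectories.
  have hΘ : MeasurePreserving (fun p : ℝ × T2 => (p.1, A p.1 p.2)) spaceTime spaceTime :=
    (MeasurePreserving.id _).skew_product (g := fun t x => A t x) (measurable_snd.comp hAm)
      (Eventually.of_forall fun t => (hmp t).map_eq)
  have hG : Measurable fun p : ℝ × T2 => g ((A p.1).symm p.2) * materialDeriv u φ p.1 p.2 :=
    (hg.comp (measurable_snd.comp hAs)).mul hHm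
  have hGΘ : Measurable fun p : ℝ × T2 => g p.2 * materialDeriv u φ p.1 (A p.1 p.2) :=
    (hg.comp measurable_snd).mul (hHm.comp hAm)
  have e1 : ∫ p, g ((A p.1).symm p.2) * materialDeriv u φ p.1 p.2 ∂spaceTime =
      ∫ p, g p.2 * materialDeriv u φ p.1 (A p.1 p.2) ∂spaceTime := by
    conv_lhs => rw [← hΘ.map_eq]
    rw [integral_map hΘ.measurable.aemeasurable hG.aestronglyMeasurable]
    simp
  have hint : Integrable (fun p : ℝ × T2 => g p.2 * materialDeriv u φ p.1 (A p.1 p.2))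
      spaceTime := by
    refine integrable_spaceTime_of_bounded hGΘ.aestronglyMeasurable (M * C) fun p hp => ?_
    rw [norm_mul]
    exact mul_le_mul (hM _) (hC u _ _ hp (hu1 _ _)) (norm_nonneg _) ((abs_nonneg _).trans (hM p.2))
  rw [e1, spaceTime, integral_prod_symm _ hint, ← integral_neg]
  congr 1
  funext x
  simp only
  rw [integral_const_mul, ← mul_neg]
  congr 1
  obtain ⟨z, rfl⟩ := toT2_surjective x
  obtain ⟨γ, g1, -, g3, g4, D, hD, g5⟩ := hA z
  have hγ : Continuous γ := by
    refine (LipschitzWith.of_dist_le_mul (K := 1) fun s t => ?_).continuous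
    simpa [dist_eq_norm, Real.dist_eq] using g3 s t
  rw [integral_Icc_eq_integral_Ioc, ← intervalIntegral.integral_of_le zero_le_one]
  -- Along a trajectory the material derivative is the time derivative of `φ` except at countably
  -- many times. The end value vanishes and the start contributes `-φ 0 x`.
  have h0 := integral_eq_of_hasDerivAt_off_countable (fun t => lift φ (t, γ t))
    (fun t => materialDeriv u φ t (A t (toT2 z))) (a := 0) (b := 1) hD
    (hφ.smooth.continuous.comp (continuous_id.prodMk hγ)).continuousOn ?_ ?_
  · rw [h0]
    obtain ⟨s, hs, hv⟩ := hφ.vanish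
    simp [lift, hv 1 hs.le, g1 0 le_rfl]
  · intro t ht
    simp only [zero_le_one, min_eq_left, max_eq_right] at ht
    have h1 := (hφ.differentiable (t, γ t)).hasFDerivAt
    have h2 := (hasDerivAt_id t).prodMk (g5 t ht)
    have h3 := h1.comp_hasDerivAt t h2
    rw [← g4, hφ.materialDeriv_eq, g4]
    exact h3
  · rw [intervalIntegrable_iff_integrableOn_Icc_of_le zero_le_one]
    refine Integrable.of_bound (C := C) ?_ ?_
    · exact (hHm.comp (hAm.comp measurable_prodMk_right)).aestronglyMeasurable
    · filter_upwards [ae_restrict_mem measurableSet_Icc] with t ht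
      exact hC u _ _ ht (hu1 _ _)

/-- A velocity field bounded by `1` for which constants satisfy the weak formulation of the
transport equation is divergence free. -/
lemma isDivFree_of_integral {u : ℝ → T2 → (Fin 2 → ℝ)}
    (hu : Measurable fun p : ℝ × T2 => u p.1 p.2) (hu1 : ∀ t x, ‖u t x‖ ≤ 1)
    (h : ∀ φ, IsTestFunction φ → ∫ p, materialDeriv u φ p.1 p.2 ∂spaceTime = - ∫ x, φ 0 x) :
    IsDivFree u := by
  refine ⟨Integrable.of_bound hu.aestronglyMeasurable 1 (Eventually.of_forall fun p => hu1 _ _),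
    fun φ hφ _ => ?_⟩
  obtain ⟨C, hC⟩ := hφ.exists_bound
  -- For the zero field the material derivative is the bare time derivative. Subtracting this
  -- identity from the assumed one isolates the integral of `u · ∇φ`.
  have h0 := integral_mul_materialDeriv (u := fun _ => 0) (A := fun _ => MeasurableEquiv.refl T2)
    measurable_const (by simp) (flowOn_refl fun _ _ => rfl) measurable_id measurable_id
    (fun _ => MeasurePreserving.id _) (g := fun _ => 1) measurable_const (M := 1) (by simp) hφ
  simp only [one_mul] at h0
  have e : ∀ p : ℝ × T2, advect u φ p.1 p.2 =
      materialDeriv u φ p.1 p.2 - materialDeriv (fun _ => 0) φ p.1 p.2 := fun p => by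
    simp [materialDeriv, advect]
  simp_rw [e]
  rw [integral_sub, h φ hφ, h0, sub_self]
  · exact integrable_spaceTime_of_bounded (hφ.measurable_materialDeriv hu).aestronglyMeasurable C
      fun p hp => hC _ _ _ hp (hu1 _ _)
  · exact integrable_spaceTime_of_bounded
      (hφ.measurable_materialDeriv measurable_const).aestronglyMeasurable C
      fun p hp => hC _ _ _ hp (by simp)

/-- A bounded measurable solution of the weak formulation, with a velocity field bounded by `1`, is
a weak solution. -/
lemma isWeakSolution_of_integral {u : ℝ → T2 → (Fin 2 → ℝ)}
    (hu : Measurable fun p : ℝ × T2 => u p.1 p.2) (hu1 : ∀ t x, ‖u t x‖ ≤ 1) (hdiv : IsDivFree u)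
    {f₀ : T2 → ℝ} (hf₀ : Integrable f₀ volume) {f : ℝ → T2 → ℝ}
    (hf : AEStronglyMeasurable (fun p : ℝ × T2 => f p.1 p.2) spaceTime) {M : ℝ}
    (hM : ∀ t x, |f t x| ≤ M)
    (h : ∀ φ, IsTestFunction φ →
      ∫ p, f p.1 p.2 * materialDeriv u φ p.1 p.2 ∂spaceTime = - ∫ x, f₀ x * φ 0 x) :
    IsWeakSolution u f₀ f := by
  refine ⟨hdiv, hf₀, integrable_spaceTime_of_bounded hf M fun p _ => hM _ _, ?_, h⟩
  refine Integrable.of_bound (hf.smul hu.aestronglyMeasurable) M (Eventually.of_forall fun p => ?_)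
  change ‖f p.1 p.2 • u p.1 p.2‖ ≤ M
  rw [norm_smul]
  calc _ ≤ M * 1 := mul_le_mul (hM _ _) (hu1 _ _) (norm_nonneg _) ((abs_nonneg _).trans (hM 0 p.2))
    _ = M := mul_one M

/-! ### The solutions along the truncated field -/

lemma IsWeakSolution.congr_data {u : ℝ → T2 → (Fin 2 → ℝ)} {f₀ g₀ : T2 → ℝ} {f : ℝ → T2 → ℝ}
    (h : IsWeakSolution u g₀ f) (he : f₀ =ᵐ[volume] g₀) : IsWeakSolution u f₀ f := by
  refine ⟨h.velocity, h.data.congr he.symm, h.integrable, h.flux, fun φ hφ => ?_⟩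
  rw [h.weak φ hφ]
  congr 1
  refine integral_congr_ae ?_
  filter_upwards [he] with x hx
  rw [hx]

/-- An essentially bounded function has a bounded measurable representative. -/
lemma exists_bounded_representative {f₀ : T2 → ℝ} (hf₀ : MemLp f₀ ⊤ volume) :
    ∃ (g : T2 → ℝ) (M : ℝ), Measurable g ∧ (∀ x, |g x| ≤ M) ∧ f₀ =ᵐ[volume] g := by
  obtain ⟨h, hm, he⟩ := hf₀.aestronglyMeasurable
  set M := (eLpNorm f₀ ⊤ volume).toReal
  refine ⟨fun x => max (-M) (min (h x) M), M, ?_, fun x => ?_, ?_⟩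
  · exact measurable_const.max (hm.measurable.min measurable_const)
  · have : 0 ≤ M := ENNReal.toReal_nonneg
    rw [abs_le]
    exact ⟨le_max_left _ _, max_le (by linarith) (min_le_right _ _)⟩
  · have hb := ae_le_eLpNormEssSup (f := f₀) (μ := volume)
    filter_upwards [he, hb] with x hx hb
    have h1 : |f₀ x| ≤ M := by
      rw [← eLpNorm_exponent_top] at hb
      have := ENNReal.toReal_mono hf₀.2.ne hb
      rwa [toReal_enorm, Real.norm_eq_abs] at this
    rw [abs_le] at h1
    rw [← hx, min_eq_left h1.2, max_eq_right h1.1]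

section

variable {i : ℕ → Fin 2} {L : ℕ → ℕ} {τ : ℕ → ℝ}

lemma measurable_truncatedField (hfin : FinitenessCondition τ) (K : ℕ) :
    Measurable fun p : ℝ × T2 => truncatedField i L τ K p.1 p.2 :=
  measurable_fractalField hfin (dyadicUpTo_subset K)

lemma integral_truncated (hfin : FinitenessCondition τ) (hτ : ∀ k, 1 ≤ k → 0 < τ k) (K : ℕ)
    {g : T2 → ℝ} (hg : Measurable g) {M : ℝ} (hM : ∀ x, |g x| ≤ M) {φ : ℝ → T2 → ℝ}
    (hφ : IsTestFunction φ) :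
    ∫ p, g ((truncatedFlow i L τ K p.1).symm p.2) *
      materialDeriv (truncatedField i L τ K) φ p.1 p.2 ∂spaceTime = - ∫ x, g x * φ 0 x :=
  integral_mul_materialDeriv (measurable_truncatedField hfin K) (norm_fractalField_le _)
    (flowOn_truncatedFlow hfin hτ K) (measurable_uncurry_blockFlow _ _ _)
    (measurable_uncurry_blockFlow_symm _ _ _) (measurePreserving_blockFlow _ _ _) hg hM hφ

lemma isDivFree_truncatedField (hfin : FinitenessCondition τ) (hτ : ∀ k, 1 ≤ k → 0 < τ k)
    (K : ℕ) : IsDivFree (truncatedField i L τ K) := by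
  refine isDivFree_of_integral (measurable_truncatedField hfin K) (norm_fractalField_le _)
    fun φ hφ => ?_
  have := integral_truncated (i := i) (L := L) hfin hτ K (g := fun _ => 1) measurable_const
    (M := 1) (by simp) hφ
  simpa using this

/-- The function `g` transported by the flow of `u_K`. -/
def truncatedSol (i : ℕ → Fin 2) (L : ℕ → ℕ) (τ : ℕ → ℝ) (g : T2 → ℝ) (K : ℕ) (t : ℝ) (x : T2) :
    ℝ :=
  g ((truncatedFlow i L τ K t).symm x)

lemma measurable_truncatedSol {g : T2 → ℝ} (hg : Measurable g) (K : ℕ) :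
    Measurable fun p : ℝ × T2 => truncatedSol i L τ g K p.1 p.2 :=
  hg.comp (measurable_snd.comp (measurable_uncurry_blockFlow_symm K 0 0))

lemma integrable_of_bounded {g : T2 → ℝ} (hg : Measurable g) {M : ℝ} (hM : ∀ x, |g x| ≤ M) :
    Integrable g volume :=
  Integrable.of_bound hg.aestronglyMeasurable M (Eventually.of_forall hM)

lemma isWeakSolution_truncatedSol (hfin : FinitenessCondition τ) (hτ : ∀ k, 1 ≤ k → 0 < τ k)
    {g : T2 → ℝ} (hg : Measurable g) {M : ℝ} (hM : ∀ x, |g x| ≤ M) (K : ℕ) :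
    IsWeakSolution (truncatedField i L τ K) g (truncatedSol i L τ g K) :=
  isWeakSolution_of_integral (measurable_truncatedField hfin K) (norm_fractalField_le _)
    (isDivFree_truncatedField hfin hτ K) (integrable_of_bounded hg hM)
    (measurable_truncatedSol hg K).aestronglyMeasurable (fun _ _ => hM _)
    fun _ hφ => integral_truncated hfin hτ K hg hM hφ

/-- Applying `β` commutes with composition by the inverse flow, so `β (f)` is the solution
transported from `β ∘ g`. -/
lemma isRenormalised_truncatedSol (hfin : FinitenessCondition τ) (hτ : ∀ k, 1 ≤ k → 0 < τ k)
    {f₀ g : T2 → ℝ} (he : f₀ =ᵐ[volume] g) (hg : Measurable g) {M : ℝ} (hM : ∀ x, |g x| ≤ M)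
    (K : ℕ) : IsRenormalised (truncatedField i L τ K) f₀ (truncatedSol i L τ g K) := by
  refine ⟨(isWeakSolution_truncatedSol hfin hτ hg hM K).congr_data he, ?_⟩
  rintro β hβ ⟨C, hC⟩
  refine IsWeakSolution.congr_data (g₀ := fun x => β (g x)) ?_ (he.fun_comp β)
  exact isWeakSolution_truncatedSol hfin hτ (hβ.measurable.comp hg) (fun x => hC _) K

lemma isC0L1_truncatedSol {g : T2 → ℝ} (hg : Measurable g) {M : ℝ} (hM : ∀ x, |g x| ≤ M) (K : ℕ) :
    IsC0L1 (truncatedSol i L τ g K) := by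
  have hi := integrable_of_bounded hg hM
  refine ⟨fun t _ => ?_, fun t _ => ?_⟩
  · rw [memLp_one_iff_integrable]
    exact integrable_of_bounded (hg.comp (truncatedFlow i L τ K t).symm.measurable) fun _ => hM _
  · exact (stronglyContinuous_blockFlow K 0 0 g hi t).mono_left nhdsWithin_le_nhds

lemma isLinftyLinfty_truncatedSol {g : T2 → ℝ} (hg : Measurable g) {M : ℝ} (hM : ∀ x, |g x| ≤ M)
    (K : ℕ) : IsLinftyLinfty (truncatedSol i L τ g K) :=
  memLp_top_of_bound (measurable_truncatedSol hg K).aestronglyMeasurable M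
    (Eventually.of_forall fun _ => hM _)

lemma isLagrangianFlow_truncatedFlow (hfin : FinitenessCondition τ) (hτ : ∀ k, 1 ≤ k → 0 < τ k)
    (K : ℕ) : IsLagrangianFlow (truncatedField i L τ K) (truncatedFlow i L τ K) := by
  refine ⟨isDivFree_truncatedField hfin hτ K, fun t _ => measurePreserving_blockFlow _ _ _ _, ?_⟩
  refine Eventually.of_forall fun x => ?_
  obtain ⟨z, rfl⟩ := toT2_surjective x
  obtain ⟨γ, -, -, g3, g4, D, hD, g5⟩ := flowOn_truncatedFlow (i := i) (L := L) hfin hτ K z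
  have hγ : LipschitzWith 1 γ := by
    refine LipschitzWith.of_dist_le_mul (K := 1) fun s t => ?_
    simpa [dist_eq_norm, Real.dist_eq] using g3 s t
  refine ⟨γ, hγ.lipschitzOnWith.absolutelyContinuousOnInterval, fun t _ => g4 t, ?_⟩
  rw [ae_restrict_iff' measurableSet_Icc]
  have hc : (D ∪ {0, 1}).Countable := hD.union (by simp)
  filter_upwards [hc.ae_notMem volume] with t ht ht'
  simp only [mem_union, mem_insert_iff, mem_singleton_iff, not_or] at ht
  exact g5 t ⟨⟨lt_of_le_of_ne ht'.1 (Ne.symm ht.2.1), lt_of_le_of_ne ht'.2 ht.2.2⟩, ht.1⟩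

lemma truncatedFlow_zero (hfin : FinitenessCondition τ) (hτ : ∀ k, 1 ≤ k → 0 < τ k)
    (K : ℕ) (x : T2) : (truncatedFlow i L τ K 0).symm x = x := by
  rw [MeasurableEquiv.symm_apply_eq]
  exact ((flowOn_truncatedFlow hfin hτ K).apply_of_le le_rfl x).symm

lemma isLagrangianSolution_truncatedSol (hfin : FinitenessCondition τ)
    (hτ : ∀ k, 1 ≤ k → 0 < τ k) {f₀ g : T2 → ℝ} (he : f₀ =ᵐ[volume] g) (hg : Measurable g) {M : ℝ}
    (hM : ∀ x, |g x| ≤ M) (K : ℕ) :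
    IsLagrangianSolution (truncatedField i L τ K) f₀ (truncatedSol i L τ g K) := by
  refine ⟨(isWeakSolution_truncatedSol hfin hτ hg hM K).integrable, g, truncatedFlow i L τ K,
    integrable_of_bounded hg hM, isLagrangianFlow_truncatedFlow hfin hτ K, ?_,
    fun t _ => EventuallyEq.rfl⟩
  simpa only [truncatedFlow_zero hfin hτ K] using he

end

/-! ### Uniqueness of Fourier coefficients -/

/-- An integrable function that is orthogonal to all continuous functions vanishes. -/
lemma ae_eq_zero_of_forall_integral_mul_continuous {w : T2 → ℝ} (hw : Integrable w volume)
    (h : ∀ ψ : C(T2, ℝ), ∫ x, w x * ψ x = 0) : w =ᵐ[volume] 0 := by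
  refine ae_eq_zero_of_forall_setIntegral_isClosed_eq_zero hw fun F hF => ?_
  -- The indicator of a closed set is a pointwise limit of continuous functions with values in
  -- `[0,1]`.
  have h0 : Tendsto (fun n => ∫ x, w x * (hF.apprSeq n x : ℝ)) atTop
      (𝓝 (∫ x, w x * F.indicator (fun _ => (1 : ℝ)) x)) := by
    refine tendsto_integral_of_dominated_convergence (fun x => ‖w x‖) ?_ hw.norm ?_ ?_
    · intro n
      exact hw.aestronglyMeasurable.mul
        (NNReal.continuous_coe.comp (hF.apprSeq n).continuous).measurable.aestronglyMeasurable
    · refine fun n => Eventually.of_forall fun x => ?_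
      rw [norm_mul]
      have h1 : ‖((hF.apprSeq n x : NNReal) : ℝ)‖ ≤ 1 := by
        rw [Real.norm_of_nonneg (NNReal.coe_nonneg _)]
        exact_mod_cast HasOuterApproxClosed.apprSeq_apply_le_one hF n x
      exact mul_le_of_le_one_right (norm_nonneg _) h1
    · refine Eventually.of_forall fun x => ?_
      have h1 := (tendsto_pi_nhds.1 (HasOuterApproxClosed.tendsto_apprSeq hF)) x
      have h2 := (NNReal.tendsto_coe.2 h1).const_mul (w x)
      convert h2 using 2
      by_cases hx : x ∈ F <;> simp [hx]
  have h1 : ∀ n, ∫ x, w x * (hF.apprSeq n x : ℝ) = 0 := fun n =>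
    h ⟨fun x => (hF.apprSeq n x : ℝ), NNReal.continuous_coe.comp (hF.apprSeq n).continuous⟩
  simp_rw [h1] at h0
  have h2 := tendsto_nhds_unique h0 tendsto_const_nhds
  rw [← integral_indicator hF.measurableSet, ← h2]
  congr 1
  funext x
  by_cases hx : x ∈ F <;> simp [hx]

open UnitAddTorus in
/-- An integrable function whose Fourier coefficients vanish is zero. -/
lemma ae_eq_zero_of_forall_integral_mFourier {w : T2 → ℝ} (hw : Integrable w volume)
    (hre : ∀ n : Fin 2 → ℤ, ∫ x, w x * (mFourier n x).re = 0)
    (him : ∀ n : Fin 2 → ℤ, ∫ x, w x * (mFourier n x).im = 0) : w =ᵐ[volume] 0 := by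
  have hint : ∀ ψ : C(T2, ℂ), Integrable (fun x => (w x : ℂ) * ψ x) volume := fun ψ =>
    hw.ofReal.mul_bdd (c := ‖ψ‖) ψ.continuous.measurable.aestronglyMeasurable
      (Eventually.of_forall fun x => ψ.norm_coe_le_norm x)
  -- The continuous functions annihilated by `w` form a closed subspace. It contains all Fourier
  -- modes, whose span is dense, so it is everything.
  let V : Submodule ℂ C(T2, ℂ) :=
    { carrier := {ψ | ∫ x, (w x : ℂ) * ψ x = 0}
      add_mem' := by
        intro ψ χ hψ hχ
        change ∫ x, (w x : ℂ) * (ψ x + χ x) = 0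
        simp_rw [mul_add]
        rw [integral_add (hint ψ) (hint χ), hψ, hχ, add_zero]
      zero_mem' := by
        change ∫ x, (w x : ℂ) * (0 : ℂ) = 0
        simp
      smul_mem' := by
        intro c ψ hψ
        change ∫ x, (w x : ℂ) * (c * ψ x) = 0
        simp_rw [mul_left_comm _ c]
        rw [integral_const_mul, hψ, mul_zero] }
  have hcont : Continuous fun ψ : C(T2, ℂ) => ∫ x, (w x : ℂ) * ψ x := by
    refine (LipschitzWith.of_dist_le_mul (K := NNReal.mk (∫ x, ‖w x‖) (by positivity))
      fun ψ χ => ?_).continuous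
    rw [dist_eq_norm, ← integral_sub (hint ψ) (hint χ), NNReal.coe_mk, ← integral_mul_const]
    refine norm_integral_le_of_norm_le (hw.norm.mul_const _) (Eventually.of_forall fun x => ?_)
    rw [← mul_sub, norm_mul, Complex.norm_real, ← dist_eq_norm]
    gcongr
    exact ContinuousMap.dist_apply_le_dist x
  have hVc : IsClosed (V : Set C(T2, ℂ)) := isClosed_singleton.preimage hcont
  have hspan : Submodule.span ℂ (range (mFourier (d := Fin 2))) ≤ V := by
    rw [Submodule.span_le]
    rintro _ ⟨n, rfl⟩
    change ∫ x, (w x : ℂ) * mFourier n x = 0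
    have hi := hint (mFourier n)
    apply Complex.ext
    · rw [← RCLike.re_eq_complex_re, ← integral_re hi]
      simpa using hre n
    · rw [← RCLike.im_eq_complex_im, ← integral_im hi]
      simpa using him n
  have htop : V = ⊤ := by
    rw [eq_top_iff, ← span_mFourier_closure_eq_top]
    exact Submodule.topologicalClosure_minimal _ hspan hVc
  refine ae_eq_zero_of_forall_integral_mul_continuous hw fun ψ => ?_
  have hmem : (⟨fun x => (ψ x : ℂ), Complex.continuous_ofReal.comp ψ.continuous⟩ : C(T2, ℂ)) ∈ V := by
    rw [htop]; trivial
  have h1 : ∫ x, (w x : ℂ) * (ψ x : ℂ) = 0 := hmem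
  have h2 : ∫ x, ((w x * ψ x : ℝ) : ℂ) = 0 := by simpa using h1
  rw [integral_complex_ofReal] at h2
  exact_mod_cast h2

/-! ### Uniqueness while a single shear acts -/

/-- The function `sin (2πLz)` on the circle; its sign is the square wave. -/
def wave (L : ℕ) (z : UnitAddCircle) : ℝ := (fourier (L : ℤ) z).im

lemma wave_coe (L : ℕ) (r : ℝ) : wave L (r : UnitAddCircle) = Real.sin (2 * L * r * Real.pi) := by
  rw [wave, fourier_coe_apply]
  have : 2 * (Real.pi : ℂ) * Complex.I * ((L : ℤ) : ℂ) * (r : ℂ) / ((1 : ℝ) : ℂ) =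
      ((2 * L * r * Real.pi : ℝ) : ℂ) * Complex.I := by
    push_cast; ring
  rw [this, Complex.exp_ofReal_mul_I_im]

/-- Writing `2 L r` as integer plus fractional part, the integer `n` contributes the factor `(-1)^n`
and the fractional part a nonnegative sine. -/
lemma shearSign_of_wave_pos {L : ℕ} {z : UnitAddCircle} (h : 0 < wave L z) : shearSign L z = 1 := by
  induction z using QuotientAddGroup.induction_on with
  | H r =>
    change 0 < wave L (r : UnitAddCircle) at h
    rw [wave_coe, ← Int.fract_add_floor (2 * (L : ℝ) * r), add_mul, Real.sin_add_int_mul_pi] at h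
    rw [shearSign_coe]
    have hs : 0 ≤ Real.sin (Int.fract (2 * (L : ℝ) * r) * Real.pi) :=
      Real.sin_nonneg_of_nonneg_of_le_pi (by have := Real.pi_pos; positivity)
        (mul_le_of_le_one_left Real.pi_pos.le (Int.fract_lt_one _).le)
    rw [if_pos]
    by_contra he
    rw [Int.not_even_iff_odd] at he
    rw [he.neg_one_zpow] at h
    linarith

lemma shearSign_of_wave_neg {L : ℕ} {z : UnitAddCircle} (h : wave L z < 0) :
    shearSign L z = -1 := by
  induction z using QuotientAddGroup.induction_on with
  | H r =>
    change wave L (r : UnitAddCircle) < 0 at h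
    rw [wave_coe, ← Int.fract_add_floor (2 * (L : ℝ) * r), add_mul, Real.sin_add_int_mul_pi] at h
    rw [shearSign_coe]
    have hs : 0 ≤ Real.sin (Int.fract (2 * (L : ℝ) * r) * Real.pi) :=
      Real.sin_nonneg_of_nonneg_of_le_pi (by have := Real.pi_pos; positivity)
        (mul_le_of_le_one_left Real.pi_pos.le (Int.fract_lt_one _).le)
    rw [if_neg]
    intro he
    rw [he.neg_one_zpow] at h
    linarith

lemma measurable_wave (L : ℕ) : Measurable (wave L) :=
  Complex.measurable_im.comp (fourier (L : ℤ)).continuous.measurable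

/-- The stripe boundaries are null, because the zeros of the sine are the countably many points `n /
(2 L)`. The smooth cutoffs may therefore be removed in the limit. -/
lemma ae_wave_ne_zero {L : ℕ} (hL : 1 ≤ L) (j : Fin 2) : ∀ᵐ x : T2, wave L (x j) ≠ 0 := by
  have hs : {r : ℝ | wave L (r : UnitAddCircle) = 0} ⊆ range fun n : ℤ => (n / (2 * L) : ℝ) := by
    intro r hz
    change wave L (r : UnitAddCircle) = 0 at hz
    rw [wave_coe, Real.sin_eq_zero_iff] at hz
    obtain ⟨n, hn⟩ := hz
    have h1 : (n : ℝ) = 2 * L * r := mul_right_cancel₀ Real.pi_ne_zero hn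
    have h2 : (0 : ℝ) < L := by exact_mod_cast hL
    exact ⟨n, by simp only [h1]; field_simp⟩
  have h1 : ∀ᵐ z : UnitAddCircle, wave L z ≠ 0 := by
    have hmp := UnitAddCircle.measurePreserving_mk 0
    rw [← hmp.map_eq]
    refine (ae_map_iff (p := fun z => wave L z ≠ 0) hmp.measurable.aemeasurable
      (measurable_wave L (measurableSet_singleton 0)).compl).2 (ae_restrict_of_ae ?_)
    filter_upwards [((countable_range _).mono hs).ae_notMem volume] with r hr using hr
  exact (Measure.quasiMeasurePreserving_eval (fun _ : Fin 2 => (volume : Measure UnitAddCircle))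
    j).ae h1

/-- The test functions used to prove uniqueness: `E` transported by the shear of velocity `σ c`,
and cut off to the stripes on which the square wave has sign `σ`. -/
def stripeTest (i : Fin 2) (L : ℕ) (c σ : ℝ) (θ : ℝ → ℝ) (E : T2 → ℝ) (N : ℕ) (t : ℝ) (x : T2) : ℝ :=
  θ t * Real.smoothTransition (N * (σ * wave L (x (1 - i)))) * E (translate i (-(σ * c * t)) x)

variable {i : Fin 2} {L : ℕ} {c σ : ℝ} {θ : ℝ → ℝ} {E : T2 → ℝ}

lemma stripeTest_toT2 (N : ℕ) (t : ℝ) (y : Fin 2 → ℝ) :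
    stripeTest i L c σ θ E N t (toT2 y) = θ t * Real.smoothTransition
      (N * (σ * Real.sin (2 * L * y (1 - i) * Real.pi))) *
        E (toT2 (y + Pi.single i (-(σ * c * t)))) := by
  rw [stripeTest, translate, toT2_add, toT2_single]
  congr 4
  exact congrArg (σ * ·) (wave_coe L _)

lemma isTestFunction_stripeTest (hθ : ContDiff ℝ ∞ θ) {b : ℝ} (hb : b < 1)
    (hθb : ∀ t, b ≤ t → θ t = 0) (hE : ContDiff ℝ ∞ fun y => E (toT2 y)) (N : ℕ) :
    IsTestFunction (stripeTest i L c σ θ E N) := by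
  refine ⟨?_, b, hb, fun t ht x => by simp [stripeTest, hθb t ht]⟩
  simp_rw [stripeTest_toT2]
  refine ((hθ.comp contDiff_fst).mul (Real.smoothTransition.contDiff.comp ?_)).mul (hE.comp ?_)
  · have h1 : ContDiff ℝ ∞ fun p : ℝ × (Fin 2 → ℝ) => p.2 (1 - i) :=
      (contDiff_apply ℝ ℝ (1 - i)).comp contDiff_snd
    exact contDiff_const.mul (contDiff_const.mul
      (Real.contDiff_sin.comp ((contDiff_const.mul h1).mul contDiff_const)))
  · refine contDiff_snd.add ?_
    rw [contDiff_pi]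
    intro j
    rcases eq_or_ne j i with rfl | h
    · simp only [Pi.single_eq_same]
      exact (contDiff_const.mul contDiff_fst).neg
    · simp only [Pi.single_eq_of_ne h]
      exact contDiff_const

lemma IsTestFunction.materialDeriv_eq_deriv {φ : ℝ → T2 → ℝ} (hφ : IsTestFunction φ)
    (u : ℝ → T2 → (Fin 2 → ℝ)) (t : ℝ) (y : Fin 2 → ℝ) :
    materialDeriv u φ t (toT2 y) =
      deriv (fun s : ℝ => φ (t + s) (toT2 (y + s • u t (toT2 y)))) 0 := by
  rw [hφ.materialDeriv_eq]
  have h1 := (hφ.differentiable (t, y)).hasFDerivAt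
  have h2 : HasDerivAt (fun s : ℝ => (t + s, y + s • u t (toT2 y))) (1, u t (toT2 y)) 0 := by
    refine ((hasDerivAt_id' (0 : ℝ)).const_add t).prodMk (HasDerivAt.const_add y ?_)
    simpa using (hasDerivAt_id' (0 : ℝ)).smul_const (u t (toT2 y))
  refine Eq.symm (HasFDerivAt.comp_hasDerivAt (f := fun s : ℝ => (t + s, y + s • u t (toT2 y)))
    (0 : ℝ) (l := lift φ) ?_ h2).deriv
  simpa using h1

lemma shearSign_of_cutoff_ne_zero (hσ : σ = 1 ∨ σ = -1) {N : ℕ} {z : UnitAddCircle}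
    (h : Real.smoothTransition (N * (σ * wave L z)) ≠ 0) : shearSign L z = σ := by
  have h1 : 0 < σ * wave L z := by
    by_contra hle
    refine h (Real.smoothTransition.zero_of_nonpos ?_)
    exact mul_nonpos_of_nonneg_of_nonpos (Nat.cast_nonneg N) (not_lt.1 hle)
  rcases hσ with rfl | rfl
  · exact shearSign_of_wave_pos (by linarith)
  · exact shearSign_of_wave_neg (by linarith)

/-- Where the cutoff is nonzero the velocity is `σ c` along axis `i`. Along such a line both the
cutoff and the argument of `E` are constant, so the derivative falls on `θ` alone. -/
lemma materialDeriv_stripeTest (hσ : σ = 1 ∨ σ = -1) (hθ : ContDiff ℝ ∞ θ) {b : ℝ} (hb : b < 1)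
    (hθb : ∀ t, b ≤ t → θ t = 0) (hE : ContDiff ℝ ∞ fun y => E (toT2 y)) (N : ℕ)
    {u : ℝ → T2 → (Fin 2 → ℝ)} {t : ℝ} (hu : ∀ x, u t x = c • shearField i L x) (x : T2) :
    materialDeriv u (stripeTest i L c σ θ E N) t x = deriv θ t *
      Real.smoothTransition (N * (σ * wave L (x (1 - i)))) * E (shearFlow i L (-(c * t)) x) := by
  obtain ⟨y, rfl⟩ := toT2_surjective x
  rw [(isTestFunction_stripeTest hθ hb hθb hE N).materialDeriv_eq_deriv, hu]
  set x := toT2 y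
  have hother : ∀ s : ℝ, toT2 (y + s • c • shearField i L x) (1 - i) = x (1 - i) := by
    intro s
    simp [toT2, x, shearField, Pi.single_eq_of_ne (one_sub_ne i)]
  by_cases hcut : Real.smoothTransition (N * (σ * wave L (x (1 - i)))) = 0
  · have : (fun s : ℝ => stripeTest i L c σ θ E N (t + s) (toT2 (y + s • c • shearField i L x))) =
        fun _ => 0 := by
      funext s
      rw [stripeTest, hother, hcut]; simp
    rw [this, hcut]; simp
  · have hsign := shearSign_of_cutoff_ne_zero hσ hcut
    have : (fun s : ℝ => stripeTest i L c σ θ E N (t + s) (toT2 (y + s • c • shearField i L x))) =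
        fun s => θ (t + s) * (Real.smoothTransition (N * (σ * wave L (x (1 - i)))) *
          E (shearFlow i L (-(c * t)) x)) := by
      funext s
      rw [stripeTest, hother, mul_assoc]
      congr 3
      rw [translate, shearFlow, hsign, shearField, hsign, ← Pi.single_smul, ← Pi.single_smul,
        toT2_add, toT2_single, add_assoc, ← Pi.single_add, ← AddCircle.coe_add]
      congr 3
      simp only [smul_eq_mul]
      ring
    rw [this, mul_assoc]
    have hd : HasDerivAt (fun s => θ (t + s)) (deriv θ t) 0 := by
      have h1 : HasDerivAt θ (deriv θ t) (t + 0) := by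
        rw [add_zero]
        exact (hθ.differentiable (by simp) t).hasDerivAt
      simpa using h1.comp_const_add t 0
    exact (hd.mul_const _).deriv

/-- `h` vanishes before time `a`. -/
def VanishesBefore (h : ℝ × T2 → ℝ) (a : ℝ) : Prop := ∀ᵐ p ∂spaceTime, p.1 < a → h p = 0

lemma ae_spaceTime_fst_ne (a : ℝ) : ∀ᵐ p ∂spaceTime, p.1 ≠ a := by
  have h1 : ∀ᵐ t ∂(volume : Measure ℝ).restrict (Icc 0 1), t ≠ a :=
    ae_restrict_of_ae (by simpa using (countable_singleton a).ae_notMem volume)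
  exact (Measure.quasiMeasurePreserving_fst (μ := (volume : Measure ℝ).restrict (Icc 0 1))
    (ν := (volume : Measure T2))).ae h1

lemma materialDeriv_of_vanish {φ : ℝ → T2 → ℝ} (hφ : IsTestFunction φ) {b : ℝ}
    (hb : ∀ t, b ≤ t → ∀ x, φ t x = 0) (u : ℝ → T2 → (Fin 2 → ℝ)) {t : ℝ} (ht : b < t) (x : T2) :
    materialDeriv u φ t x = 0 := by
  obtain ⟨y, rfl⟩ := toT2_surjective x
  rw [hφ.materialDeriv_eq]
  have : lift φ =ᶠ[𝓝 (t, y)] fun _ => 0 := by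
    have : Ioi b ×ˢ univ ∈ 𝓝 (t, y) := prod_mem_nhds (Ioi_mem_nhds ht) univ_mem
    filter_upwards [this] with p hp using hb p.1 (le_of_lt hp.1) _
  rw [this.fderiv_eq]
  simp

/-- The field is known only on `(a, b)`, and this is enough: `h` vanishes before `a`, and the test
function vanishes from `b' < b` on. -/
lemma integral_stripe_eq_zero (hσ : σ = 1 ∨ σ = -1) {h : ℝ × T2 → ℝ}
    {u : ℝ → T2 → (Fin 2 → ℝ)}
    (hweak : ∀ φ, IsTestFunction φ → ∫ p, h p * materialDeriv u φ p.1 p.2 ∂spaceTime = 0)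
    {a b : ℝ} (hb1 : b ≤ 1) (hu : ∀ t ∈ Ioo a b, ∀ x, u t x = c • shearField i L x)
    (ha : VanishesBefore h a) (hθ : ContDiff ℝ ∞ θ) {b' : ℝ} (hb' : b' < b)
    (hθb : ∀ t, b' ≤ t → θ t = 0) (hE : ContDiff ℝ ∞ fun y => E (toT2 y)) (N : ℕ) :
    ∫ p, h p * (deriv θ p.1 * Real.smoothTransition (N * (σ * wave L (p.2 (1 - i)))) *
      E (shearFlow i L (-(c * p.1)) p.2)) ∂spaceTime = 0 := by
  have hφ := isTestFunction_stripeTest (i := i) (L := L) (c := c) (σ := σ) hθ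
    (hb'.trans_le hb1) hθb hE N
  rw [← hweak _ hφ]
  refine integral_congr_ae ?_
  filter_upwards [ha, ae_spaceTime_fst_ne a, ae_spaceTime_fst_ne b'] with p hp hpa hpb
  rcases lt_or_gt_of_ne hpa with h1 | h1
  · simp [hp h1]
  congr 1
  rcases lt_or_gt_of_ne hpb with h2 | h2
  · exact (materialDeriv_stripeTest hσ hθ (hb'.trans_le hb1) hθb hE N
      (hu p.1 ⟨h1, h2.trans hb'⟩) p.2).symm
  · rw [materialDeriv_of_vanish hφ (fun t ht x => by simp [stripeTest, hθb t ht]) u h2]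
    have : θ =ᶠ[𝓝 p.1] fun _ => 0 := by
      filter_upwards [Ioi_mem_nhds h2] with s hs using hθb s (le_of_lt hs)
    rw [this.deriv_eq]
    simp

section

variable {i : Fin 2} {L : ℕ} {c : ℝ} {θ : ℝ → ℝ} {E : T2 → ℝ}

/-- Once `N |s| ≥ 1`, the cutoff of the correct sign equals `1` and the other equals `0`. -/
lemma tendsto_cutoff {s : ℝ} (hs : s ≠ 0) :
    Tendsto (fun N : ℕ => Real.smoothTransition (N * (1 * s)) + Real.smoothTransition (N * (-1 * s)))
      atTop (𝓝 1) := by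
  refine tendsto_const_nhds.congr' ?_
  obtain ⟨N₀, hN₀⟩ := exists_nat_ge (1 / |s|)
  have hpos : 0 < |s| := abs_pos.2 hs
  filter_upwards [eventually_ge_atTop N₀] with N hN
  have h1 : 1 ≤ N * |s| := by
    have : (N₀ : ℝ) ≤ N := by exact_mod_cast hN
    rw [div_le_iff₀ hpos] at hN₀
    nlinarith
  rcases lt_or_gt_of_ne hs with h | h
  · rw [abs_of_neg h] at h1
    rw [Real.smoothTransition.zero_of_nonpos (by nlinarith), Real.smoothTransition.one_of_one_le
      (by nlinarith), zero_add]
  · rw [abs_of_pos h] at h1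
    rw [Real.smoothTransition.one_of_one_le (by nlinarith), Real.smoothTransition.zero_of_nonpos
      (by nlinarith), add_zero]

lemma measurable_E_shearFlow (hEm : Measurable E) :
    Measurable fun p : ℝ × T2 => E (shearFlow i L (-(c * p.1)) p.2) :=
  hEm.comp ((measurable_shearFlow_uncurry i L).comp
    ((measurable_const.mul measurable_fst).neg.prodMk measurable_snd))

/-- Adding the identities for both signs and letting `N → ∞` removes the cutoff, although the shear
composed with `E` is itself not an admissible test function across the stripes. -/
lemma integral_deriv_mul_shear_eq_zero (hL : 1 ≤ L) {h : ℝ × T2 → ℝ} (hh : Integrable h spaceTime)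
    {u : ℝ → T2 → (Fin 2 → ℝ)}
    (hweak : ∀ φ, IsTestFunction φ → ∫ p, h p * materialDeriv u φ p.1 p.2 ∂spaceTime = 0)
    {a b : ℝ} (hb1 : b ≤ 1) (hu : ∀ t ∈ Ioo a b, ∀ x, u t x = c • shearField i L x)
    (ha : VanishesBefore h a) (hθ : ContDiff ℝ ∞ θ) {b' : ℝ} (hb' : b' < b)
    (hθb : ∀ t, b' ≤ t → θ t = 0) (hE : ContDiff ℝ ∞ fun y => E (toT2 y)) (hEm : Measurable E)
    (hE1 : ∀ x, |E x| ≤ 1) :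
    ∫ p, h p * (deriv θ p.1 * E (shearFlow i L (-(c * p.1)) p.2)) ∂spaceTime = 0 := by
  have hdθ : Continuous (deriv θ) := hθ.continuous_deriv (by simp)
  obtain ⟨C, hC⟩ := (isCompact_Icc (a := (0 : ℝ)) (b := 1)).exists_bound_of_continuousOn
    hdθ.continuousOn
  have hwm : Measurable fun p : ℝ × T2 => wave L (p.2 (1 - i)) :=
    (measurable_wave L).comp ((measurable_pi_apply _).comp measurable_snd)
  have hSm : ∀ (N : ℕ) (σ : ℝ), Measurable fun p : ℝ × T2 =>
      Real.smoothTransition (N * (σ * wave L (p.2 (1 - i)))) := fun N σ =>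
    Real.smoothTransition.continuous.measurable.comp
      (measurable_const.mul (measurable_const.mul hwm))
  have hdm : Measurable fun p : ℝ × T2 => deriv θ p.1 := hdθ.measurable.comp measurable_fst
  have hSE := measurable_E_shearFlow (i := i) (L := L) (c := c) hEm
  have hbound : ∀ (N : ℕ) (σ : ℝ), ∀ᵐ p ∂spaceTime, ‖h p * (deriv θ p.1 *
      Real.smoothTransition (N * (σ * wave L (p.2 (1 - i)))) *
      E (shearFlow i L (-(c * p.1)) p.2))‖ ≤ ‖h p‖ * C := by
    intro N σ
    filter_upwards [ae_spaceTime_mem] with p hp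
    rw [norm_mul]
    gcongr
    rw [norm_mul, norm_mul]
    have h1 := hC p.1 hp
    have h2 : ‖Real.smoothTransition (N * (σ * wave L (p.2 (1 - i))))‖ ≤ 1 := by
      rw [Real.norm_of_nonneg (Real.smoothTransition.nonneg _)]
      exact Real.smoothTransition.le_one _
    calc _ ≤ C * 1 * 1 := by
          gcongr
          · exact mul_nonneg ((norm_nonneg _).trans h1) zero_le_one
          · exact (norm_nonneg _).trans h1
          · exact hE1 _
      _ = C := by ring
  have hm : ∀ (N : ℕ) (σ : ℝ), AEStronglyMeasurable (fun p => h p * (deriv θ p.1 *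
      Real.smoothTransition (N * (σ * wave L (p.2 (1 - i)))) *
      E (shearFlow i L (-(c * p.1)) p.2))) spaceTime := fun N σ =>
    hh.aestronglyMeasurable.mul ((hdm.mul (hSm N σ)).mul hSE).aestronglyMeasurable
  have hint : ∀ (N : ℕ) (σ : ℝ), Integrable (fun p => h p * (deriv θ p.1 *
      Real.smoothTransition (N * (σ * wave L (p.2 (1 - i)))) *
      E (shearFlow i L (-(c * p.1)) p.2))) spaceTime := fun N σ =>
    (hh.norm.mul_const C).mono' (hm N σ) (hbound N σ)
  have hzero : ∀ N : ℕ, ∫ p, (h p * (deriv θ p.1 *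
      Real.smoothTransition (N * (1 * wave L (p.2 (1 - i)))) *
      E (shearFlow i L (-(c * p.1)) p.2)) + h p * (deriv θ p.1 *
      Real.smoothTransition (N * (-1 * wave L (p.2 (1 - i)))) *
      E (shearFlow i L (-(c * p.1)) p.2))) ∂spaceTime = 0 := by
    intro N
    rw [integral_add (hint N 1) (hint N (-1)),
      integral_stripe_eq_zero (Or.inl rfl) hweak hb1 hu ha hθ hb' hθb hE N,
      integral_stripe_eq_zero (Or.inr rfl) hweak hb1 hu ha hθ hb' hθb hE N, add_zero]
  have hlim : Tendsto (fun N : ℕ => ∫ p, (h p * (deriv θ p.1 *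
      Real.smoothTransition (N * (1 * wave L (p.2 (1 - i)))) *
      E (shearFlow i L (-(c * p.1)) p.2)) + h p * (deriv θ p.1 *
      Real.smoothTransition (N * (-1 * wave L (p.2 (1 - i)))) *
      E (shearFlow i L (-(c * p.1)) p.2))) ∂spaceTime) atTop
      (𝓝 (∫ p, h p * (deriv θ p.1 * E (shearFlow i L (-(c * p.1)) p.2)) ∂spaceTime)) := by
    refine tendsto_integral_of_dominated_convergence (fun p => ‖h p‖ * C + ‖h p‖ * C)
      (fun N => (hm N 1).add (hm N (-1))) ((hh.norm.mul_const C).add (hh.norm.mul_const C))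
      (fun N => ?_) ?_
    · filter_upwards [hbound N 1, hbound N (-1)] with p h1 h2
      exact (norm_add_le _ _).trans (add_le_add h1 h2)
    · have hw : ∀ᵐ p ∂spaceTime, wave L (p.2 (1 - i)) ≠ 0 :=
        (Measure.quasiMeasurePreserving_snd (μ := (volume : Measure ℝ).restrict (Icc 0 1))
          (ν := (volume : Measure T2))).ae (ae_wave_ne_zero hL (1 - i))
      filter_upwards [hw] with p hp
      have h1 := ((tendsto_cutoff hp).mul_const
        (h p * (deriv θ p.1 * E (shearFlow i L (-(c * p.1)) p.2))))
      rw [one_mul (h p * _)] at h1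
      refine h1.congr fun N => ?_
      ring
  simp_rw [hzero] at hlim
  exact (tendsto_nhds_unique hlim tendsto_const_nhds)

/-- Smooth functions with compact support in `(a, b)` are derivatives of smooth functions that
vanish from some time before `b` on. -/
lemma exists_primitive {ρ : ℝ → ℝ} (hρ : ContDiff ℝ ∞ ρ) (hc : HasCompactSupport ρ) {a b : ℝ}
    (hs : tsupport ρ ⊆ Ioo a b) :
    ∃ θ : ℝ → ℝ, ContDiff ℝ ∞ θ ∧ (∃ b' < b, ∀ t, b' ≤ t → θ t = 0) ∧ deriv θ = ρ := by
  -- Basing the primitive at `b` makes it vanish after the support of `ρ`. It need not vanish before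
  -- that support, where the solution will be known to be zero.
  have hd : ∀ t, HasDerivAt (fun t => ∫ r in b..t, ρ r) (ρ t) t := fun t =>
    intervalIntegral.integral_hasDerivAt_right (hρ.continuous.intervalIntegrable _ _)
      hρ.continuous.aestronglyMeasurable.stronglyMeasurableAtFilter hρ.continuous.continuousAt
  have hder : deriv (fun t => ∫ r in b..t, ρ r) = ρ := funext fun t => (hd t).deriv
  refine ⟨fun t => ∫ r in b..t, ρ r, ?_, ?_, hder⟩
  · rw [contDiff_infty_iff_deriv, hder]
    exact ⟨fun t => (hd t).differentiableAt, hρ⟩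
  · have hb : ∃ b' < b, ∀ t, b' ≤ t → ρ t = 0 := by
      rcases (tsupport ρ).eq_empty_or_nonempty with he | hne
      · refine ⟨b - 1, by linarith, fun t _ => ?_⟩
        exact image_eq_zero_of_notMem_tsupport (by simp [he])
      · obtain ⟨m, hm, hmax⟩ := hc.isCompact.exists_isGreatest hne
        refine ⟨(m + b) / 2, by linarith [(hs hm).2], fun t ht => ?_⟩
        refine image_eq_zero_of_notMem_tsupport fun hmem => ?_
        have := hmax hmem
        linarith [(hs hm).2]
    obtain ⟨b', hb', h0⟩ := hb
    refine ⟨b', hb', fun t ht => ?_⟩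
    refine intervalIntegral.integral_zero_ae (Eventually.of_forall fun r hr => h0 r ?_)
    rcases le_total b t with h | h
    · rw [uIoc_of_le h] at hr; linarith [hr.1]
    · rw [uIoc_of_ge h] at hr; linarith [hr.1]

/-- Almost every time slice is orthogonal to each transported test function. -/
lemma ae_integral_mul_shear_eq_zero (hL : 1 ≤ L) {h : ℝ × T2 → ℝ} (hh : Integrable h spaceTime)
    {u : ℝ → T2 → (Fin 2 → ℝ)}
    (hweak : ∀ φ, IsTestFunction φ → ∫ p, h p * materialDeriv u φ p.1 p.2 ∂spaceTime = 0)
    {a b : ℝ} (hb1 : b ≤ 1) (hu : ∀ t ∈ Ioo a b, ∀ x, u t x = c • shearField i L x)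
    (ha : VanishesBefore h a) (hE : ContDiff ℝ ∞ fun y => E (toT2 y)) (hEm : Measurable E)
    (hE1 : ∀ x, |E x| ≤ 1) :
    ∀ᵐ t ∂(volume : Measure ℝ).restrict (Icc 0 1), t ∈ Ioo a b →
      ∫ x, h (t, x) * E (shearFlow i L (-(c * t)) x) = 0 := by
  have hSE := measurable_E_shearFlow (i := i) (L := L) (c := c) hEm
  have hint : Integrable (fun p : ℝ × T2 => h p * E (shearFlow i L (-(c * p.1)) p.2)) spaceTime :=
    hh.mul_bdd (c := 1) hSE.aestronglyMeasurable (Eventually.of_forall fun p => hE1 _)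
  have hq : Integrable (fun t => ∫ x, h (t, x) * E (shearFlow i L (-(c * t)) x))
      ((volume : Measure ℝ).restrict (Icc 0 1)) := hint.integral_prod_left
  -- This is the fundamental lemma of the calculus of variations in time; each admissible weight `ρ`
  -- is realised as some `θ'`.
  refine isOpen_Ioo.ae_eq_zero_of_integral_contDiff_smul_eq_zero
    (hq.locallyIntegrable.locallyIntegrableOn _) fun ρ hρ hρc hρs => ?_
  obtain ⟨θ, hθ, ⟨b', hb', hθb⟩, hder⟩ := exists_primitive hρ hρc hρs
  have h0 := integral_deriv_mul_shear_eq_zero hL hh hweak hb1 hu ha hθ hb' hθb hE hEm hE1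
  rw [hder] at h0
  obtain ⟨C, hC⟩ := hρ.continuous.bounded_above_of_compact_support hρc
  have hint2 : Integrable (fun p : ℝ × T2 => h p * (ρ p.1 * E (shearFlow i L (-(c * p.1)) p.2)))
      spaceTime := by
    have := hint.bdd_mul (c := C) (hρ.continuous.measurable.comp measurable_fst).aestronglyMeasurable
      (Eventually.of_forall fun p : ℝ × T2 => hC p.1)
    refine this.congr (Eventually.of_forall fun p => ?_)
    simp only [Function.comp_apply]
    ring
  rw [spaceTime, integral_prod _ hint2] at h0
  refine Eq.trans ?_ h0
  congr 1
  funext t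
  rw [smul_eq_mul, ← integral_const_mul]
  congr 1
  funext x
  simp only
  ring

lemma contDiff_mFourier_toT2 (n : Fin 2 → ℤ) :
    ContDiff ℝ ∞ fun y => UnitAddTorus.mFourier n (toT2 y) := by
  have e : (fun y => UnitAddTorus.mFourier n (toT2 y)) =
      fun y : Fin 2 → ℝ => ∏ j, Complex.exp (2 * Real.pi * Complex.I * n j * (y j : ℂ)) := by
    funext y
    change ∏ j, fourier (n j) ((y j : ℝ) : UnitAddCircle) = _
    refine Finset.prod_congr rfl fun j _ => ?_
    rw [fourier_coe_apply]
    simp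
  rw [e]
  refine contDiff_prod fun j _ => ContDiff.cexp (contDiff_const.mul ?_)
  exact Complex.ofRealCLM.contDiff.comp (contDiff_apply ℝ ℝ j)

/-- While a single shear acts, a solution that vanishes initially remains zero. -/
lemma VanishesBefore.shear_step (hL : 1 ≤ L) {h : ℝ × T2 → ℝ} (hh : Integrable h spaceTime)
    {u : ℝ → T2 → (Fin 2 → ℝ)}
    (hweak : ∀ φ, IsTestFunction φ → ∫ p, h p * materialDeriv u φ p.1 p.2 ∂spaceTime = 0)
    {a b : ℝ} (hb1 : b ≤ 1) (hu : ∀ t ∈ Ioo a b, ∀ x, u t x = c • shearField i L x)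
    (ha : VanishesBefore h a) : VanishesBefore h b := by
  have hle : ∀ (n : Fin 2 → ℤ) (x : T2), ‖UnitAddTorus.mFourier n x‖ ≤ 1 := fun n x =>
    ((UnitAddTorus.mFourier n).norm_coe_le_norm x).trans UnitAddTorus.mFourier_norm.le
  -- There are countably many modes, so one null set of times serves them all.
  have hre : ∀ᵐ t ∂(volume : Measure ℝ).restrict (Icc 0 1), ∀ n : Fin 2 → ℤ, t ∈ Ioo a b →
      ∫ x, h (t, x) * (UnitAddTorus.mFourier n (shearFlow i L (-(c * t)) x)).re = 0 := by
    rw [ae_all_iff]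
    exact fun n => ae_integral_mul_shear_eq_zero (E := fun x => (UnitAddTorus.mFourier n x).re)
      hL hh hweak hb1 hu ha (Complex.reCLM.contDiff.comp (contDiff_mFourier_toT2 n))
      (Complex.measurable_re.comp (UnitAddTorus.mFourier n).continuous.measurable)
      fun x => (Complex.abs_re_le_norm _).trans (hle n x)
  have him : ∀ᵐ t ∂(volume : Measure ℝ).restrict (Icc 0 1), ∀ n : Fin 2 → ℤ, t ∈ Ioo a b →
      ∫ x, h (t, x) * (UnitAddTorus.mFourier n (shearFlow i L (-(c * t)) x)).im = 0 := by
    rw [ae_all_iff]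
    exact fun n => ae_integral_mul_shear_eq_zero (E := fun x => (UnitAddTorus.mFourier n x).im)
      hL hh hweak hb1 hu ha (Complex.imCLM.contDiff.comp (contDiff_mFourier_toT2 n))
      (Complex.measurable_im.comp (UnitAddTorus.mFourier n).continuous.measurable)
      fun x => (Complex.abs_im_le_norm _).trans (hle n x)
  have ha' : ∀ᵐ t ∂(volume : Measure ℝ).restrict (Icc 0 1), ∀ᵐ x : T2, t < a → h (t, x) = 0 :=
    Measure.ae_ae_of_ae_prod ha
  have hne : ∀ᵐ t ∂(volume : Measure ℝ).restrict (Icc 0 1), t ≠ a :=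
    ae_restrict_of_ae (by simpa using (countable_singleton a).ae_notMem volume)
  have hslice : ∀ᵐ t ∂(volume : Measure ℝ).restrict (Icc 0 1), ∀ᵐ x : T2, t < b → h (t, x) = 0 := by
    filter_upwards [hre, him, ha', hne, hh.prod_right_ae] with t h1 h2 h3 h4 h5
    by_cases htb : t < b
    · rcases lt_or_gt_of_ne h4 with h6 | h6
      · filter_upwards [h3] with x hx _ using hx h6
      -- Pulling the slice back by the shear turns the transported modes into ordinary ones, so the
      -- pulled-back slice has vanishing Fourier coefficients.
      · have hmp := measurePreserving_shearEquiv i L (c * t)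
        have hcv : ∀ F : T2 → ℝ, ∫ x, h (t, x) * F (shearFlow i L (-(c * t)) x) =
            ∫ x, h (t, shearEquiv i L (c * t) x) * F x := by
          intro F
          rw [← hmp.integral_comp' (g := fun x => h (t, x) * F (shearFlow i L (-(c * t)) x))]
          simp [shearFlow_add]
        have hw := ae_eq_zero_of_forall_integral_mFourier
          (w := fun x => h (t, shearEquiv i L (c * t) x))
          (hmp.integrable_comp_of_integrable (g := fun x => h (t, x)) h5)
          (fun n => by
            rw [← hcv (fun x => (UnitAddTorus.mFourier n x).re)]; exact h1 n ⟨h6, htb⟩)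
          (fun n => by
            rw [← hcv (fun x => (UnitAddTorus.mFourier n x).im)]; exact h2 n ⟨h6, htb⟩)
        have hw2 := (measurePreserving_shearEquiv_symm i L (c * t)).quasiMeasurePreserving.ae hw
        filter_upwards [hw2] with x hx _
        simpa [shearFlow_add] using hx
    · exact Eventually.of_forall fun x hx => absurd hx htb
  have hmeas : AEMeasurable ((Iio b ×ˢ (univ : Set T2)).indicator fun p => ‖h p‖ₑ) spaceTime :=
    hh.aestronglyMeasurable.enorm.indicator (measurableSet_Iio.prod MeasurableSet.univ)
  have hzero : ∫⁻ p, (Iio b ×ˢ (univ : Set T2)).indicator (fun p => ‖h p‖ₑ) p ∂spaceTime = 0 := by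
    rw [spaceTime, lintegral_prod _ hmeas]
    refine lintegral_eq_zero_of_ae_eq_zero ?_
    filter_upwards [hslice] with t ht
    refine lintegral_eq_zero_of_ae_eq_zero ?_
    filter_upwards [ht] with x hx
    by_cases htb : t < b
    · simp [hx htb]
    · rw [indicator_of_notMem (by simpa using htb)]; rfl
  have h0 := (lintegral_eq_zero_iff' hmeas).1 hzero
  filter_upwards [h0] with p hp hlt
  rw [indicator_of_mem (by simpa using hlt)] at hp
  simpa using hp

end

section

/-! ### Uniqueness of weak solutions along the truncated field -/

lemma blockStart_add_le_one {k m : ℕ} (hm : m < 2 ^ k) : blockStart k m + slotLen k ≤ 1 := by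
  induction k generalizing m with
  | zero =>
    obtain rfl : m = 0 := by simpa using hm
    rw [blockStart_zero, slotLen_zero, zero_add]
  | succ k ih =>
    have hd := slotLen_succ k
    have hp := slotLen_pos k
    have hm2 : m / 2 < 2 ^ k := by rw [pow_succ] at hm; omega
    have := ih hm2
    rcases Nat.even_or_odd' m with ⟨n, rfl | rfl⟩
    · have e : 2 * n / 2 = n := by omega
      rw [e] at hm2 this
      rw [blockStart_left hm2]
      linarith
    · have e : (2 * n + 1) / 2 = n := by omega
      rw [e] at hm2 this
      rw [blockStart_right hm2]
      linarith

section

variable {i : ℕ → Fin 2} {L : ℕ → ℕ} {τ : ℕ → ℝ}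

lemma VanishesBefore.slot_step (hL : ∀ k, 1 ≤ k → 1 ≤ L k) (hfin : FinitenessCondition τ)
    {K : ℕ} {h : ℝ × T2 → ℝ} (hh : Integrable h spaceTime)
    (hweak : ∀ φ, IsTestFunction φ →
      ∫ p, h p * materialDeriv (truncatedField i L τ K) φ p.1 p.2 ∂spaceTime = 0)
    {p : ℕ × ℕ} (hp : p ∈ dyadic) (hpK : p.1 ≤ K) (hp1 : startTime p + slotLen p.1 ≤ 1)
    (ha : VanishesBefore h (startTime p)) :
    VanishesBefore h (startTime p + slotLen p.1) := by
  have hlt : τ p.1 < slotLen p.1 := hfin p.1 hp.1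
  have h1 : VanishesBefore h (startTime p + τ p.1) :=
    ha.shear_step (c := 1) (i := i p.1) (hL _ hp.1) hh hweak (by linarith) fun t ht x => by
      rw [truncatedField, fractalField_of_mem hfin (dyadicUpTo_subset K) ⟨hp, hpK⟩
        ⟨ht.1.le, ht.2.le⟩, one_smul]
  -- No sign of `τ` is assumed here. If it is negative the activity interval is empty and the field
  -- vanishes throughout the slot.
  rcases lt_or_ge (τ p.1) 0 with hneg | hpos
  · exact ha.shear_step (c := 0) (i := i p.1) (hL _ hp.1) hh hweak hp1 fun t ht x => by
      rw [truncatedField, fractalField_of_mem_gap hfin (dyadicUpTo_subset K) hp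
        (by linarith [ht.1]) ⟨ht.1.le, ht.2⟩, zero_smul]
      rfl
  · exact h1.shear_step (c := 0) (i := i p.1) (hL _ hp.1) hh hweak hp1 fun t ht x => by
      rw [truncatedField, fractalField_of_mem_gap hfin (dyadicUpTo_subset K) hp ht.1
        ⟨by linarith [ht.1], ht.2⟩, zero_smul]
      rfl

/-- The induction follows the four quarters of the block, as for the flow itself; inside blocks of
level `K` the field is zero. -/
lemma VanishesBefore.block_step (hL : ∀ k, 1 ≤ k → 1 ≤ L k) (hfin : FinitenessCondition τ)
    {K : ℕ} {h : ℝ × T2 → ℝ} (hh : Integrable h spaceTime)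
    (hweak : ∀ φ, IsTestFunction φ →
      ∫ p, h p * materialDeriv (truncatedField i L τ K) φ p.1 p.2 ∂spaceTime = 0)
    (n k m : ℕ) (hK : n + k = K) (hm : m < 2 ^ k) (ha : VanishesBefore h (blockStart k m)) :
    VanishesBefore h (blockStart k m + slotLen k) := by
  induction n generalizing k m with
  | zero =>
    rw [Nat.zero_add] at hK
    subst hK
    -- With velocity factor `c = 0` the direction and frequency are immaterial; `le_rfl` selects `L
    -- = 1`.
    exact ha.shear_step (c := 0) (i := 0) le_rfl hh hweak (blockStart_add_le_one hm)
      fun t ht x => by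
        rw [truncatedField_of_mem_block hfin hm ht, zero_smul]
        rfl
  | succ n ih =>
    have h1b := blockStart_add_le_one hm
    have hd := slotLen_pos (k + 1)
    have h4 : slotLen k = 4 * slotLen (k + 1) := by rw [slotLen_succ]; ring
    have s1 := ha.slot_step hL hfin hh hweak (mem_dyadic_left hm) (by simp only; omega)
      (by change blockStart k m + slotLen (k + 1) ≤ 1; linarith)
    have s2 := ih (k + 1) (2 * m) (by omega) (by rw [pow_succ]; omega)
      (by rw [blockStart_left hm]; exact s1)
    have e1 : blockStart (k + 1) (2 * m) + slotLen (k + 1) = startTime (k + 1, 2 * m + 1) := by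
      rw [blockStart_left hm, startTime_right_eq hm]; ring
    rw [e1] at s2
    have s3 := s2.slot_step hL hfin hh hweak (mem_dyadic_right hm) (by simp only; omega)
      (by rw [startTime_right_eq hm]; simp only; linarith)
    have s4 := ih (k + 1) (2 * m + 1) (by omega) (by rw [pow_succ]; omega)
      (by
        rw [blockStart_right hm]
        rw [startTime_right_eq hm] at s3
        convert s3 using 1
        simp only
        ring)
    rw [blockStart_right hm] at s4
    convert s4 using 1
    rw [h4]; ring

/-- Weak solutions along the truncated field are unique. -/
theorem weakSolution_unique (hL : ∀ k, 1 ≤ k → 1 ≤ L k) (hfin : FinitenessCondition τ) {K : ℕ}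
    {f₀ : T2 → ℝ} {f g : ℝ → T2 → ℝ} (hf : IsWeakSolution (truncatedField i L τ K) f₀ f)
    (hg : IsWeakSolution (truncatedField i L τ K) f₀ g) :
    Function.uncurry g =ᵐ[spaceTime] Function.uncurry f := by
  set h : ℝ × T2 → ℝ := fun p => g p.1 p.2 - f p.1 p.2
  have hh : Integrable h spaceTime := hg.integrable.sub hf.integrable
  have hum := measurable_truncatedField (i := i) (L := L) hfin K
  have hweak : ∀ φ, IsTestFunction φ →
      ∫ p, h p * materialDeriv (truncatedField i L τ K) φ p.1 p.2 ∂spaceTime = 0 := by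
    intro φ hφ
    obtain ⟨C, hC⟩ := hφ.exists_bound
    have hb : ∀ᵐ p ∂spaceTime, ‖materialDeriv (truncatedField i L τ K) φ p.1 p.2‖ ≤ C :=
      ae_spaceTime_mem.mono fun p hp => hC _ _ _ hp (norm_fractalField_le _ _ _)
    have hm := (hφ.measurable_materialDeriv hum).aestronglyMeasurable (μ := spaceTime)
    simp_rw [h, sub_mul]
    rw [integral_sub (hg.integrable.mul_bdd hm hb) (hf.integrable.mul_bdd hm hb)]
    have e1 := hg.weak φ hφ
    have e2 := hf.weak φ hφ
    simp only [materialDeriv]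
    rw [e1, e2, sub_self]
  -- The initial data have already cancelled in `hweak`, and `spaceTime` gives no mass to negative
  -- times.
  have h0 : VanishesBefore h (blockStart 0 0) := by
    filter_upwards [ae_spaceTime_mem] with p hp hlt
    rw [blockStart_zero] at hlt
    exact absurd hp.1 (not_le.2 hlt)
  have h1 := h0.block_step hL hfin hh hweak K 0 0 (by simp) (by simp)
  rw [blockStart_zero, slotLen_zero, zero_add] at h1
  filter_upwards [h1, ae_spaceTime_mem, ae_spaceTime_fst_ne 1] with p hp h2 h3
  exact sub_eq_zero.1 (hp (lt_of_le_of_ne h2.2 h3))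

end

end

section

/-! ### Cancellation -/

lemma shearSign_sq_cases (L : ℕ) (z : UnitAddCircle) {c : ℝ} {n : ℤ} (hn : Odd n)
    (hc : 2 * (L : ℝ) * c = n) {σ : ℝ} (hσ : σ = 1 ∨ σ = -1) :
    shearSign L (z + ((c * σ : ℝ) : UnitAddCircle)) = - shearSign L z := by
  rcases hσ with rfl | rfl
  · exact shearSign_add_of_odd hn (by rw [mul_one, hc]) z
  · exact shearSign_add_of_odd hn.neg (by push_cast; rw [mul_neg_one, mul_neg, hc]) z

/-- Two perpendicular shears, each of which shifts by an odd number of stripes of the other,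
generate an involution. -/
lemma shearFlow_cancel {i₁ i₂ : Fin 2} {L₁ L₂ : ℕ} {s t : ℝ} {m n : ℤ} (hi : i₂ ≠ i₁) (hm : Odd m)
    (hn : Odd n) (hs : 2 * (L₂ : ℝ) * s = m) (ht : 2 * (L₁ : ℝ) * t = n) (x : T2) :
    shearFlow i₂ L₂ t (shearFlow i₁ L₁ s (shearFlow i₂ L₂ t (shearFlow i₁ L₁ s x))) = x := by
  have e2 : i₂ = 1 - i₁ := eq_one_sub_of_ne hi
  have e1 : 1 - i₂ = i₁ := by rw [e2]; simp
  set A := shearFlow i₁ L₁ s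
  set B := shearFlow i₂ L₂ t
  have hA1 : ∀ x, A x i₁ = x i₁ + ((s * shearSign L₁ (x i₂) : ℝ) : UnitAddCircle) := fun x => by
    simp only [A]
    rw [shearFlow_apply_same, ← e2]
  have hA2 : ∀ x, A x i₂ = x i₂ := fun x => by rw [e2]; exact shearFlow_apply_other _ _ _ _
  have hB2 : ∀ x, B x i₂ = x i₂ + ((t * shearSign L₂ (x i₁) : ℝ) : UnitAddCircle) := fun x => by
    simp only [B]
    rw [shearFlow_apply_same, e1]
  have hB1 : ∀ x, B x i₁ = x i₁ := fun x => by
    have := shearFlow_apply_other i₂ L₂ t x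
    rwa [e1] at this
  -- Each shear reverses the sign that drives the other, so in each coordinate the second
  -- displacement is the negative of the first.
  have f1 : ∀ x, shearSign L₂ (A x i₁) = - shearSign L₂ (x i₁) := fun x => by
    rw [hA1]; exact shearSign_sq_cases _ _ hm hs (shearSign_eq_or _ _)
  have f2 : ∀ x, shearSign L₁ (B x i₂) = - shearSign L₁ (x i₂) := fun x => by
    rw [hB2]; exact shearSign_sq_cases _ _ hn ht (shearSign_eq_or _ _)
  have g1 : B (A (B (A x))) i₁ = x i₁ := by
    rw [hB1, hA1, f2, hA2, hB1, hA1, add_assoc, ← AddCircle.coe_add]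
    simp
  have g2 : B (A (B (A x))) i₂ = x i₂ := by
    rw [hB2, f1, hA2, hB1, hB2, hA2, add_assoc, ← AddCircle.coe_add]
    simp
  funext j
  rcases eq_or_eq_one_sub i₁ j with rfl | rfl
  · exact g1
  · rw [← e2]; exact g2

/-! ### The set of unresolved times -/

/-- The times that are in no slot of the first `n` levels of a block of level `k` that starts at
time `a`. -/
def unresolved : ℕ → ℕ → ℝ → Set ℝ
  | 0, k, a => Ioo a (a + slotLen k)
  | n + 1, k, a => unresolved n (k + 1) (a + slotLen (k + 1)) ∪
      unresolved n (k + 1) (a + 3 * slotLen (k + 1))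

lemma unresolved_succ_subset (n k : ℕ) (a : ℝ) : unresolved (n + 1) k a ⊆ unresolved n k a := by
  induction n generalizing k a with
  | zero =>
    have h4 : slotLen k = 4 * slotLen (k + 1) := by rw [slotLen_succ]; ring
    have hd := slotLen_pos (k + 1)
    rintro t (⟨h1, h2⟩ | ⟨h1, h2⟩)
    · exact ⟨by linarith, by linarith⟩
    · exact ⟨by linarith, by linarith⟩
  | succ n ih => exact union_subset_union (ih _ _) (ih _ _)

lemma unresolved_antitone (k : ℕ) (a : ℝ) : Antitone fun n => unresolved n k a :=
  antitone_nat_of_succ_le fun n => unresolved_succ_subset n k a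

lemma volume_unresolved_le (n k : ℕ) (a : ℝ) :
    volume (unresolved n k a) ≤ ENNReal.ofReal (2 ^ n * slotLen (k + n)) := by
  induction n generalizing k a with
  | zero => simp [unresolved]
  | succ n ih =>
    refine (measure_union_le _ _).trans ((add_le_add (ih _ _) (ih _ _)).trans ?_)
    have hp := slotLen_pos (k + 1 + n)
    rw [← ENNReal.ofReal_add (by positivity) (by positivity)]
    refine ENNReal.ofReal_le_ofReal (le_of_eq ?_)
    have : k + (n + 1) = k + 1 + n := by ring
    rw [this, pow_succ]
    ring

lemma exists_block_of_mem_unresolved {n k m : ℕ} (hm : m < 2 ^ k) {t : ℝ}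
    (ht : t ∈ unresolved n k (blockStart k m)) :
    ∃ m' < 2 ^ (k + n), t ∈ Ioo (blockStart (k + n) m') (blockStart (k + n) m' + slotLen (k + n)) := by
  induction n generalizing k m with
  | zero => exact ⟨m, hm, ht⟩
  | succ n ih =>
    have e : k + (n + 1) = k + 1 + n := by ring
    rw [e]
    rcases ht with h | h
    · rw [← blockStart_left hm] at h
      exact ih (by rw [pow_succ]; omega) h
    · rw [← blockStart_right hm] at h
      exact ih (by rw [pow_succ]; omega) h

lemma exists_block_of_mem_unresolved_zero {n : ℕ} {t : ℝ} (ht : t ∈ unresolved n 0 0) :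
    ∃ m < 2 ^ n, t ∈ Ioo (blockStart n m) (blockStart n m + slotLen n) := by
  rw [← blockStart_zero] at ht
  simpa using exists_block_of_mem_unresolved (by simp) ht

lemma notMem_unresolved_of_mem_slot {n : ℕ} {q : ℕ × ℕ} (hq : q ∈ dyadic) (hqn : q.1 ≤ n) {t : ℝ}
    (ht : t ∈ Icc (startTime q) (startTime q + slotLen q.1)) : t ∉ unresolved n 0 0 := by
  intro h
  obtain ⟨m, hm, h⟩ := exists_block_of_mem_unresolved_zero h
  rcases slot_block_disjoint hm hq hqn with h1 | h1
  · linarith [ht.2, h.1]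
  · linarith [ht.1, h.2]

lemma one_notMem_unresolved (n : ℕ) : (1 : ℝ) ∉ unresolved n 0 0 := by
  intro h
  obtain ⟨m, hm, h⟩ := exists_block_of_mem_unresolved_zero h
  linarith [blockStart_add_le_one hm, h.2]

/-- Each time is close to a resolved time. -/
lemma exists_resolved_near (n : ℕ) (t : ℝ) : ∃ s, s ∉ unresolved n 0 0 ∧ |t - s| ≤ slotLen n := by
  by_cases h : t ∈ unresolved n 0 0
  · rcases n with _ | n
    · refine ⟨0, fun h0 => lt_irrefl _ h0.1, ?_⟩
      have h1 : 0 < t := h.1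
      have h2 : t < 0 + slotLen 0 := h.2
      rw [sub_zero, abs_of_pos h1]
      linarith
    · obtain ⟨m, hm, h⟩ := exists_block_of_mem_unresolved_zero h
      have hq : (n + 1, m) ∈ dyadic := ⟨by simp, hm⟩
      -- The left end of the block is also the right end of slot `(n + 1, m)`, hence resolved.
      refine ⟨blockStart (n + 1) m, notMem_unresolved_of_mem_slot hq le_rfl ?_, ?_⟩
      · rw [blockStart, startTime_left hq]
        exact ⟨by linarith [slotLen_pos (n + 1)], le_rfl⟩
      · rw [abs_of_pos (by linarith [h.1])]
        linarith [h.2]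
  · exact ⟨t, h, by simpa using (slotLen_pos n).le⟩

lemma two_pow_mul_slotLen (n : ℕ) : (2 : ℝ) ^ n * slotLen n = (1 / 2) ^ n := by
  rw [slotLen_eq, ← mul_pow]; norm_num

lemma tendsto_slotLen : Tendsto slotLen atTop (𝓝 0) := by
  simp_rw [funext slotLen_eq]
  exact tendsto_pow_atTop_nhds_zero_of_lt_one (by norm_num) (by norm_num)

/-- There are `2^n` blocks of level `n`, each of length `4^{-n}`. -/
lemma tendsto_volume_unresolved : Tendsto (fun n => volume (unresolved n 0 0)) atTop (𝓝 0) := by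
  have h1 : Tendsto (fun n : ℕ => ENNReal.ofReal ((1 / 2) ^ n)) atTop (𝓝 0) := by
    rw [← ENNReal.ofReal_zero]
    exact ENNReal.tendsto_ofReal
      (tendsto_pow_atTop_nhds_zero_of_lt_one (by norm_num) (by norm_num))
  refine tendsto_of_tendsto_of_tendsto_of_le_of_le tendsto_const_nhds h1 (fun _ => zero_le)
    fun n => ?_
  have := volume_unresolved_le n 0 0
  rwa [Nat.zero_add, two_pow_mul_slotLen] at this

/-! ### Stabilisation of the truncated flows -/

section

variable {i : ℕ → Fin 2} {L : ℕ → ℕ} {τ : ℕ → ℝ}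

lemma blockFlow_of_le (n k : ℕ) {a t : ℝ} (h : t ≤ a) :
    blockFlow i L τ n k a t = MeasurableEquiv.refl T2 := by
  induction n generalizing k a with
  | zero => rfl
  | succ n ih =>
    have hd := slotLen_pos (k + 1)
    rw [blockFlow, clip_of_le h, clip_of_le (by linarith), ih _ (by linarith), ih _ (by linarith)]
    simp only [shearEquiv_zero]
    rfl

lemma blockFlow_succ_apply (n k : ℕ) (a t : ℝ) (x : T2) : blockFlow i L τ (n + 1) k a t x =
    blockFlow i L τ n (k + 1) (a + 3 * slotLen (k + 1)) t
      (shearFlow (i (k + 1)) (L (k + 1)) (clip (τ (k + 1)) (a + 2 * slotLen (k + 1)) t)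
        (blockFlow i L τ n (k + 1) (a + slotLen (k + 1)) t
          (shearFlow (i (k + 1)) (L (k + 1)) (clip (τ (k + 1)) a t) x))) := rfl

lemma blockFlow_one_apply_of_ge (hτ : ∀ k, 1 ≤ k → 0 < τ k) (hfin : FinitenessCondition τ) (k : ℕ)
    {a t : ℝ} (ht : a + slotLen k ≤ t) (x : T2) :
    blockFlow i L τ 1 k a t x = shearFlow (i (k + 1)) (L (k + 1)) (2 * τ (k + 1)) x := by
  have h4 : slotLen k = 4 * slotLen (k + 1) := by rw [slotLen_succ]; ring
  have hd := slotLen_pos (k + 1)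
  have h0 := hτ (k + 1) (by omega)
  have hlt : τ (k + 1) < slotLen (k + 1) := hfin (k + 1) (by omega)
  rw [blockFlow_succ_apply, clip_of_ge h0.le (by linarith), clip_of_ge h0.le (by linarith)]
  change shearFlow _ _ _ (shearFlow _ _ _ x) = _
  rw [shearFlow_add, two_mul]

/-- After the block is over, each sub-block has contributed its two slots back to back, a shear for
time `2 τ_{k+2}`. The cancellation conditions at `k + 1` say that this shear moves points by one
stripe of level `k + 1`, and that time `τ_{k+1}` moves them by an odd number of stripes of level `k
+ 2`. -/
lemma blockFlow_two_apply_of_ge (hL : ∀ k, 1 ≤ k → 1 ≤ L k) (hτ : ∀ k, 1 ≤ k → 0 < τ k)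
    (hfin : FinitenessCondition τ) (hcan : CancellationConditions i L τ) (k : ℕ)
    {a t : ℝ} (ht : a + slotLen k ≤ t) (x : T2) : blockFlow i L τ 2 k a t x = x := by
  have h4 : slotLen k = 4 * slotLen (k + 1) := by rw [slotLen_succ]; ring
  have hd := slotLen_pos (k + 1)
  have h0 := hτ (k + 1) (by omega)
  have hlt : τ (k + 1) < slotLen (k + 1) := hfin (k + 1) (by omega)
  rw [blockFlow_succ_apply, clip_of_ge h0.le (by linarith), clip_of_ge h0.le (by linarith),
    blockFlow_one_apply_of_ge hτ hfin _ (by linarith),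
    blockFlow_one_apply_of_ge hτ hfin _ (by linarith)]
  obtain ⟨hne, h1, n, hn, h2⟩ := hcan (k + 1) (by omega)
  have hL1 : (0 : ℝ) < L (k + 1) := by exact_mod_cast hL (k + 1) (by omega)
  exact shearFlow_cancel hne hn odd_one h2 (by rw [h1]; push_cast; field_simp) x

/-- A resolved time lies before or after each innermost block. In the first case the two extra
levels have not started there; in the second they have cancelled. -/
lemma blockFlow_add_two (hL : ∀ k, 1 ≤ k → 1 ≤ L k) (hτ : ∀ k, 1 ≤ k → 0 < τ k)
    (hfin : FinitenessCondition τ) (hcan : CancellationConditions i L τ) (n k : ℕ) {a t : ℝ}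
    (ht : t ∉ unresolved n k a) : blockFlow i L τ (n + 2) k a t = blockFlow i L τ n k a t := by
  induction n generalizing k a with
  | zero =>
    rcases le_or_gt t a with h | h
    · rw [blockFlow_of_le _ _ h, blockFlow_of_le _ _ h]
    · have h' : a + slotLen k ≤ t := by
        by_contra hlt
        exact ht ⟨h, not_le.1 hlt⟩
      ext x : 2
      exact blockFlow_two_apply_of_ge hL hτ hfin hcan k h' x
  | succ n ih =>
    have h1 : t ∉ unresolved n (k + 1) (a + slotLen (k + 1)) := fun h => ht (Or.inl h)
    have h2 : t ∉ unresolved n (k + 1) (a + 3 * slotLen (k + 1)) := fun h => ht (Or.inr h)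
    ext x : 2
    change blockFlow i L τ (n + 2 + 1) k a t x = _
    rw [blockFlow_succ_apply, ih _ h1, ih _ h2]
    rfl

lemma truncatedFlow_eq_of_resolved (hL : ∀ k, 1 ≤ k → 1 ≤ L k) (hτ : ∀ k, 1 ≤ k → 0 < τ k)
    (hfin : FinitenessCondition τ) (hcan : CancellationConditions i L τ) {n : ℕ} {t : ℝ}
    (ht : t ∉ unresolved n 0 0) (j : ℕ) :
    truncatedFlow i L τ (n + 2 * j) t = truncatedFlow i L τ n t := by
  induction j with
  | zero => rfl
  | succ j ih =>
    rw [← ih]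
    exact blockFlow_add_two hL hτ hfin hcan (n + 2 * j) 0
      fun h => ht (unresolved_antitone 0 0 (Nat.le_add_right n (2 * j)) h)

lemma blockFlow_of_ge (hτ : ∀ k, 1 ≤ k → 0 < τ k) (hfin : FinitenessCondition τ) (n k : ℕ)
    {a s t : ℝ} (hs : a + slotLen k ≤ s) (ht : a + slotLen k ≤ t) :
    blockFlow i L τ n k a s = blockFlow i L τ n k a t := by
  induction n generalizing k a with
  | zero => rfl
  | succ n ih =>
    have h4 : slotLen k = 4 * slotLen (k + 1) := by rw [slotLen_succ]; ring
    have hd := slotLen_pos (k + 1)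
    have h0 := (hτ (k + 1) (by omega)).le
    have hlt : τ (k + 1) < slotLen (k + 1) := hfin (k + 1) (by omega)
    ext x : 2
    rw [blockFlow_succ_apply, blockFlow_succ_apply, clip_of_ge h0 (by linarith),
      clip_of_ge h0 (by linarith), clip_of_ge h0 (by linarith), clip_of_ge h0 (by linarith),
      ih (k + 1) (a := a + slotLen (k + 1)) (by linarith) (by linarith),
      ih (k + 1) (a := a + 3 * slotLen (k + 1)) (by linarith) (by linarith)]

/-- At the end of the last slot of level `n` in a block, what is left to do for the first `n + 1`
levels are the last two slots of level `n + 1`. -/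
lemma blockFlow_last (hτ : ∀ k, 1 ≤ k → 0 < τ k) (hfin : FinitenessCondition τ) (n k : ℕ)
    (a : ℝ) (x : T2) :
    blockFlow i L τ (n + 1) k a (a + slotLen k) x =
      shearFlow (i (k + n + 1)) (L (k + n + 1)) (2 * τ (k + n + 1))
        (blockFlow i L τ (n + 1) k a (a + slotLen k - slotLen (k + n)) x) ∧
    blockFlow i L τ n k a (a + slotLen k) x =
      blockFlow i L τ n k a (a + slotLen k - slotLen (k + n)) x := by
  induction n generalizing k a x with
  | zero =>
    refine ⟨?_, rfl⟩
    rw [blockFlow_one_apply_of_ge hτ hfin k le_rfl, blockFlow_of_le _ _ (by simp)]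
    rfl
  | succ n ih =>
    have h4 : slotLen k = 4 * slotLen (k + 1) := by rw [slotLen_succ]; ring
    have hd := slotLen_pos (k + 1)
    have h0 := (hτ (k + 1) (by omega)).le
    have hlt : τ (k + 1) < slotLen (k + 1) := hfin (k + 1) (by omega)
    have e : k + (n + 1) = k + 1 + n := by ring
    have hle : slotLen (k + 1 + n) ≤ slotLen (k + 1) := by
      rw [slotLen_eq, slotLen_eq]
      exact pow_le_pow_of_le_one (by norm_num) (by norm_num) (Nat.le_add_right _ _)
    have eT : a + 3 * slotLen (k + 1) + slotLen (k + 1) = a + slotLen k := by rw [h4]; ring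
    have hlast := ih (k + 1) (a + 3 * slotLen (k + 1))
    rw [eT] at hlast
    rw [e]
    -- At this time the first three quarters are finished, so only the last sub-block still depends
    -- on time and the induction hypothesis applies to it.
    have key : ∀ j y, blockFlow i L τ (j + 1) k a (a + slotLen k - slotLen (k + 1 + n)) y =
        blockFlow i L τ j (k + 1) (a + 3 * slotLen (k + 1))
          (a + slotLen k - slotLen (k + 1 + n))
          (shearFlow (i (k + 1)) (L (k + 1)) (τ (k + 1))
            (blockFlow i L τ j (k + 1) (a + slotLen (k + 1)) (a + slotLen k)
              (shearFlow (i (k + 1)) (L (k + 1)) (τ (k + 1)) y))) := by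
      intro j y
      rw [blockFlow_succ_apply, clip_of_ge h0 (by linarith), clip_of_ge h0 (by linarith),
        blockFlow_of_ge hτ hfin j (k + 1) (a := a + slotLen (k + 1)) (t := a + slotLen k)
          (by linarith) (by linarith)]
    have key' : ∀ j y, blockFlow i L τ (j + 1) k a (a + slotLen k) y =
        blockFlow i L τ j (k + 1) (a + 3 * slotLen (k + 1)) (a + slotLen k)
          (shearFlow (i (k + 1)) (L (k + 1)) (τ (k + 1))
            (blockFlow i L τ j (k + 1) (a + slotLen (k + 1)) (a + slotLen k)
              (shearFlow (i (k + 1)) (L (k + 1)) (τ (k + 1)) y))) := by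
      intro j y
      rw [blockFlow_succ_apply, clip_of_ge h0 (by linarith), clip_of_ge h0 (by linarith)]
    constructor
    · rw [key, key']
      exact (hlast _).1
    · rw [key, key']
      exact (hlast _).2

end

end

section

/-! ### Densities of transported functions -/

/-- The transport of a bounded function by a (not necessarily invertible) measure preserving map
has a bounded density. -/
lemma exists_density {Y : T2 → T2} (hY : MeasurePreserving Y volume volume) {g : T2 → ℝ}
    (hg : Measurable g) {M : ℝ} (hM : ∀ x, |g x| ≤ M) :
    ∃ h : T2 → ℝ, Measurable h ∧ (∀ x, |h x| ≤ M) ∧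
      ∀ ψ : C(T2, ℝ), ∫ x, h x * ψ x = ∫ x, g x * ψ (Y x) := by
  have hM0 : 0 ≤ M := (abs_nonneg _).trans (hM 0)
  have hgM : Measurable fun x => ENNReal.ofReal (g x + M) :=
    (hg.add_const M).ennreal_ofReal
  -- Adding `M` makes the density nonnegative. The image measure is at most `2 M` times Lebesgue
  -- measure because `Y` preserves the latter, so its Radon–Nikodym derivative lies in `[0, 2 M]`
  -- almost everywhere, and `M` is subtracted again.
  set ν₀ : Measure T2 := volume.withDensity fun x => ENNReal.ofReal (g x + M) with hν₀
  set ν : Measure T2 := ν₀.map Y with hν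
  have hle : ∀ B, MeasurableSet B → ν B ≤ ENNReal.ofReal (2 * M) * volume B := by
    intro B hB
    rw [hν, Measure.map_apply hY.measurable hB, hν₀, withDensity_apply _ (hY.measurable hB)]
    calc _ ≤ ∫⁻ _ in Y ⁻¹' B, ENNReal.ofReal (2 * M) := by
          refine lintegral_mono fun x => ENNReal.ofReal_le_ofReal ?_
          linarith [(abs_le.1 (hM x)).2]
      _ = _ := by
          rw [setLIntegral_const, hY.measure_preimage hB.nullMeasurableSet]
  have hac : ν ≪ volume := by
    refine Measure.AbsolutelyContinuous.mk fun B hB h0 => ?_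
    have := hle B hB
    rw [h0, mul_zero] at this
    exact le_antisymm this zero_le
  have hfin : IsFiniteMeasure ν := ⟨(hle univ MeasurableSet.univ).trans_lt (by
    rw [measure_univ, mul_one]; exact ENNReal.ofReal_lt_top)⟩
  have hrn : volume.withDensity (ν.rnDeriv volume) = ν := Measure.withDensity_rnDeriv_eq _ _ hac
  have hrm := Measure.measurable_rnDeriv ν (volume : Measure T2)
  have hrle : ∀ᵐ x : T2, ν.rnDeriv volume x ≤ ENNReal.ofReal (2 * M) := by
    refine ae_le_of_forall_setLIntegral_le_of_sigmaFinite hrm fun B hB _ => ?_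
    rw [← withDensity_apply _ hB, hrn, setLIntegral_const]
    exact hle B hB
  set r : T2 → ℝ := fun x => (ν.rnDeriv volume x).toReal with hr
  refine ⟨fun x => max (-M) (min (r x - M) M), ?_, fun x => ?_, fun ψ => ?_⟩
  · exact measurable_const.max ((hrm.ennreal_toReal.sub_const M).min measurable_const)
  · rw [abs_le]
    exact ⟨le_max_left _ _, max_le (by linarith) (min_le_right _ _)⟩
  · have e1 : ∫ x, max (-M) (min (r x - M) M) * ψ x = ∫ x, (r x * ψ x - M * ψ x) := by
      refine integral_congr_ae ?_
      filter_upwards [hrle] with x hx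
      have h1 : 0 ≤ r x := ENNReal.toReal_nonneg
      have h2 : r x ≤ 2 * M := ENNReal.toReal_le_of_le_ofReal (by linarith) hx
      rw [min_eq_left (by linarith), max_eq_right (by linarith), sub_mul]
    have iψ : Integrable (fun x => ψ x) (volume : Measure T2) :=
      Integrable.of_bound ψ.continuous.measurable.aestronglyMeasurable ‖ψ‖
        (Eventually.of_forall fun x => ψ.norm_coe_le_norm x)
    have ir : Integrable (fun x => r x * ψ x) (volume : Measure T2) :=
      iψ.bdd_mul (c := 2 * M) hrm.ennreal_toReal.aestronglyMeasurable (by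
        filter_upwards [hrle] with x hx
        rw [Real.norm_of_nonneg ENNReal.toReal_nonneg]
        exact ENNReal.toReal_le_of_le_ofReal (by linarith) hx)
    have iY : Integrable (fun x => ψ (Y x)) volume := hY.integrable_comp_of_integrable iψ
    have e2 : ∫ x, r x * ψ x = ∫ x, (g x + M) * ψ (Y x) := by
      have h1 := integral_withDensity_eq_integral_toReal_smul hrm
        (hrle.mono fun x hx => hx.trans_lt ENNReal.ofReal_lt_top) (fun x => ψ x)
      rw [hrn, hν, integral_map hY.measurable.aemeasurable
        ψ.continuous.measurable.aestronglyMeasurable, hν₀,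
        integral_withDensity_eq_integral_toReal_smul hgM (by simp)] at h1
      simp only [smul_eq_mul] at h1
      rw [hr, ← h1]
      congr 1
      funext x
      rw [ENNReal.toReal_ofReal (by linarith [(abs_le.1 (hM x)).1])]
    have ig : Integrable (fun x => g x * ψ (Y x)) volume :=
      iY.bdd_mul (c := M) hg.aestronglyMeasurable (Eventually.of_forall hM)
    have e3 : ∫ x, ψ (Y x) = ∫ x, ψ x := by
      conv_rhs => rw [← hY.map_eq]
      rw [integral_map hY.measurable.aemeasurable ψ.continuous.measurable.aestronglyMeasurable]
    rw [e1, integral_sub ir (iψ.const_mul M), e2]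
    simp_rw [add_mul]
    rw [integral_add ig (iY.const_mul M), integral_const_mul, integral_const_mul, e3]
    ring

/-! ### The limit flow -/

lemma dist_toT2_le (x y : Fin 2 → ℝ) : dist (toT2 x) (toT2 y) ≤ ‖x - y‖ := by
  rw [dist_pi_le_iff (norm_nonneg _)]
  intro j
  rw [dist_eq_norm]
  refine le_trans ?_ (norm_le_pi_norm (x - y) j)
  exact QuotientAddGroup.norm_mk_le_norm

section

variable {i : ℕ → Fin 2} {L : ℕ → ℕ} {τ : ℕ → ℝ}

lemma dist_truncatedFlow_le (hfin : FinitenessCondition τ) (hτ : ∀ k, 1 ≤ k → 0 < τ k) (K : ℕ)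
    (s t : ℝ) (x : T2) :
    dist (truncatedFlow i L τ K s x) (truncatedFlow i L τ K t x) ≤ |s - t| := by
  obtain ⟨z, rfl⟩ := toT2_surjective x
  obtain ⟨γ, -, -, g3, g4, -⟩ := flowOn_truncatedFlow (i := i) (L := L) hfin hτ K z
  rw [← g4, ← g4]
  exact (dist_toT2_le _ _).trans (g3 s t)

/-- The two flows coincide at a resolved time within `4^{-n}` of `t`, and both are 1-Lipschitz in
time. -/
lemma dist_truncatedFlow_add_le (hL : ∀ k, 1 ≤ k → 1 ≤ L k) (hτ : ∀ k, 1 ≤ k → 0 < τ k)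
    (hfin : FinitenessCondition τ) (hcan : CancellationConditions i L τ) (n j : ℕ) (t : ℝ)
    (x : T2) :
    dist (truncatedFlow i L τ (n + 2 * j) t x) (truncatedFlow i L τ n t x) ≤ 2 * slotLen n := by
  obtain ⟨s, hs, hd⟩ := exists_resolved_near n t
  have h1 := dist_truncatedFlow_le (i := i) (L := L) hfin hτ (n + 2 * j) t s x
  have h2 := dist_truncatedFlow_le (i := i) (L := L) hfin hτ n s t x
  rw [truncatedFlow_eq_of_resolved hL hτ hfin hcan hs j] at h1
  rw [abs_sub_comm] at h2
  linarith [dist_triangle (truncatedFlow i L τ (n + 2 * j) t x) (truncatedFlow i L τ n s x)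
    (truncatedFlow i L τ n t x)]

lemma cauchySeq_truncatedFlow (hL : ∀ k, 1 ≤ k → 1 ≤ L k) (hτ : ∀ k, 1 ≤ k → 0 < τ k)
    (hfin : FinitenessCondition τ) (hcan : CancellationConditions i L τ) (e : ℕ) (t : ℝ) (x : T2) :
    CauchySeq fun j => truncatedFlow i L τ (2 * j + e) t x := by
  refine cauchySeq_of_le_tendsto_0 (fun N => 4 * slotLen (2 * N + e)) (fun n m N hn hm => ?_) ?_
  · have key : ∀ n, N ≤ n → dist (truncatedFlow i L τ (2 * n + e) t x)
        (truncatedFlow i L τ (2 * N + e) t x) ≤ 2 * slotLen (2 * N + e) := by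
      intro n hn
      obtain ⟨d, rfl⟩ := Nat.exists_eq_add_of_le hn
      have e1 : 2 * (N + d) + e = 2 * N + e + 2 * d := by ring
      rw [e1]
      exact dist_truncatedFlow_add_le hL hτ hfin hcan _ _ _ _
    have h1 := key n hn
    have h2 := key m hm
    rw [dist_comm] at h2
    linarith [dist_triangle (truncatedFlow i L τ (2 * n + e) t x)
      (truncatedFlow i L τ (2 * N + e) t x) (truncatedFlow i L τ (2 * m + e) t x)]
  · have h1 : Tendsto (fun N : ℕ => 2 * N + e) atTop atTop :=
      tendsto_atTop_mono (fun N => by simp only [id]; omega) tendsto_id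
    simpa using (tendsto_slotLen.comp h1).const_mul 4

/-- The limit of the flows of `u_K` along the `K` of a given parity. -/
def limitFlow (i : ℕ → Fin 2) (L : ℕ → ℕ) (τ : ℕ → ℝ) (e : ℕ) (t : ℝ) (x : T2) : T2 :=
  limUnder atTop fun j => truncatedFlow i L τ (2 * j + e) t x

lemma tendsto_limitFlow (hL : ∀ k, 1 ≤ k → 1 ≤ L k) (hτ : ∀ k, 1 ≤ k → 0 < τ k)
    (hfin : FinitenessCondition τ) (hcan : CancellationConditions i L τ) (e : ℕ) (t : ℝ) (x : T2) :
    Tendsto (fun j => truncatedFlow i L τ (2 * j + e) t x) atTop (𝓝 (limitFlow i L τ e t x)) :=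
  (cauchySeq_truncatedFlow hL hτ hfin hcan e t x).tendsto_limUnder

lemma continuous_limitFlow_time (hL : ∀ k, 1 ≤ k → 1 ≤ L k) (hτ : ∀ k, 1 ≤ k → 0 < τ k)
    (hfin : FinitenessCondition τ) (hcan : CancellationConditions i L τ) (e : ℕ) (x : T2) :
    Continuous fun t => limitFlow i L τ e t x := by
  refine (LipschitzWith.of_dist_le_mul (K := 1) fun s t => ?_).continuous
  rw [NNReal.coe_one, one_mul, Real.dist_eq]
  exact le_of_tendsto ((tendsto_limitFlow hL hτ hfin hcan e s x).dist
    (tendsto_limitFlow hL hτ hfin hcan e t x))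
    (Eventually.of_forall fun j => dist_truncatedFlow_le hfin hτ _ _ _ _)

/-- Measure preservation, tested on bounded continuous functions, survives pointwise limits.
Invertibility is not claimed, which is why `exists_density` is needed. -/
lemma measurePreserving_limitFlow (hL : ∀ k, 1 ≤ k → 1 ≤ L k) (hτ : ∀ k, 1 ≤ k → 0 < τ k)
    (hfin : FinitenessCondition τ) (hcan : CancellationConditions i L τ) (e : ℕ) (t : ℝ) :
    MeasurePreserving (limitFlow i L τ e t) volume volume := by
  have ht := tendsto_limitFlow (i := i) hL hτ hfin hcan e t
  have hm : Measurable (limitFlow i L τ e t) :=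
    measurable_of_tendsto_metrizable (fun j => (truncatedFlow i L τ (2 * j + e) t).measurable)
      (tendsto_pi_nhds.2 ht)
  refine ⟨hm, ?_⟩
  have : IsProbabilityMeasure (volume.map (limitFlow i L τ e t)) :=
    Measure.isProbabilityMeasure_map hm.aemeasurable
  refine ext_of_forall_integral_eq_of_IsFiniteMeasure fun ψ => ?_
  rw [integral_map hm.aemeasurable ψ.continuous.measurable.aestronglyMeasurable]
  have h1 : Tendsto (fun j => ∫ x, ψ (truncatedFlow i L τ (2 * j + e) t x)) atTop
      (𝓝 (∫ x, ψ (limitFlow i L τ e t x))) := by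
    refine tendsto_integral_of_dominated_convergence (fun _ => ‖ψ‖) (fun j => ?_)
      (integrable_const _) (fun j => Eventually.of_forall fun x => ψ.norm_coe_le_norm _)
      (Eventually.of_forall fun x => (ψ.continuous.tendsto _).comp (ht x))
    exact (ψ.continuous.measurable.comp (truncatedFlow i L τ (2 * j + e) t).measurable)
      |>.aestronglyMeasurable
  have h2 : ∀ j, ∫ x, ψ (truncatedFlow i L τ (2 * j + e) t x) = ∫ x, ψ x := fun j =>
    (measurePreserving_blockFlow (i := i) (L := L) (τ := τ) (2 * j + e) 0 0 t).integral_comp' ψ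
  simp_rw [h2] at h1
  exact (tendsto_nhds_unique h1 tendsto_const_nhds)

lemma limitFlow_of_resolved (hL : ∀ k, 1 ≤ k → 1 ≤ L k) (hτ : ∀ k, 1 ≤ k → 0 < τ k)
    (hfin : FinitenessCondition τ) (hcan : CancellationConditions i L τ) {e j : ℕ} {t : ℝ}
    (ht : t ∉ unresolved (2 * j + e) 0 0) (x : T2) :
    limitFlow i L τ e t x = truncatedFlow i L τ (2 * j + e) t x := by
  refine tendsto_nhds_unique (tendsto_limitFlow hL hτ hfin hcan e t x) ?_
  refine tendsto_const_nhds.congr' ?_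
  filter_upwards [eventually_ge_atTop j] with l hl
  obtain ⟨d, rfl⟩ := Nat.exists_eq_add_of_le hl
  have e1 : 2 * (j + d) + e = 2 * j + e + 2 * d := by ring
  rw [e1, truncatedFlow_eq_of_resolved hL hτ hfin hcan ht]

end

end

section

/-! ### The limits of the truncated solutions -/

lemma measurableSet_unresolved (n k : ℕ) (a : ℝ) : MeasurableSet (unresolved n k a) := by
  induction n generalizing k a with
  | zero => exact measurableSet_Ioo
  | succ n ih => exact (ih _ _).union (ih _ _)

lemma tendsto_two_mul_add (e : ℕ) : Tendsto (fun j : ℕ => 2 * j + e) atTop atTop :=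
  tendsto_atTop_mono (fun j => by simp only [id]; omega) tendsto_id

lemma ae_eventually_resolved (e : ℕ) :
    ∀ᵐ t : ℝ, ∃ j, t ∉ unresolved (2 * j + e) 0 0 := by
  rw [ae_iff]
  push Not
  refine le_antisymm ?_ zero_le
  refine ge_of_tendsto (tendsto_volume_unresolved.comp (tendsto_two_mul_add e))
    (Eventually.of_forall fun j => measure_mono fun t ht => ht j)

variable {i : ℕ → Fin 2} {L : ℕ → ℕ} {τ : ℕ → ℝ}

/-- `f` is the limit of the functions `g` transported by the flows of `u_{2j+e}`. -/
structure IsLimitSol (i : ℕ → Fin 2) (L : ℕ → ℕ) (τ : ℕ → ℝ) (g : T2 → ℝ) (M : ℝ) (e : ℕ)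
    (f : ℝ → T2 → ℝ) : Prop where
  bound : ∀ t x, |f t x| ≤ M
  measurable : ∀ t, Measurable (f t)
  resolved : ∀ j t, t ∉ unresolved (2 * j + e) 0 0 → f t = truncatedSol i L τ g (2 * j + e) t
  integral : ∀ t (ψ : C(T2, ℝ)), ∫ x, f t x * ψ x = ∫ x, g x * ψ (limitFlow i L τ e t x)

/-- At a time resolved at some level the stabilised truncated solution is used, at any other time
the density of `g` transported by the limit flow. Both obey the same integral identity. -/
lemma exists_isLimitSol (hL : ∀ k, 1 ≤ k → 1 ≤ L k) (hτ : ∀ k, 1 ≤ k → 0 < τ k)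
    (hfin : FinitenessCondition τ) (hcan : CancellationConditions i L τ) {g : T2 → ℝ}
    (hg : Measurable g) {M : ℝ} (hM : ∀ x, |g x| ≤ M) (e : ℕ) :
    ∃ f, IsLimitSol i L τ g M e f := by
  have key : ∀ t, ∃ F : T2 → ℝ, (∀ x, |F x| ≤ M) ∧ Measurable F ∧
      (∀ j, t ∉ unresolved (2 * j + e) 0 0 → F = truncatedSol i L τ g (2 * j + e) t) ∧
      ∀ ψ : C(T2, ℝ), ∫ x, F x * ψ x = ∫ x, g x * ψ (limitFlow i L τ e t x) := by
    intro t
    by_cases ht : ∃ j, t ∉ unresolved (2 * j + e) 0 0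
    · obtain ⟨j, hj⟩ := ht
      have heq : ∀ l, t ∉ unresolved (2 * l + e) 0 0 →
          truncatedFlow i L τ (2 * j + e) t = truncatedFlow i L τ (2 * l + e) t := by
        intro l hl
        ext x : 2
        rw [← limitFlow_of_resolved hL hτ hfin hcan hj x,
          limitFlow_of_resolved hL hτ hfin hcan hl x]
      refine ⟨truncatedSol i L τ g (2 * j + e) t, fun x => hM _,
        hg.comp (truncatedFlow i L τ (2 * j + e) t).symm.measurable, fun l hl => ?_, fun ψ => ?_⟩
      · funext x
        rw [truncatedSol, truncatedSol, heq l hl]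
      · have hmp : MeasurePreserving (truncatedFlow i L τ (2 * j + e) t) volume volume :=
          measurePreserving_blockFlow _ _ _ _
        rw [← hmp.integral_comp' (fun x => truncatedSol i L τ g (2 * j + e) t x * ψ x)]
        simp only [truncatedSol, MeasurableEquiv.symm_apply_apply,
          limitFlow_of_resolved hL hτ hfin hcan hj]
    · obtain ⟨F, h1, h2, h3⟩ := exists_density
        (measurePreserving_limitFlow hL hτ hfin hcan e t) hg hM
      exact ⟨F, h2, h1, fun j hj => absurd ⟨j, hj⟩ ht, h3⟩
  choose f h1 h2 h3 h4 using key
  exact ⟨f, h1, h2, fun j t => h3 t j, h4⟩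

namespace IsLimitSol

variable {g : T2 → ℝ} {M : ℝ} {e : ℕ} {f : ℝ → T2 → ℝ}

lemma eventually_eq (hf : IsLimitSol i L τ g M e f) {t : ℝ}
    (ht : ∃ j, t ∉ unresolved (2 * j + e) 0 0) :
    ∀ᶠ j in atTop, truncatedSol i L τ g (2 * j + e) t = f t := by
  obtain ⟨j, hj⟩ := ht
  filter_upwards [eventually_ge_atTop j] with l hl
  exact (hf.resolved l t fun h => hj (unresolved_antitone 0 0 (by omega) h)).symm

lemma ae_eventually_eq (hf : IsLimitSol i L τ g M e f) :
    ∀ᵐ p ∂spaceTime, ∀ᶠ j in atTop, truncatedSol i L τ g (2 * j + e) p.1 = f p.1 := by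
  have h1 : ∀ᵐ t ∂(volume : Measure ℝ).restrict (Icc 0 1), ∃ j, t ∉ unresolved (2 * j + e) 0 0 :=
    ae_restrict_of_ae (ae_eventually_resolved e)
  filter_upwards [(Measure.quasiMeasurePreserving_fst (μ := (volume : Measure ℝ).restrict (Icc 0 1))
    (ν := (volume : Measure T2))).ae h1] with p hp using hf.eventually_eq hp

lemma tendsto_ae (hf : IsLimitSol i L τ g M e f) :
    ∀ᵐ p ∂spaceTime, Tendsto (fun j => truncatedSol i L τ g (2 * j + e) p.1 p.2) atTop
      (𝓝 (f p.1 p.2)) := by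
  filter_upwards [hf.ae_eventually_eq] with p hp
  refine tendsto_const_nhds.congr' ?_
  filter_upwards [hp] with j hj
  rw [hj]

lemma aestronglyMeasurable (hf : IsLimitSol i L τ g M e f) (hg : Measurable g) :
    AEStronglyMeasurable (fun p : ℝ × T2 => f p.1 p.2) spaceTime :=
  aestronglyMeasurable_of_tendsto_ae atTop
    (fun j => (measurable_truncatedSol hg (2 * j + e)).aestronglyMeasurable) hf.tendsto_ae

lemma isLinftyLinfty (hf : IsLimitSol i L τ g M e f) (hg : Measurable g) : IsLinftyLinfty f :=
  memLp_top_of_bound (hf.aestronglyMeasurable hg) M (Eventually.of_forall fun _ => hf.bound _ _)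

/-- Against a continuous `ψ` the pairing is `∫ g · ψ(limitFlow)`, continuous in time by dominated
convergence. Density of such `ψ` in `L¹` and the uniform bound `M` give the general case. -/
lemma isC0WeakStarLinfty (hf : IsLimitSol i L τ g M e f) (hL : ∀ k, 1 ≤ k → 1 ≤ L k)
    (hτ : ∀ k, 1 ≤ k → 0 < τ k) (hfin : FinitenessCondition τ)
    (hcan : CancellationConditions i L τ) (hg : Measurable g) (hM : ∀ x, |g x| ≤ M) :
    IsC0WeakStarLinfty f := by
  have hM0 : 0 ≤ M := (abs_nonneg _).trans (hM 0)
  refine ⟨fun t _ => memLp_top_of_bound (hf.measurable t).aestronglyMeasurable M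
    (Eventually.of_forall fun _ => hf.bound _ _), fun G hG => Continuous.continuousOn ?_⟩
  refine continuous_of_uniform_approx_of_continuous fun u hu => ?_
  obtain ⟨ε, hε, hεu⟩ := Metric.mem_uniformity_dist.1 hu
  obtain ⟨ψ, hψ, hψi⟩ := hG.exists_boundedContinuous_integral_sub_le
    (ε := ε / (2 * (M + 1))) (by positivity)
  refine ⟨fun t => ∫ x, f t x * ψ x, ?_, fun t => hεu ?_⟩
  · have e1 : (fun t => ∫ x, f t x * ψ x) = fun t => ∫ x, g x * ψ (limitFlow i L τ e t x) :=
      funext fun t => hf.integral t ψ.toContinuousMap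
    rw [e1]
    refine continuous_of_dominated (bound := fun _ => M * ‖ψ‖) (fun t => ?_) (fun t => ?_)
      (integrable_const _) ?_
    · exact (hg.mul (ψ.continuous.measurable.comp
        (measurePreserving_limitFlow hL hτ hfin hcan e t).measurable)).aestronglyMeasurable
    · refine Eventually.of_forall fun x => ?_
      rw [norm_mul]
      exact mul_le_mul (hM x) (ψ.norm_coe_le_norm _) (norm_nonneg _) hM0
    · exact Eventually.of_forall fun x => continuous_const.mul
        (ψ.continuous.comp (continuous_limitFlow_time hL hτ hfin hcan e x))
  · have hfm := (hf.measurable t).aestronglyMeasurable (μ := volume)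
    have hfb : ∀ᵐ x : T2, ‖f t x‖ ≤ M := Eventually.of_forall fun x => hf.bound t x
    rw [dist_eq_norm, ← integral_sub (hG.bdd_mul hfm hfb) (hψi.bdd_mul hfm hfb)]
    calc ‖∫ x, (f t x * G x - f t x * ψ x)‖ ≤ ∫ x, M * ‖G x - ψ x‖ := by
          refine norm_integral_le_of_norm_le ((hG.sub hψi).norm.const_mul M)
            (Eventually.of_forall fun x => ?_)
          rw [← mul_sub, norm_mul]
          exact mul_le_mul_of_nonneg_right (hf.bound t x) (norm_nonneg _)
      _ ≤ M * (ε / (2 * (M + 1))) := by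
          rw [integral_const_mul]
          gcongr
      _ < ε := by
          rw [mul_div_assoc', div_lt_iff₀ (by positivity)]
          nlinarith

lemma fractalConvergence (hf : IsLimitSol i L τ g M e f) (hg : Measurable g)
    (hM : ∀ x, |g x| ≤ M) :
    FractalConvergence (fun j => truncatedSol i L τ g (2 * j + e)) f := by
  have hM0 : 0 ≤ M := (abs_nonneg _).trans (hM 0)
  refine ⟨fun G hG => ?_, fun p hp => ?_, fun q hq => ?_, ?_⟩
  · refine tendsto_integral_of_dominated_convergence (fun p => M * ‖G p‖) (fun j => ?_)
      (hG.norm.const_mul M) (fun j => Eventually.of_forall fun p => ?_) ?_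
    · exact (measurable_truncatedSol hg (2 * j + e)).aestronglyMeasurable.mul
        hG.aestronglyMeasurable
    · rw [norm_mul]
      exact mul_le_mul_of_nonneg_right (hM _) (norm_nonneg _)
    · filter_upwards [hf.tendsto_ae] with p hp using hp.mul_const _
  · have hp0 : 0 < p := by linarith
    -- The difference is at most `2 M` and vanishes at all resolved times.
    have hbound : ∀ j, normLpLinfty p (fun t x => truncatedSol i L τ g (2 * j + e) t x - f t x) ≤
        (ENNReal.ofReal (2 * M) ^ p * volume (unresolved (2 * j + e) 0 0)) ^ (1 / p) := by
      intro j
      refine ENNReal.rpow_le_rpow ?_ (by positivity)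
      calc _ ≤ ∫⁻ t in Icc (0 : ℝ) 1, (unresolved (2 * j + e) 0 0).indicator
              (fun _ => ENNReal.ofReal (2 * M) ^ p) t := by
            refine lintegral_mono fun t => ?_
            by_cases ht : t ∈ unresolved (2 * j + e) 0 0
            · rw [indicator_of_mem ht]
              refine ENNReal.rpow_le_rpow ?_ hp0.le
              rw [eLpNorm_exponent_top]
              refine eLpNormEssSup_le_of_ae_bound (Eventually.of_forall fun x => ?_)
              rw [two_mul M]
              exact (norm_sub_le _ _).trans (add_le_add (hM _) (hf.bound t x))
            · have h0 : (fun x => truncatedSol i L τ g (2 * j + e) t x - f t x) = 0 := by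
                rw [hf.resolved j t ht]
                funext x
                simp
              simp only [h0]
              simp [hp0]
        _ ≤ ∫⁻ t, (unresolved (2 * j + e) 0 0).indicator
              (fun _ => ENNReal.ofReal (2 * M) ^ p) t := setLIntegral_le_lintegral _ _
        _ = _ := lintegral_indicator_const (measurableSet_unresolved _ _ _) _
    have hlim : Tendsto (fun j => (ENNReal.ofReal (2 * M) ^ p *
        volume (unresolved (2 * j + e) 0 0)) ^ (1 / p)) atTop (𝓝 0) := by
      have hne : ENNReal.ofReal (2 * M) ^ p ≠ (⊤ : ℝ≥0∞) :=
        ENNReal.rpow_ne_top_of_nonneg hp0.le ENNReal.ofReal_ne_top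
      have h1 := ENNReal.Tendsto.const_mul (a := ENNReal.ofReal (2 * M) ^ p)
        (tendsto_volume_unresolved.comp (tendsto_two_mul_add e)) (Or.inr hne)
      rw [mul_zero] at h1
      have h2 := (ENNReal.continuous_rpow_const (y := 1 / p)).tendsto 0
      rw [ENNReal.zero_rpow_of_pos (by positivity)] at h2
      exact h2.comp h1
    exact tendsto_of_tendsto_of_tendsto_of_le_of_le tendsto_const_nhds hlim (fun _ => zero_le) hbound
  · filter_upwards [eventually_ge_atTop q.1] with j hj t ht
    rw [hf.resolved j t (notMem_unresolved_of_mem_slot hq (by omega) ht)]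
  · refine Eventually.of_forall fun j => ?_
    rw [hf.resolved j 1 (one_notMem_unresolved _)]

/-- At almost every time both the field and the solution are eventually constant in `j`, so the
identity for `β (f^K)` passes to the limit despite the nonlinearity. Only the values of `β` on `[-M,
M]` enter. -/
lemma integral_limit (hf : IsLimitSol i L τ g M e f) (hτ : ∀ k, 1 ≤ k → 0 < τ k)
    (hfin : FinitenessCondition τ) (hg : Measurable g) (hM : ∀ x, |g x| ≤ M) {β : ℝ → ℝ}
    (hβ : Continuous β) {φ : ℝ → T2 → ℝ} (hφ : IsTestFunction φ) :
    ∫ p, β (f p.1 p.2) * materialDeriv (limitField i L τ) φ p.1 p.2 ∂spaceTime =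
      - ∫ x, β (g x) * φ 0 x := by
  obtain ⟨C, hC⟩ := hφ.exists_bound
  obtain ⟨B, hB⟩ := (isCompact_Icc (a := -M) (b := M)).exists_bound_of_continuousOn hβ.continuousOn
  have hB' : ∀ x, |β (g x)| ≤ B := fun x => hB _ (abs_le.1 (hM x))
  have hlim : Tendsto (fun j => ∫ p, β (truncatedSol i L τ g (2 * j + e) p.1 p.2) *
      materialDeriv (truncatedField i L τ (2 * j + e)) φ p.1 p.2 ∂spaceTime) atTop
      (𝓝 (∫ p, β (f p.1 p.2) * materialDeriv (limitField i L τ) φ p.1 p.2 ∂spaceTime)) := by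
    refine tendsto_integral_of_dominated_convergence (fun _ => B * C) (fun j => ?_)
      (integrable_const _) (fun j => ?_) ?_
    · exact ((hβ.measurable.comp (measurable_truncatedSol hg (2 * j + e))).mul
        (hφ.measurable_materialDeriv (measurable_truncatedField hfin _))).aestronglyMeasurable
    · filter_upwards [ae_spaceTime_mem] with p hp
      rw [norm_mul]
      exact mul_le_mul (hB' _) (hC _ _ _ hp (norm_fractalField_le _ _ _)) (norm_nonneg _)
        ((abs_nonneg _).trans (hB' 0))
    · filter_upwards [hf.ae_eventually_eq] with p hp
      refine tendsto_const_nhds.congr' ?_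
      filter_upwards [hp, (tendsto_two_mul_add e).eventually
        (eventually_truncatedField_eq (i := i) (L := L) hfin p.1)] with j h1 h2
      simp only [materialDeriv, advect, h1, h2]
  have hconst : ∀ j, ∫ p, β (truncatedSol i L τ g (2 * j + e) p.1 p.2) *
      materialDeriv (truncatedField i L τ (2 * j + e)) φ p.1 p.2 ∂spaceTime =
        - ∫ x, β (g x) * φ 0 x := fun j =>
    integral_truncated hfin hτ (2 * j + e) (hβ.measurable.comp hg) hB' hφ
  simp_rw [hconst] at hlim
  exact tendsto_nhds_unique tendsto_const_nhds hlim |>.symm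

lemma isRenormalised (hf : IsLimitSol i L τ g M e f) (hτ : ∀ k, 1 ≤ k → 0 < τ k)
    (hfin : FinitenessCondition τ) (hg : Measurable g) (hM : ∀ x, |g x| ≤ M) {f₀ : T2 → ℝ}
    (he : f₀ =ᵐ[volume] g) : IsRenormalised (limitField i L τ) f₀ f := by
  have hum : Measurable fun p : ℝ × T2 => limitField i L τ p.1 p.2 :=
    measurable_fractalField hfin subset_rfl
  have hu1 : ∀ t x, ‖limitField i L τ t x‖ ≤ 1 := norm_fractalField_le _
  have hdiv : IsDivFree (limitField i L τ) := by
    refine isDivFree_of_integral hum hu1 fun φ hφ => ?_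
    have := hf.integral_limit hτ hfin hg hM (β := fun _ => 1) continuous_const hφ
    simpa using this
  have key : ∀ β : ℝ → ℝ, Continuous β →
      IsWeakSolution (limitField i L τ) (fun x => β (f₀ x)) (fun t x => β (f t x)) := by
    intro β hβ
    obtain ⟨B, hB⟩ := (isCompact_Icc (a := -M) (b := M)).exists_bound_of_continuousOn
      hβ.continuousOn
    refine IsWeakSolution.congr_data (g₀ := fun x => β (g x)) ?_ (he.fun_comp β)
    exact isWeakSolution_of_integral hum hu1 hdiv
      (integrable_of_bounded (hβ.measurable.comp hg) fun x => hB _ (abs_le.1 (hM x)))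
      (hβ.comp_aestronglyMeasurable (hf.aestronglyMeasurable hg))
      (fun t x => hB _ (abs_le.1 (hf.bound t x))) fun φ hφ => hf.integral_limit hτ hfin hg hM hβ hφ
  exact ⟨key id continuous_id, fun β hβ _ => key β hβ⟩

end IsLimitSol

end

section

/-! ### The two limits are different -/

/-- Two weak-* continuous curves that agree almost everywhere agree at all times. -/
lemma ae_eq_of_isC0WeakStarLinfty {f g : ℝ → T2 → ℝ} (hf : IsC0WeakStarLinfty f)
    (hg : IsC0WeakStarLinfty g) (h : Function.uncurry f =ᵐ[spaceTime] Function.uncurry g)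
    {t : ℝ} (ht : t ∈ Icc (0 : ℝ) 1) : f t =ᵐ[volume] g t := by
  have hs : ∀ᵐ s ∂(volume : Measure ℝ).restrict (Icc 0 1), f s =ᵐ[volume] g s :=
    Measure.ae_ae_of_ae_prod h
  have hfi := (hf.1 t ht).integrable le_top
  have hgi := (hg.1 t ht).integrable le_top
  have key : (fun x => f t x - g t x) =ᵐ[volume] 0 := by
    refine ae_eq_zero_of_forall_integral_mul_continuous (hfi.sub hgi) fun ψ => ?_
    have hb := fun w : T2 → ℝ => fun hw : Integrable w volume =>
      hw.mul_bdd (c := ‖ψ‖) ψ.continuous.measurable.aestronglyMeasurable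
        (Eventually.of_forall fun x => ψ.norm_coe_le_norm x)
    have hψ : Integrable ψ (volume : Measure T2) :=
      Integrable.of_bound ψ.continuous.measurable.aestronglyMeasurable ‖ψ‖
        (Eventually.of_forall fun x => ψ.norm_coe_le_norm x)
    -- For each `ψ` the two pairings are continuous functions of time that agree almost everywhere,
    -- hence everywhere on `[0,1]`.
    have heq := Measure.eqOn_Icc_of_ae_eq (μ := (volume : Measure ℝ)) zero_ne_one
      (f := fun s => ∫ x, f s x * ψ x) (g := fun s => ∫ x, g s x * ψ x)
      (by filter_upwards [hs] with s hs
          exact integral_congr_ae (hs.mono fun x hx => by simp only [hx]))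
      (hf.2 ψ hψ) (hg.2 ψ hψ) ht
    simp only [sub_mul]
    rw [integral_sub (hb _ hfi) (hb _ hgi), sub_eq_zero]
    exact heq
  filter_upwards [key] with x hx
  exact sub_eq_zero.1 hx

/-- The start of the last unresolved block is resolved. -/
lemma last_notMem_unresolved (n k : ℕ) (a : ℝ) :
    a + slotLen k - slotLen (k + n) ∉ unresolved n k a := by
  induction n generalizing k a with
  | zero => exact fun h => by have := h.1; simp at this
  | succ n ih =>
    have h4 : slotLen k = 4 * slotLen (k + 1) := by rw [slotLen_succ]; ring
    have hle : slotLen (k + (n + 1)) ≤ slotLen (k + 1) := by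
      rw [slotLen_eq, slotLen_eq]
      exact pow_le_pow_of_le_one (by norm_num) (by norm_num) (by omega)
    have hd := slotLen_pos (k + 1)
    rintro (h | h)
    · have h2 : _ < _ := (unresolved_antitone (k + 1) _ (Nat.zero_le n) h).2
      linarith
    · refine ih (k + 1) (a + 3 * slotLen (k + 1)) ?_
      convert h using 1
      rw [h4, add_right_comm k 1 n, add_assoc k n 1]
      ring

/-- A function that is invariant under a shear is invariant under the corresponding translation. -/
lemma ae_eq_translate_of_ae_eq_shearFlow {g : T2 → ℝ} {i : Fin 2} {L : ℕ} {t : ℝ}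
    (h : (fun x => g (shearFlow i L (-t) x)) =ᵐ[volume] g) :
    (fun x => g (translate i t x)) =ᵐ[volume] g := by
  have h' := (measurePreserving_translate i t).quasiMeasurePreserving.ae h
  filter_upwards [h, h'] with x hx hx'
  -- On negative stripes the shear for time `-t` is already translation by `t`. On positive stripes
  -- it is the inverse translation, so the invariance is used at the translated point.
  by_cases hm : x ∈ posStripes i L
  · rw [shearFlow_of_mem ((translate_mem_posStripes i L t x).2 hm)] at hx'
    rw [← hx']
    congr 1
    simp [translate, add_assoc, ← Pi.single_add]
  · rw [shearFlow_of_notMem hm, neg_neg] at hx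
    exact hx

/-- The group of translations which leave `g` invariant. -/
def invariantTranslations (g : T2 → ℝ) : AddSubgroup T2 where
  carrier := {v | (fun x => g (v + x)) =ᵐ[volume] g}
  zero_mem' := by simp
  add_mem' {v w} hv hw := by
    change _ =ᵐ[volume] _
    have h := (measurePreserving_add_left (volume : Measure T2) w).quasiMeasurePreserving.ae hv
    filter_upwards [h, hw] with x h1 h2
    rw [add_assoc, h1, h2]
  neg_mem' {v} hv := by
    change _ =ᵐ[volume] _
    have h := (measurePreserving_add_left (volume : Measure T2) (-v)).quasiMeasurePreserving.ae hv
    filter_upwards [h] with x hx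
    rw [← hx, add_neg_cancel_left]

/-- Each preimage under `g` of a measurable set is almost invariant under a dense set of
translations, hence null or conull by ergodicity. -/
lemma ae_const_of_dense_invariantTranslations {g : T2 → ℝ} (hg : Measurable g)
    (h : Dense (invariantTranslations g : Set T2)) : ∃ c : ℝ, g =ᵐ[volume] fun _ => c := by
  refine exists_eventuallyEq_const_of_forall_separating MeasurableSet fun U hU => ?_
  have : ErgodicVAdd T2 T2 volume := instErgodicVAddOfIsAddLeftInvariant
  have hc : EventuallyConst (g ⁻¹' U) (ae (volume : Measure T2)) := by
    refine aeconst_of_dense_setOfPred_preimage_vadd_ae (M := T2) (hg hU).nullMeasurableSet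
      (h.mono fun v hv => ?_)
    have hv' : (fun x => g (v + x)) =ᵐ[volume] g := hv
    filter_upwards [hv'] with x hx
    have : (g (v + x) ∈ U) = (g x ∈ U) := by rw [hx]
    exact this
  exact eventuallyConst_pred.1 hc

lemma ae_const_of_forall_translate {g : T2 → ℝ} (hg : Measurable g) {i : ℕ → Fin 2} {s : ℕ → ℝ}
    (hi : ∀ k, i (k + 1) ≠ i k) (hs : ∀ k, 0 < s k) (hs0 : Tendsto s atTop (𝓝 0))
    (h : ∀ k, (fun x => g (translate (i k) (s k) x)) =ᵐ[volume] g) :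
    ∃ c : ℝ, g =ᵐ[volume] fun _ => c := by
  refine ae_const_of_dense_invariantTranslations hg ?_
  have hmem : ∀ k, Pi.single (i k) (s k : UnitAddCircle) ∈ invariantTranslations g := by
    intro k
    filter_upwards [h k] with x hx
    rw [add_comm]
    exact hx
  let G : Fin 2 → AddSubgroup ℝ := fun j => (invariantTranslations g).comap
    ((AddMonoidHom.single (fun _ : Fin 2 => UnitAddCircle) j).comp
      (QuotientAddGroup.mk' (AddSubgroup.zmultiples (1 : ℝ))))
  have hG : ∀ j, Dense (G j : Set ℝ) := by
    intro j
    refine AddSubgroup.dense_of_not_isolated_zero _ fun ε hε => ?_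
    obtain ⟨N, hN⟩ := eventually_atTop.1 (hs0.eventually_lt_const hε)
    -- Directions alternate, so both occur among the indices `N` and `N + 1`; thus each axis admits
    -- arbitrarily small invariant steps.
    have : ∃ k ≥ N, i k = j := by
      by_cases hj : i N = j
      · exact ⟨N, le_rfl, hj⟩
      · refine ⟨N + 1, Nat.le_succ N, ?_⟩
        rw [eq_one_sub_of_ne (hi N), eq_one_sub_of_ne (Ne.symm hj)]
    obtain ⟨k, hk, rfl⟩ := this
    exact ⟨s k, hmem k, hs k, hN k hk⟩
  have hd : Dense (toT2 '' univ.pi fun j => (G j : Set ℝ)) := by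
    refine toT2_surjective.denseRange.dense_image ?_ (dense_pi univ fun j _ => hG j)
    exact continuous_pi fun j => (AddCircle.continuous_mk' 1).comp (continuous_apply j)
  refine hd.mono ?_
  rintro _ ⟨x, hx, rfl⟩
  have : toT2 x = ∑ j, Pi.single j (x j : UnitAddCircle) :=
    (Finset.univ_sum_single (toT2 x)).symm
  rw [this]
  exact sum_mem fun j _ => hx j (mem_univ j)

variable {i : ℕ → Fin 2} {L : ℕ → ℕ} {τ : ℕ → ℝ} {g : T2 → ℝ} {M : ℝ}

lemma truncatedSol_last (hτ : ∀ k, 1 ≤ k → 0 < τ k) (hfin : FinitenessCondition τ) (K : ℕ)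
    (x : T2) :
    truncatedSol i L τ g (K + 1) 1 x = truncatedSol i L τ g (K + 1) (1 - slotLen K)
      (shearFlow (i (K + 1)) (L (K + 1)) (-(2 * τ (K + 1))) x) ∧
    truncatedSol i L τ g K 1 x = truncatedSol i L τ g K (1 - slotLen K) x := by
  have h1 := fun y => (blockFlow_last (i := i) (L := L) hτ hfin K 0 0 y).1
  have h2 := fun y => (blockFlow_last (i := i) (L := L) hτ hfin K 0 0 y).2
  simp only [zero_add, slotLen_zero] at h1 h2
  unfold truncatedSol truncatedFlow
  constructor
  · congr 1
    rw [MeasurableEquiv.symm_apply_eq, h1, MeasurableEquiv.apply_symm_apply, shearFlow_add]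
    simp
  · congr 1
    rw [MeasurableEquiv.symm_apply_eq, h2, MeasurableEquiv.apply_symm_apply]

/-- If the limits agree, parity no longer matters: every truncated solution equals the common curve
at its resolved times, such as `1 - 4^{-K}` and `1`. Level `K` shows that the curve equals `g` at
both; level `K + 1` then makes `g` invariant under the net shear between them. -/
lemma IsLimitSol.ae_eq_const {fEven fOdd : ℝ → T2 → ℝ} (hE : IsLimitSol i L τ g M 0 fEven)
    (hO : IsLimitSol i L τ g M 1 fOdd) (hτ : ∀ k, 1 ≤ k → 0 < τ k)
    (hfin : FinitenessCondition τ) (hi : ∀ k, 1 ≤ k → i (k + 1) ≠ i k) (hg : Measurable g)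
    (h : ∀ t ∈ Icc (0 : ℝ) 1, fEven t =ᵐ[volume] fOdd t) : ∃ c : ℝ, g =ᵐ[volume] fun _ => c := by
  have hsol : ∀ K, ∀ t ∈ Icc (0 : ℝ) 1, t ∉ unresolved K 0 0 →
      truncatedSol i L τ g K t =ᵐ[volume] fEven t := by
    intro K t ht hK
    obtain ⟨j, rfl | rfl⟩ := K.even_or_odd'
    · rw [hE.resolved j t hK]; rfl
    · rw [← hO.resolved j t hK]
      exact (h t ht).symm
  -- Time `1` is resolved already at level `0`, where the flow is the identity.
  have hone : fEven 1 = g := by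
    rw [hE.resolved 0 1 (one_notMem_unresolved _)]; rfl
  have hinv : ∀ K, (fun x => g (shearFlow (i (K + 1)) (L (K + 1)) (-(2 * τ (K + 1))) x))
      =ᵐ[volume] g := by
    intro K
    have hle : slotLen K ≤ 1 := by
      rw [slotLen_eq]; exact pow_le_one₀ (by norm_num) (by norm_num)
    have hmem : 1 - slotLen K ∈ Icc (0 : ℝ) 1 := ⟨by linarith, by linarith [slotLen_pos K]⟩
    have hres : 1 - slotLen K ∉ unresolved K 0 0 := by
      simpa [slotLen_zero] using last_notMem_unresolved K 0 0
    have h1mem : (1 : ℝ) ∈ Icc (0 : ℝ) 1 := ⟨zero_le_one, le_rfl⟩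
    have hlast := truncatedSol_last (i := i) (L := L) (g := g) hτ hfin K
    have e1 : fEven (1 - slotLen K) =ᵐ[volume] g := by
      have a1 := hsol K _ hmem hres
      have a2 := hsol K 1 h1mem (one_notMem_unresolved K)
      rw [hone] at a2
      rw [← funext fun x => (hlast x).2] at a1
      exact a1.symm.trans a2
    have e2 : truncatedSol i L τ g (K + 1) (1 - slotLen K) =ᵐ[volume] g :=
      (hsol (K + 1) _ hmem fun hm => hres (unresolved_succ_subset K 0 0 hm)).trans e1
    have e3 := hsol (K + 1) 1 h1mem (one_notMem_unresolved _)
    rw [hone] at e3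
    have e4 := (measurePreserving_shearFlow (i (K + 1)) (L (K + 1))
      (-(2 * τ (K + 1)))).quasiMeasurePreserving.ae e2
    filter_upwards [e3, e4] with x h3 h4
    rw [← h4, ← (hlast x).1, h3]
  refine ae_const_of_forall_translate hg (i := fun k => i (k + 1)) (s := fun k => 2 * τ (k + 1))
    (fun k => hi (k + 1) (by omega)) (fun k => by linarith [hτ (k + 1) (by omega)]) ?_
    fun k => ae_eq_translate_of_ae_eq_shearFlow (hinv k)
  have hlim : Tendsto (fun k => 2 * slotLen (k + 1)) atTop (𝓝 0) := by
    simpa using (tendsto_slotLen.comp (tendsto_add_atTop_nat 1)).const_mul 2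
  refine squeeze_zero (fun k => by linarith [hτ (k + 1) (by omega)]) (fun k => ?_) hlim
  have := hfin (k + 1) (by omega)
  exact mul_le_mul_of_nonneg_left this.le zero_le_two

lemma IsLimitSol.odd_one {f : ℝ → T2 → ℝ} (hf : IsLimitSol i L τ g M 1 f)
    (hτ : ∀ k, 1 ≤ k → 0 < τ k) (hfin : FinitenessCondition τ) (x : T2) :
    f 1 x = g (shearFlow (i 1) (L 1) (-2 * τ 1) x) := by
  rw [hf.resolved 0 1 (one_notMem_unresolved _)]
  unfold truncatedSol truncatedFlow
  congr 1
  rw [MeasurableEquiv.symm_apply_eq]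
  change x = blockFlow i L τ 1 0 0 1 _
  rw [blockFlow_one_apply_of_ge hτ hfin 0 (by simp [slotLen_zero]), shearFlow_add]
  simp

end

end FractalShear

end

/-! ### Assembly of the proposition -/

theorem proposition4p5 (i : ℕ → Fin 2) (L : ℕ → ℕ) (τ : ℕ → ℝ)
    (hL : ∀ k, 1 ≤ k → 1 ≤ L k) (hτ : ∀ k, 1 ≤ k → 0 < τ k)
    (hfin : FractalShear.FinitenessCondition τ)
    (f₀ : FractalShear.T2 → ℝ) (hf₀ : MemLp f₀ ⊤ volume) :
    ∃ f : ℕ → ℝ → FractalShear.T2 → ℝ,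
      (∀ K, 1 ≤ K →
        FractalShear.IsWeakSolution (FractalShear.truncatedField i L τ K) f₀ (f K) ∧
        (∀ g : ℝ → FractalShear.T2 → ℝ,
          FractalShear.IsWeakSolution (FractalShear.truncatedField i L τ K) f₀ g →
          Function.uncurry g =ᵐ[FractalShear.spaceTime] Function.uncurry (f K)) ∧
        FractalShear.IsC0L1 (f K) ∧
        FractalShear.IsLinftyLinfty (f K) ∧
        FractalShear.IsLagrangianSolution (FractalShear.truncatedField i L τ K) f₀ (f K) ∧
        FractalShear.IsRenormalised (FractalShear.truncatedField i L τ K) f₀ (f K)) ∧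
      (FractalShear.CancellationConditions i L τ →
        ∃ fEven fOdd : ℝ → FractalShear.T2 → ℝ,
          FractalShear.IsLinftyLinfty fEven ∧ FractalShear.IsLinftyLinfty fOdd ∧
          FractalShear.IsC0WeakStarLinfty fEven ∧ FractalShear.IsC0WeakStarLinfty fOdd ∧
          FractalShear.FractalConvergence (fun K => f (2 * K)) fEven ∧
          FractalShear.FractalConvergence (fun K => f (2 * K + 1)) fOdd ∧
          FractalShear.IsRenormalised (FractalShear.limitField i L τ) f₀ fEven ∧
          FractalShear.IsRenormalised (FractalShear.limitField i L τ) f₀ fOdd ∧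
          fEven 1 =ᵐ[volume] f₀ ∧
          fOdd 1 =ᵐ[volume] (fun x => f₀ (FractalShear.shearFlow (i 1) (L 1) (-2 * τ 1) x)) ∧
          ((¬ ∃ c : ℝ, f₀ =ᵐ[volume] fun _ => c) →
            ¬ Function.uncurry fEven =ᵐ[FractalShear.spaceTime] Function.uncurry fOdd)) := by
  obtain ⟨g, M, hg, hM, he⟩ := FractalShear.exists_bounded_representative hf₀
  refine ⟨FractalShear.truncatedSol i L τ g, fun K _ => ?_, fun hcan => ?_⟩
  · have hw := (FractalShear.isWeakSolution_truncatedSol (i := i) (L := L) hfin hτ hg hM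
      K).congr_data he
    exact ⟨hw, fun f hf => FractalShear.weakSolution_unique hL hfin hw hf,
      FractalShear.isC0L1_truncatedSol hg hM K, FractalShear.isLinftyLinfty_truncatedSol hg hM K,
      FractalShear.isLagrangianSolution_truncatedSol hfin hτ he hg hM K,
      FractalShear.isRenormalised_truncatedSol hfin hτ he hg hM K⟩
  obtain ⟨fEven, hE⟩ := FractalShear.exists_isLimitSol hL hτ hfin hcan hg hM 0
  obtain ⟨fOdd, hO⟩ := FractalShear.exists_isLimitSol hL hτ hfin hcan hg hM 1
  have hEc := hE.isC0WeakStarLinfty hL hτ hfin hcan hg hM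
  have hOc := hO.isC0WeakStarLinfty hL hτ hfin hcan hg hM
  refine ⟨fEven, fOdd, hE.isLinftyLinfty hg, hO.isLinftyLinfty hg, hEc, hOc,
    hE.fractalConvergence hg hM, hO.fractalConvergence hg hM, hE.isRenormalised hτ hfin hg hM he,
    hO.isRenormalised hτ hfin hg hM he, ?_, ?_, fun hne heq => hne ?_⟩
  · rw [hE.resolved 0 1 (FractalShear.one_notMem_unresolved _)]
    exact he.symm
  · have h := (FractalShear.measurePreserving_shearFlow (i 1) (L 1)
      (-2 * τ 1)).quasiMeasurePreserving.ae he
    filter_upwards [h] with x hx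
    rw [hO.odd_one hτ hfin x, hx]
  · obtain ⟨c, hc⟩ := hE.ae_eq_const hO hτ hfin (fun k hk => (hcan k hk).1) hg
      fun t ht => FractalShear.ae_eq_of_isC0WeakStarLinfty hEc hOc heq ht
    exact ⟨c, he.trans hc⟩
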